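/- Notation. $\mathbb N=\{0,1,2,\dots\}$, $\Sigma^*$ is the set of finite binary strings, "recursive" means total recursive. A family $(r_x)$ of rationals, with $x$ in $\mathbb N$, $\Sigma^*$ or a finite product of these, is computable if $r_x=(-1)^{s(x)}a(x)/b(x)$ with recursive $a,b,s$ into $\mathbb N$ and $b(x)\neq0$; a family $(t_x)$ of reals is computable if there is a computable family of rationals $(r_{x,k})$ with $|r_{x,k}-t_x|\le2^{-k}$ for all $x$ and $k\in\mathbb N$; a family of complex numbers is computable if its real and imaginary parts are. A function into $\mathbb Q+i\mathbb Q$ is recursive if its real and imaginary parts are computable families of rationals. Let $X$ be an infinite-dimensional complex Hilbert space, with inner product linear in the first variable. A (Pour-El–Richards) computability structure on $X$ is a nonempty set $\varphi$ of sequences $(x_n)_{n\in\mathbb N}$ in $X$, called the computable sequences, such that: 1. (Linear forms) if $(x_n),(y_n)\in\varphi$, $(\alpha_{nk}),(\beta_{nk})$ are computable double sequences of complex numbers and $d:\mathbb N\to\mathbb N$ is recursive, then $\bigl(\sum_{k=0}^{d(n)}(\alpha_{nk}x_k+\beta_{nk}y_k)\bigr)_n\in\varphi$; 2. (Limits) if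 a double sequence $(x_{nm})$ in $X$ is computable (that is, it is mapped into $\varphi$ by a recursive bijection $\mathbb N\to\mathbb N\times\mathbb N$), $e:\mathbb N\times\mathbb N\to\mathbb N$ is recursive and $\|x_{n\,e(n,k)}-y_n\|\le2^{-k}$ for all $n,k$, then $(y_n)\in\varphi$; 3. (Norms) if $(x_n)\in\varphi$, then $(\|x_n\|)$ is a computable sequence of reals. The pair $(X,\varphi)$ is effectively separable if some sequence in $\varphi$ has a dense linear span; a computable orthonormal basis is an orthonormal sequence in $\varphi$ with dense linear span. For bounded Hermitian operators write $S\leqslant T$ if $T-S$ is positive. A semi-POVM on $\Sigma^*$ is a map $R$ from $\Sigma^*$ to the positive bounded operators on $X$ such that $\sum_{s\in\Sigma^*}R(s)$ converges strongly to an operator $\leqslant I$. It is lower-computable if there are a computable orthonormal basis $(e_i)_{i\in\mathbb N}$ of $X$, positive bounded operators $f(n,s)$ ($n\in\mathbb N$, $s\in\Sigma^*$), and a recursive $g:\mathbb N\times\Sigma^*\to\mathbb N$ such that (i) for each $s$, $f(n,s)$ converges strongly to $R(s)$ as $n\to\infty$; (ii) $f(n,s)-2^{-n}I\leqslant f(n+1,s)-2^{-(n+1)}I$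 for all $n,s$; (iii) for all $n,s,k,l$, $\langle f(n,s)e_k,e_l\rangle\in\mathbb Q+i\mathbb Q$, and it is $0$ if $k\ge g(n,s)$ or $l\ge g(n,s)$; (iv) $(n,s,i,j)\mapsto\langle f(n,s)e_i,e_j\rangle$ is a recursive function into $\mathbb Q+i\mathbb Q$. A universal semi-POVM is a lower-computable semi-POVM $M$ on $\Sigma^*$ such that for every lower-computable semi-POVM $R$ on $\Sigma^*$ there is a real $c>0$ with $cR(s)\leqslant M(s)$ for all $s\in\Sigma^*$. **Theorem.** Let $X$ be an infinite-dimensional complex Hilbert space and $\varphi$ a computability structure on $X$ such that $(X,\varphi)$ is effectively separable. Then there exists a universal semi-POVM on $\Sigma^*$. -/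

import Mathlib

/-! Sequences are indexed by `ℕ = {0, 1, 2, …}`; `Σ*` is `List Bool`.  "Recursive" is Mathlib's
`Computable`, "bounded operator" is `X →L[ℂ] X`, and `≤` between operators is the Loewner order. -/

/-- A computable family of rational numbers: `r x = (-1) ^ s x * a x / b x` with total recursive
functions `a`, `b`, `s` into `ℕ` and `b` without zeros. -/
def IsComputableRat {α : Type*} [Primcodable α] (r : α → ℚ) : Prop :=
  ∃ a b s : α → ℕ, Computable a ∧ Computable b ∧ Computable s ∧
    ∀ x, b x ≠ 0 ∧ r x = (-1) ^ s x * (a x : ℚ) / (b x : ℚ)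

/-- A computable family of real numbers: approximable within `2⁻ᵏ` by a computable family of
rational numbers, uniformly in the index. -/
def IsComputableReal {α : Type*} [Primcodable α] (t : α → ℝ) : Prop :=
  ∃ r : α × ℕ → ℚ, IsComputableRat r ∧ ∀ x k, |(r (x, k) : ℝ) - t x| ≤ (2⁻¹ : ℝ) ^ k

/-- A computable family of complex numbers. -/
def IsComputableComplex {α : Type*} [Primcodable α] (z : α → ℂ) : Prop :=
  IsComputableReal (fun x => (z x).re) ∧ IsComputableReal (fun x => (z x).im)

/-- The complex number `z` lies in `ℚ + iℚ`. -/
def IsComplexRational (z : ℂ) : Prop :=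
  ∃ p q : ℚ, z = (p : ℂ) + (q : ℂ) * Complex.I

/-- `z` is a total recursive function with values in `ℚ + iℚ`. -/
def IsRecursiveComplexRational {α : Type*} [Primcodable α] (z : α → ℂ) : Prop :=
  ∃ p q : α → ℚ, IsComputableRat p ∧ IsComputableRat q ∧
    ∀ x, z x = (p x : ℂ) + (q x : ℂ) * Complex.I

/-- A computability structure (Pour-El and Richards) on a complex normed space: a nonempty set of
sequences, called the computable sequences, subject to the axioms on linear forms, limits and norms.
A double sequence is computable if its composition with the recursive bijection
`Nat.unpair : ℕ → ℕ × ℕ` is. -/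
structure ComputabilityStructure (X : Type*) [NormedAddCommGroup X] [NormedSpace ℂ X] where
  /-- the computable sequences -/
  seqs : Set (ℕ → X)
  nonempty : seqs.Nonempty
  linear_forms : ∀ x ∈ seqs, ∀ y ∈ seqs, ∀ a b : ℕ × ℕ → ℂ,
    IsComputableComplex a → IsComputableComplex b → ∀ d : ℕ → ℕ, Computable d →
    (fun n => ∑ k ∈ Finset.range (d n + 1), (a (n, k) • x k + b (n, k) • y k)) ∈ seqs
  limits : ∀ (x : ℕ → ℕ → X) (y : ℕ → X) (e : ℕ × ℕ → ℕ),
    (fun n => x n.unpair.1 n.unpair.2) ∈ seqs → Computable e →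
    (∀ n k, ‖x n (e (n, k)) - y n‖ ≤ (2⁻¹ : ℝ) ^ k) → y ∈ seqs
  norms : ∀ x ∈ seqs, IsComputableReal (fun n => ‖x n‖)

/-- The finite linear combinations of the terms of `e` are dense. -/
def IsGeneratingSet {X : Type*} [NormedAddCommGroup X] [NormedSpace ℂ X] (e : ℕ → X) : Prop :=
  Dense (Submodule.span ℂ (Set.range e) : Set X)

/-- Some computable sequence is a generating set. -/
def ComputabilityStructure.IsEffectivelySeparable {X : Type*} [NormedAddCommGroup X]
    [NormedSpace ℂ X] (φ : ComputabilityStructure X) : Prop :=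
  ∃ e ∈ φ.seqs, IsGeneratingSet e

section SemiPOVM

variable {X : Type*} [NormedAddCommGroup X] [InnerProductSpace ℂ X] [CompleteSpace X]

/-- A computable orthonormal basis of the Hilbert space `X`. -/
def IsComputableOrthonormalBasis (φ : ComputabilityStructure X) (e : ℕ → X) : Prop :=
  e ∈ φ.seqs ∧ Orthonormal ℂ e ∧ IsGeneratingSet e

/-- A semi-POVM on `Σ*`: positive operators whose sum converges strongly to an operator `≤ I`. -/
def IsSemiPOVM (R : List Bool → X →L[ℂ] X) : Prop :=
  (∀ s, (R s).IsPositive) ∧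
    ∃ S : X →L[ℂ] X, (∀ x, HasSum (fun s => R s x) (S x)) ∧ S ≤ 1

/-- `T` is an `m`-square rational operator on `e`: its matrix vanishes outside the first `m` rows
and columns (those with index `< m`), and its entries are in `ℚ + iℚ`. -/
def IsSquareRationalOperator (e : ℕ → X) (m : ℕ) (T : X →L[ℂ] X) : Prop :=
  (∀ k l, m ≤ k ∨ m ≤ l → inner ℂ (e l) (T (e k)) = 0) ∧
    ∀ k l, IsComplexRational (inner ℂ (e l) (T (e k)))

/-- The family `R` is lower-computable with respect to the orthonormal basis `e`.  Mathlib's inner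
product is linear in the second variable, so `inner ℂ (e j) (T (e i))` is the matrix entry
`⟨T eᵢ, eⱼ⟩` for an inner product that is linear in the first variable. -/
def IsLowerComputableWrt (e : ℕ → X) (R : List Bool → X →L[ℂ] X) : Prop :=
  ∃ (f : ℕ → List Bool → X →L[ℂ] X) (g : ℕ × List Bool → ℕ),
    (∀ n s, (f n s).IsPositive) ∧ Computable g ∧
    (∀ s x, Filter.Tendsto (fun n => f n s x) Filter.atTop (nhds (R s x))) ∧
    (∀ n s, f n s - ((2⁻¹ : ℂ) ^ n) • (1 : X →L[ℂ] X) ≤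
      f (n + 1) s - ((2⁻¹ : ℂ) ^ (n + 1)) • (1 : X →L[ℂ] X)) ∧
    (∀ n s, IsSquareRationalOperator e (g (n, s)) (f n s)) ∧
    IsRecursiveComplexRational (fun p : ℕ × List Bool × ℕ × ℕ =>
      inner ℂ (e p.2.2.2) (f p.1 p.2.1 (e p.2.2.1)))

/-- A lower-computable semi-POVM on `Σ*`. -/
def IsLowerComputableSemiPOVM (φ : ComputabilityStructure X) (R : List Bool → X →L[ℂ] X) : Prop :=
  IsSemiPOVM R ∧ ∃ e, IsComputableOrthonormalBasis φ e ∧ IsLowerComputableWrt e R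

/-- A universal semi-POVM on `Σ*`. -/
def IsUniversalSemiPOVM (φ : ComputabilityStructure X) (M : List Bool → X →L[ℂ] X) : Prop :=
  IsLowerComputableSemiPOVM φ M ∧
    ∀ R : List Bool → X →L[ℂ] X, IsLowerComputableSemiPOVM φ R →
      ∃ c : ℝ, 0 < c ∧ ∀ s, (c : ℂ) • R s ≤ M s

end SemiPOVM

/-!
The theorem is an operator version of the existence of a universal lower-computable semimeasure,
but two points are new: the order is the Loewner order of operators, and different semi-POVMs may
be lower-computable with respect to different computable orthonormal bases.

Codes make everything exact. A list of Gaussian rational coefficients codes a vector `vec e v`, and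
a list `l` of such codes codes the operator `opOf e l = ∑ |v⟩⟨v|` over `v ∈ l`. By taking Schur
complements one row at a time and writing nonnegative rationals as sums of four squares, every
positive operator with a finite rational matrix is of the form `opOf e l` (`exists_opOf_eq`), and
since equality of rational matrices is decidable, `l` can be found effectively
(`exists_computable_opOf_eq`). Positivity of an operator thus becomes a matter of search.

A lower-computable semi-POVM `R` is then dominated, up to a constant, by a computable sequence of
items `(s, l)`: `R s` lies below a multiple of the sum of `opOf e l` over the items labelled `s`.
The condition `∑ opOf e l ≤ 1` has a finite witness for each initial segment of the sequence: a
code of the operator that completes the partial sum to a projection onto finitely many basis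
vectors. Hence the admissible item sequences can be enumerated effectively
(`exists_universal_enumeration`), and the mixture of all of them with weights `2⁻ⁱ⁻¹` is
lower-computable for the fixed basis `e` and dominates each of them (`exists_dominating_semiPOVM`).

A semi-POVM `R` that is lower-computable with respect to another basis `e'` is turned into an item
sequence for `e` in `exists_item_sequence`. Its approximations are rational only with respect to
`e'`; they are replaced by operators that are rational with respect to `e`, and a small multiple of
the identity on finitely many basis vectors, increasing with the stage and summable over `s`,
absorbs the errors, so that the new approximations increase exactly and their differences are coded
by items. The comparison with `R` costs a factor `1 / 2`.

A computable orthonormal basis exists by an effective form of the Gram–Schmidt process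
(`exists_isComputableOrthonormalBasis`). Whether a vector of a given computable sequence depends
linearly on the preceding ones cannot be decided, so the process is replaced by a search: step `n`
looks for a finite system of Gaussian rational combinations which is close to the previous system,
is nearly orthonormal, and nearly contains a prescribed vector in its span. Such a system exists
since an orthonormal system can always be extended in infinite dimension, and a nearly orthonormal
system is near an orthonormal one (`exists_orthonormalUpTo_near`), so the search never gets stuck.
The systems converge fast, and their limit is the basis.
-/

/-! ### Computable families of numbers -/

section Computability

variable {α β : Type*} [Primcodable α] [Primcodable β]

theorem Computable.nat_add {f g : α → ℕ} (hf : Computable f) (hg : Computable g) :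
    Computable fun x => f x + g x :=
  Primrec.nat_add.to_comp.comp hf hg

theorem Computable.nat_sub {f g : α → ℕ} (hf : Computable f) (hg : Computable g) :
    Computable fun x => f x - g x :=
  Primrec.nat_sub.to_comp.comp hf hg

theorem Computable.nat_mul {f g : α → ℕ} (hf : Computable f) (hg : Computable g) :
    Computable fun x => f x * g x :=
  Primrec.nat_mul.to_comp.comp hf hg

theorem Computable.decide_nat_lt {f g : α → ℕ} (hf : Computable f) (hg : Computable g) :
    Computable fun x => decide (f x < g x) :=
  (Primrec.nat_lt.decide.to_comp : Computable₂ fun a b : ℕ => decide (a < b)).comp hf hg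

theorem Computable.decide_eq {γ : Type*} [Primcodable γ] [DecidableEq γ] {f g : α → γ}
    (hf : Computable f) (hg : Computable g) : Computable fun x => decide (f x = g x) :=
  (Primrec.eq.decide.to_comp : Computable₂ fun a b : γ => decide (a = b)).comp hf hg

theorem Computable.nat_pow {f g : α → ℕ} (hf : Computable f) (hg : Computable g) :
    Computable fun x => f x ^ g x :=
  ((Primrec₂.unpaired'.1 Nat.Primrec.pow).to_comp : Computable₂ fun a b : ℕ => a ^ b).comp hf hg

theorem Computable.nat_sum_range {f : α × ℕ → ℕ} {N : α → ℕ} (hf : Computable f)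
    (hN : Computable N) : Computable fun x => ∑ k ∈ Finset.range (N x), f (x, k) := by
  have h : Computable fun x : α =>
      (N x).rec (motive := fun _ => ℕ) 0 fun k s => s + f (x, k) :=
    Computable.nat_rec hN (Computable.const 0) (Computable.to₂
      (Computable.nat_add (Computable.snd.comp Computable.snd)
        (hf.comp (Computable.fst.pair (Computable.fst.comp Computable.snd)))))
  refine h.of_eq fun x => ?_
  induction N x with
  | zero => rfl
  | succ n ih => rw [Finset.sum_range_succ, ← ih]

theorem Computable.list_map {f : α → List β} {γ : Type*} [Primcodable γ] {g : α × β → γ}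
    (hf : Computable f) (hg : Computable g) : Computable fun x => (f x).map fun b => g (x, b) := by
  have hm : Computable fun y : α × ℕ × List γ => (f y.1)[y.2.1]?.map fun b => g (y.1, b) :=
    Computable.option_map
      (Computable.list_getElem?.comp (hf.comp Computable.fst)
        (Computable.fst.comp Computable.snd))
      (Computable.to₂ (hg.comp ((Computable.fst.comp Computable.fst).pair Computable.snd)))
  have hl : Computable fun y : α × ℕ × List γ =>
      y.2.2 ++ ((f y.1)[y.2.1]?.map fun b => g (y.1, b)).toList :=
    Computable.list_append.comp (Computable.snd.comp Computable.snd)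
      (Primrec.optionToList.to_comp.comp hm)
  have h : Computable fun x : α => (f x).length.rec (motive := fun _ => List γ) []
      fun k s => s ++ ((f x)[k]?.map fun b => g (x, b)).toList :=
    Computable.nat_rec (Computable.list_length.comp hf) (Computable.const []) hl.to₂
  refine h.of_eq fun x => ?_
  have key : ∀ n, n ≤ (f x).length → Nat.rec (motive := fun _ => List γ) []
      (fun k s => s ++ ((f x)[k]?.map fun b => g (x, b)).toList) n
        = ((f x).take n).map fun b => g (x, b) := by
    intro n
    induction n with
    | zero => intro _; simp
    | succ n ih =>
      intro hn
      have hn' : n < (f x).length := hn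
      change _ ++ _ = _
      rw [ih hn'.le, List.take_add_one, List.map_append]
      cases (f x)[n]? <;> rfl
  simpa using key _ le_rfl

/-- Computable rationals are the quotients of a difference of two recursive functions by a third;
this form is the convenient one for arithmetic. -/
theorem isComputableRat_iff {r : α → ℚ} : IsComputableRat r ↔
    ∃ p q b : α → ℕ, Computable p ∧ Computable q ∧ Computable b ∧
      ∀ x, b x ≠ 0 ∧ r x = ((p x : ℚ) - q x) / b x := by
  constructor
  · rintro ⟨a, b, s, ha, hb, hs, h⟩
    refine ⟨fun x => bif (s x).bodd then 0 else a x, fun x => bif (s x).bodd then a x else 0, b,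
      Computable.cond (Computable.nat_bodd.comp hs) (Computable.const 0) ha,
      Computable.cond (Computable.nat_bodd.comp hs) ha (Computable.const 0), hb,
      fun x => ⟨(h x).1, ?_⟩⟩
    rw [(h x).2]
    cases hx : (s x).bodd with
    | true =>
      have : Odd (s x) := by
        rw [← Nat.not_even_iff_odd, Nat.even_iff, Nat.mod_two_of_bodd, hx]; simp
      simp [this.neg_one_pow, hx]
    | false =>
      have : Even (s x) := by rw [Nat.even_iff, Nat.mod_two_of_bodd, hx]; simp
      simp [this.neg_one_pow, hx]
  · rintro ⟨p, q, b, hp, hq, hb, h⟩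
    refine ⟨fun x => (p x - q x) + (q x - p x), b,
      fun x => bif decide (p x < q x) then 1 else 0,
      (hp.nat_sub hq).nat_add (hq.nat_sub hp), hb,
      Computable.cond (hp.decide_nat_lt hq) (Computable.const 1) (Computable.const 0),
      fun x => ⟨(h x).1, ?_⟩⟩
    rw [(h x).2]
    by_cases hx : p x < q x
    · simp [hx, Nat.sub_eq_zero_of_le hx.le, Nat.cast_sub hx.le]
    · have hx' := not_lt.1 hx
      simp [hx, Nat.sub_eq_zero_of_le hx', Nat.cast_sub hx']

namespace IsComputableRat

variable {r r' : α → ℚ}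

theorem comp {r : β → ℚ} (hr : IsComputableRat r) {f : α → β} (hf : Computable f) :
    IsComputableRat fun x => r (f x) := by
  obtain ⟨a, b, s, ha, hb, hs, h⟩ := hr
  exact ⟨_, _, _, ha.comp hf, hb.comp hf, hs.comp hf, fun x => h (f x)⟩

theorem of_eq (hr : IsComputableRat r) (h : ∀ x, r x = r' x) : IsComputableRat r' := by
  rwa [← funext h]

theorem natCast {f : α → ℕ} (hf : Computable f) : IsComputableRat fun x => (f x : ℚ) :=
  isComputableRat_iff.2 ⟨f, _, _, hf, Computable.const 0, Computable.const 1, by simp⟩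

theorem const (c : ℚ) : IsComputableRat fun _ : α => c := by
  refine isComputableRat_iff.2 ⟨_, _, _, Computable.const c.num.toNat,
    Computable.const (-c.num).toNat, Computable.const c.den, fun _ => ⟨c.den_nz, ?_⟩⟩
  have h : ((c.num.toNat : ℤ) - (-c.num).toNat : ℤ) = c.num := by omega
  have h' : ((c.num.toNat : ℚ) - (-c.num).toNat : ℚ) = c.num := by exact_mod_cast h
  rw [h', Rat.num_div_den]

theorem add (hr : IsComputableRat r) (hr' : IsComputableRat r') :
    IsComputableRat fun x => r x + r' x := by
  obtain ⟨p, q, b, hp, hq, hb, h⟩ := isComputableRat_iff.1 hr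
  obtain ⟨p', q', b', hp', hq', hb', h'⟩ := isComputableRat_iff.1 hr'
  refine isComputableRat_iff.2 ⟨_, _, _, (hp.nat_mul hb').nat_add (hp'.nat_mul hb),
    (hq.nat_mul hb').nat_add (hq'.nat_mul hb), hb.nat_mul hb',
    fun x => ⟨mul_ne_zero (h x).1 (h' x).1, ?_⟩⟩
  have h1 : (b x : ℚ) ≠ 0 := Nat.cast_ne_zero.2 (h x).1
  have h2 : (b' x : ℚ) ≠ 0 := Nat.cast_ne_zero.2 (h' x).1
  rw [(h x).2, (h' x).2]
  push_cast
  field_simp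
  ring

theorem neg (hr : IsComputableRat r) : IsComputableRat fun x => -r x := by
  obtain ⟨p, q, b, hp, hq, hb, h⟩ := isComputableRat_iff.1 hr
  refine isComputableRat_iff.2 ⟨_, _, _, hq, hp, hb, fun x => ⟨(h x).1, ?_⟩⟩
  rw [(h x).2, ← neg_div, neg_sub]

theorem sub (hr : IsComputableRat r) (hr' : IsComputableRat r') :
    IsComputableRat fun x => r x - r' x :=
  (hr.add hr'.neg).of_eq fun _ => (sub_eq_add_neg _ _).symm

theorem mul (hr : IsComputableRat r) (hr' : IsComputableRat r') :
    IsComputableRat fun x => r x * r' x := by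
  obtain ⟨p, q, b, hp, hq, hb, h⟩ := isComputableRat_iff.1 hr
  obtain ⟨p', q', b', hp', hq', hb', h'⟩ := isComputableRat_iff.1 hr'
  refine isComputableRat_iff.2 ⟨_, _, _, (hp.nat_mul hp').nat_add (hq.nat_mul hq'),
    (hp.nat_mul hq').nat_add (hq.nat_mul hp'), hb.nat_mul hb',
    fun x => ⟨mul_ne_zero (h x).1 (h' x).1, ?_⟩⟩
  rw [(h x).2, (h' x).2, div_mul_div_comm]
  push_cast
  ring

theorem inv_natCast_succ {f : α → ℕ} (hf : Computable f) :
    IsComputableRat fun x => ((f x : ℚ) + 1)⁻¹ :=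
  isComputableRat_iff.2 ⟨_, _, _, Computable.const 1, Computable.const 0, Computable.succ.comp hf,
    fun x => ⟨Nat.succ_ne_zero _, by simp⟩⟩

theorem half_pow {f : α → ℕ} (hf : Computable f) : IsComputableRat fun x => (2⁻¹ : ℚ) ^ f x :=
  isComputableRat_iff.2 ⟨_, _, _, Computable.const 1, Computable.const 0,
    (Computable.const 2).nat_pow hf, fun x => ⟨by positivity, by simp⟩⟩

theorem two_pow {f : α → ℕ} (hf : Computable f) : IsComputableRat fun x => (2 : ℚ) ^ f x :=
  (natCast ((Computable.const 2).nat_pow hf)).of_eq fun x => by simp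

theorem cond {c : α → Bool} (hc : Computable c) (hr : IsComputableRat r)
    (hr' : IsComputableRat r') : IsComputableRat fun x => bif c x then r x else r' x := by
  obtain ⟨a, b, s, ha, hb, hs, h⟩ := hr
  obtain ⟨a', b', s', ha', hb', hs', h'⟩ := hr'
  refine ⟨_, _, _, hc.cond ha ha', hc.cond hb hb', hc.cond hs hs', fun x => ?_⟩
  beta_reduce
  cases c x
  · exact h' x
  · exact h x

theorem sum_range {r : α × ℕ → ℚ} {N : α → ℕ} (hr : IsComputableRat r) (hN : Computable N) :
    IsComputableRat fun x => ∑ k ∈ Finset.range (N x), r (x, k) := by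
  obtain ⟨p, q, b, hp, hq, hb, h⟩ := isComputableRat_iff.1 hr
  have hi : Computable fun y : α × ℕ × ℕ × ℕ × ℕ => (y.1, y.2.1) :=
    Computable.fst.pair (Computable.fst.comp Computable.snd)
  have hs : Computable fun y : α × ℕ × ℕ × ℕ × ℕ => y.2.2 := Computable.snd.comp Computable.snd
  have h1 := Computable.fst.comp hs
  have h2 := (Computable.fst.comp Computable.snd).comp hs
  have h3 := (Computable.snd.comp Computable.snd).comp hs
  -- the partial sums are computed by recursion, as triples `(p, q, b)` standing for `(p - q) / b`
  let F : α → ℕ → ℕ × ℕ × ℕ := fun x n => n.rec (0, 0, 1) fun k s =>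
    (s.1 * b (x, k) + p (x, k) * s.2.2, s.2.1 * b (x, k) + q (x, k) * s.2.2, s.2.2 * b (x, k))
  have hF : Computable fun x => F x (N x) :=
    Computable.nat_rec hN (Computable.const (0, 0, 1)) (Computable.to₂
      (((h1.nat_mul (hb.comp hi)).nat_add ((hp.comp hi).nat_mul h3)).pair
        (((h2.nat_mul (hb.comp hi)).nat_add ((hq.comp hi).nat_mul h3)).pair
          (h3.nat_mul (hb.comp hi)))))
  have key : ∀ x n, (F x n).2.2 ≠ 0 ∧ ∑ k ∈ Finset.range n, r (x, k) =
      (((F x n).1 : ℚ) - (F x n).2.1) / (F x n).2.2 := by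
    intro x n
    induction n with
    | zero => simp [F]
    | succ n ih =>
      obtain ⟨ih0, ih⟩ := ih
      have e : F x (n + 1) = ((F x n).1 * b (x, n) + p (x, n) * (F x n).2.2,
        (F x n).2.1 * b (x, n) + q (x, n) * (F x n).2.2, (F x n).2.2 * b (x, n)) := rfl
      have hb0 := (h (x, n)).1
      refine ⟨by rw [e]; exact mul_ne_zero ih0 hb0, ?_⟩
      have hb1 : (b (x, n) : ℚ) ≠ 0 := Nat.cast_ne_zero.2 hb0
      have hb2 : ((F x n).2.2 : ℚ) ≠ 0 := Nat.cast_ne_zero.2 ih0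
      rw [Finset.sum_range_succ, ih, (h (x, n)).2, e]
      push_cast
      field_simp
      ring
  exact isComputableRat_iff.2 ⟨_, _, _, Computable.fst.comp hF,
    (Computable.fst.comp Computable.snd).comp hF, (Computable.snd.comp Computable.snd).comp hF,
    fun x => key x (N x)⟩

theorem decide_pos (hr : IsComputableRat r) : Computable fun x => decide (0 < r x) := by
  obtain ⟨p, q, b, hp, hq, hb, h⟩ := isComputableRat_iff.1 hr
  refine (hq.decide_nat_lt hp).of_eq fun x => ?_
  have hb : (0 : ℚ) < b x := Nat.cast_pos.2 (Nat.pos_of_ne_zero (h x).1)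
  rw [(h x).2, decide_eq_decide, div_pos_iff_of_pos_right hb, sub_pos, Nat.cast_lt]

theorem decide_lt (hr : IsComputableRat r) (hr' : IsComputableRat r') :
    Computable fun x => decide (r x < r' x) :=
  (hr'.sub hr).decide_pos.of_eq fun _ => by simp

end IsComputableRat

namespace IsComputableReal

variable {t t' : α → ℝ}

theorem comp {t : β → ℝ} (ht : IsComputableReal t) {f : α → β} (hf : Computable f) :
    IsComputableReal fun x => t (f x) := by
  obtain ⟨r, hr, h⟩ := ht
  exact ⟨fun p => r (f p.1, p.2), hr.comp ((hf.comp Computable.fst).pair Computable.snd),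
    fun x k => h (f x) k⟩

theorem of_eq (ht : IsComputableReal t) (h : ∀ x, t x = t' x) : IsComputableReal t' := by
  rwa [← funext h]

theorem ratCast {r : α → ℚ} (hr : IsComputableRat r) : IsComputableReal fun x => (r x : ℝ) :=
  ⟨fun p => r p.1, hr.comp Computable.fst, fun x k => by simp⟩

theorem const (c : ℚ) : IsComputableReal fun _ : α => (c : ℝ) := ratCast (.const c)

theorem add (ht : IsComputableReal t) (ht' : IsComputableReal t') :
    IsComputableReal fun x => t x + t' x := by
  obtain ⟨r, hr, h⟩ := ht
  obtain ⟨r', hr', h'⟩ := ht'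
  have hs : Computable fun p : α × ℕ => (p.1, p.2 + 1) :=
    Computable.fst.pair (Computable.succ.comp Computable.snd)
  refine ⟨fun p => r (p.1, p.2 + 1) + r' (p.1, p.2 + 1), (hr.comp hs).add (hr'.comp hs),
    fun x k => ?_⟩
  have h1 := h x (k + 1)
  have h2 := h' x (k + 1)
  rw [pow_succ, abs_le] at h1 h2
  rw [abs_le]
  push_cast
  constructor <;> linarith [h1.1, h1.2, h2.1, h2.2]

theorem neg (ht : IsComputableReal t) : IsComputableReal fun x => -t x := by
  obtain ⟨r, hr, h⟩ := ht
  refine ⟨fun p => -r p, hr.neg, fun x k => ?_⟩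
  push_cast
  rw [neg_sub_neg, abs_sub_comm]
  exact h x k

theorem sub (ht : IsComputableReal t) (ht' : IsComputableReal t') :
    IsComputableReal fun x => t x - t' x :=
  (ht.add ht'.neg).of_eq fun _ => (sub_eq_add_neg _ _).symm

/-- A computable family of reals has a recursive bound. -/
theorem exists_bound (ht : IsComputableReal t) :
    ∃ B : α → ℕ, Computable B ∧ ∀ x, |t x| ≤ B x := by
  obtain ⟨r, hr, h⟩ := ht
  obtain ⟨a, b, s, ha, hb, hs, hab⟩ := hr
  have h0 : Computable fun x : α => (x, 0) := Computable.id.pair (Computable.const 0)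
  refine ⟨fun x => a (x, 0) + 1, (ha.comp h0).nat_add (Computable.const 1), fun x => ?_⟩
  have h1 : |(r (x, 0) : ℝ)| ≤ a (x, 0) := by
    have hb1 : (1 : ℝ) ≤ b (x, 0) := Nat.one_le_cast.2 (Nat.pos_of_ne_zero (hab (x, 0)).1)
    rw [(hab (x, 0)).2]
    push_cast
    rw [abs_div, abs_mul, abs_neg_one_pow, one_mul, Nat.abs_cast, Nat.abs_cast]
    exact div_le_self (Nat.cast_nonneg _) hb1
  have h2 := h x 0
  rw [pow_zero, abs_sub_comm] at h2
  push_cast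
  calc |t x| = |(t x - r (x, 0)) + r (x, 0)| := by ring_nf
    _ ≤ _ := (abs_add_le _ _).trans (by linarith)

theorem mul (ht : IsComputableReal t) (ht' : IsComputableReal t') :
    IsComputableReal fun x => t x * t' x := by
  obtain ⟨B, hB, hBt⟩ := ht.exists_bound
  obtain ⟨B', hB', hBt'⟩ := ht'.exists_bound
  obtain ⟨r, hr, h⟩ := ht
  obtain ⟨r', hr', h'⟩ := ht'
  have hs : Computable fun p : α × ℕ => (p.1, p.2 + (B p.1 + B' p.1 + 1)) :=
    Computable.fst.pair (Computable.snd.nat_add (((hB.comp Computable.fst).nat_add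
      (hB'.comp Computable.fst)).nat_add (Computable.const 1)))
  refine ⟨fun p => r (p.1, p.2 + (B p.1 + B' p.1 + 1)) * r' (p.1, p.2 + (B p.1 + B' p.1 + 1)),
    (hr.comp hs).mul (hr'.comp hs), fun x k => ?_⟩
  have h1 := h x (k + (B x + B' x + 1))
  have h2 := h' x (k + (B x + B' x + 1))
  push_cast
  set u : ℝ := (r (x, k + (B x + B' x + 1)) : ℝ)
  set v : ℝ := (r' (x, k + (B x + B' x + 1)) : ℝ)
  set δ : ℝ := (2⁻¹ : ℝ) ^ (k + (B x + B' x + 1)) with hδ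
  have hδ0 : 0 ≤ δ := by positivity
  have hδ1 : δ ≤ 1 := pow_le_one₀ (by norm_num) (by norm_num)
  have hv : |v| ≤ B' x + 1 := by
    calc |v| = |(v - t' x) + t' x| := by ring_nf
      _ ≤ _ := (abs_add_le _ _).trans (by linarith [hBt' x])
  have hmain : δ * (B x + B' x + 1) ≤ (2⁻¹ : ℝ) ^ k := by
    have h2 : ((B x + B' x + 1 : ℕ) : ℝ) ≤ 2 ^ (B x + B' x + 1) := by
      exact_mod_cast (Nat.lt_two_pow_self).le
    rw [hδ, pow_add, mul_assoc]
    refine mul_le_of_le_one_right (by positivity) ?_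
    rw [inv_pow, inv_mul_le_iff₀ (by positivity), mul_one]
    exact_mod_cast h2
  calc |u * v - t x * t' x| = |(u - t x) * v + t x * (v - t' x)| := by ring_nf
    _ ≤ |u - t x| * |v| + |t x| * |v - t' x| := by
      rw [← abs_mul, ← abs_mul]; exact abs_add_le _ _
    _ ≤ δ * (B' x + 1) + B x * δ := by gcongr; exact hBt x
    _ = δ * (B x + B' x + 1) := by ring
    _ ≤ _ := hmain

theorem sum_range {t : α × ℕ → ℝ} {N : α → ℕ} (ht : IsComputableReal t) (hN : Computable N) :
    IsComputableReal fun x => ∑ k ∈ Finset.range (N x), t (x, k) := by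
  obtain ⟨r, hr, h⟩ := ht
  refine ⟨fun p => ∑ k ∈ Finset.range (N p.1), r ((p.1, k), p.2 + N p.1),
    IsComputableRat.sum_range (r := fun q : (α × ℕ) × ℕ => r ((q.1.1, q.2), q.1.2 + N q.1.1))
      (hr.comp ?_) (hN.comp Computable.fst), fun x k => ?_⟩
  · exact ((Computable.fst.comp Computable.fst).pair Computable.snd).pair
      ((Computable.snd.comp Computable.fst).nat_add
        (hN.comp (Computable.fst.comp Computable.fst)))
  · push_cast
    rw [← Finset.sum_sub_distrib]
    refine (Finset.abs_sum_le_sum_abs _ _).trans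
      ((Finset.sum_le_sum fun i _ => h (x, i) (k + N x)).trans ?_)
    have h2 : (N x : ℝ) ≤ 2 ^ N x := by exact_mod_cast (Nat.lt_two_pow_self).le
    rw [Finset.sum_const, Finset.card_range, nsmul_eq_mul, pow_add, mul_left_comm]
    refine mul_le_of_le_one_right (by positivity) ?_
    rw [inv_pow, ← div_eq_mul_inv]
    exact div_le_one_of_le₀ h2 (by positivity)

end IsComputableReal

namespace IsRecursiveComplexRational

variable {z z' : α → ℂ}

theorem comp {z : β → ℂ} (hz : IsRecursiveComplexRational z) {f : α → β} (hf : Computable f) :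
    IsRecursiveComplexRational fun x => z (f x) := by
  obtain ⟨p, q, hp, hq, h⟩ := hz
  exact ⟨_, _, hp.comp hf, hq.comp hf, fun x => h (f x)⟩

theorem of_eq (hz : IsRecursiveComplexRational z) (h : ∀ x, z x = z' x) :
    IsRecursiveComplexRational z' := by
  rwa [← funext h]

theorem ratCast {r : α → ℚ} (hr : IsComputableRat r) :
    IsRecursiveComplexRational fun x => (r x : ℂ) :=
  ⟨_, _, hr, .const 0, by simp⟩

theorem add (hz : IsRecursiveComplexRational z) (hz' : IsRecursiveComplexRational z') :
    IsRecursiveComplexRational fun x => z x + z' x := by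
  obtain ⟨p, q, hp, hq, h⟩ := hz
  obtain ⟨p', q', hp', hq', h'⟩ := hz'
  refine ⟨_, _, hp.add hp', hq.add hq', fun x => ?_⟩
  beta_reduce
  rw [h, h']; push_cast; ring

theorem neg (hz : IsRecursiveComplexRational z) : IsRecursiveComplexRational fun x => -z x := by
  obtain ⟨p, q, hp, hq, h⟩ := hz
  refine ⟨_, _, hp.neg, hq.neg, fun x => ?_⟩
  beta_reduce
  rw [h]; push_cast; ring

theorem sub (hz : IsRecursiveComplexRational z) (hz' : IsRecursiveComplexRational z') :
    IsRecursiveComplexRational fun x => z x - z' x :=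
  (hz.add hz'.neg).of_eq fun _ => (sub_eq_add_neg _ _).symm

theorem mul (hz : IsRecursiveComplexRational z) (hz' : IsRecursiveComplexRational z') :
    IsRecursiveComplexRational fun x => z x * z' x := by
  obtain ⟨p, q, hp, hq, h⟩ := hz
  obtain ⟨p', q', hp', hq', h'⟩ := hz'
  refine ⟨_, _, (hp.mul hp').sub (hq.mul hq'), (hp.mul hq').add (hq.mul hp'), fun x => ?_⟩
  beta_reduce
  rw [h, h']; push_cast; linear_combination (q x * q' x : ℂ) * Complex.I_mul_I

theorem conj (hz : IsRecursiveComplexRational z) :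
    IsRecursiveComplexRational fun x => (starRingEnd ℂ) (z x) := by
  obtain ⟨p, q, hp, hq, h⟩ := hz
  refine ⟨_, _, hp, hq.neg, fun x => ?_⟩
  beta_reduce
  rw [h]
  simp

theorem cond {c : α → Bool} (hc : Computable c) (hz : IsRecursiveComplexRational z)
    (hz' : IsRecursiveComplexRational z') :
    IsRecursiveComplexRational fun x => bif c x then z x else z' x := by
  obtain ⟨p, q, hp, hq, h⟩ := hz
  obtain ⟨p', q', hp', hq', h'⟩ := hz'
  refine ⟨_, _, .cond hc hp hp', .cond hc hq hq', fun x => ?_⟩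
  cases hx : c x
  · simpa [hx] using h' x
  · simpa [hx] using h x

theorem sum_range {z : α × ℕ → ℂ} {N : α → ℕ} (hz : IsRecursiveComplexRational z)
    (hN : Computable N) :
    IsRecursiveComplexRational fun x => ∑ k ∈ Finset.range (N x), z (x, k) := by
  obtain ⟨p, q, hp, hq, h⟩ := hz
  refine ⟨_, _, hp.sum_range hN, hq.sum_range hN, fun x => ?_⟩
  push_cast
  rw [Finset.sum_mul, ← Finset.sum_add_distrib]
  exact Finset.sum_congr rfl fun k _ => h (x, k)

theorem isComputableComplex (hz : IsRecursiveComplexRational z) : IsComputableComplex z := by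
  obtain ⟨p, q, hp, hq, h⟩ := hz
  exact ⟨(IsComputableReal.ratCast hp).of_eq fun x => by simp [h],
    (IsComputableReal.ratCast hq).of_eq fun x => by simp [h]⟩

theorem normSq (hz : IsRecursiveComplexRational z) :
    ∃ r : α → ℚ, IsComputableRat r ∧ ∀ x, Complex.normSq (z x) = r x := by
  obtain ⟨p, q, hp, hq, h⟩ := hz
  refine ⟨_, (hp.mul hp).add (hq.mul hq), fun x => ?_⟩
  rw [h]
  simp [Complex.normSq_apply]

/-- Equality of recursive families of Gaussian rationals is decidable. -/
theorem exists_decide_eq (hz : IsRecursiveComplexRational z)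
    (hz' : IsRecursiveComplexRational z') :
    ∃ c : α → Bool, Computable c ∧ ∀ x, c x = true ↔ z x = z' x := by
  obtain ⟨r, hr, h⟩ := (hz.sub hz').normSq
  refine ⟨_, Primrec.not.to_comp.comp hr.decide_pos, fun x => ?_⟩
  have h0 : (0 : ℝ) ≤ r x := by rw [← h]; exact Complex.normSq_nonneg _
  have h0' : 0 ≤ r x := by exact_mod_cast h0
  rw [← sub_eq_zero (a := z x), ← Complex.normSq_eq_zero, h]
  simp only [Bool.not_eq_true', decide_eq_false_iff_not, not_lt, Rat.cast_eq_zero]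
  exact ⟨fun h => le_antisymm h h0', fun h => h.le⟩

end IsRecursiveComplexRational

/-! ### Searching for witnesses -/

/-- Unbounded search: a decidable relation has a partial recursive choice function. -/
theorem exists_partrec_choice {p : α × β → Bool} (hp : Computable p) :
    ∃ F : α →. β, Partrec F ∧ (∀ a, ∀ b ∈ F a, p (a, b) = true) ∧
      ∀ a b, p (a, b) = true → (F a).Dom := by
  let G : α → ℕ → Option β := fun a n =>
    (Encodable.decode (α := β) n).bind fun b => bif p (a, b) then some b else none
  have hG : Computable₂ G := by
    refine Computable.option_bind (Computable.decode.comp Computable.snd)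
      (Computable.to₂ (Computable.cond (hp.comp
        ((Computable.fst.comp Computable.fst).pair Computable.snd))
        (Computable.option_some.comp Computable.snd) (Computable.const none)))
  refine ⟨fun a => Nat.rfindOpt (G a), Partrec.rfindOpt hG, fun a b hb => ?_, fun a b hab => ?_⟩
  · obtain ⟨n, hn⟩ := Nat.rfindOpt_spec hb
    simp only [G, Option.mem_def, Option.bind_eq_some_iff] at hn
    obtain ⟨b', -, hb'⟩ := hn
    cases h : p (a, b') <;> simp_all
  · rw [Nat.rfindOpt_dom]
    exact ⟨Encodable.encode b, b, by simp [G, hab]⟩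

/-- The search succeeds everywhere if there is always a witness. -/
theorem exists_computable_choice {p : α × β → Bool} (hp : Computable p)
    (h : ∀ a, ∃ b, p (a, b) = true) : ∃ f : α → β, Computable f ∧ ∀ a, p (a, f a) = true := by
  obtain ⟨F, hF, hF1, hF2⟩ := exists_partrec_choice hp
  have hd : ∀ a, (F a).Dom := fun a => let ⟨b, hb⟩ := h a; hF2 a b hb
  exact ⟨fun a => (F a).get (hd a), hF.of_eq_tot fun a => Part.get_mem _,
    fun a => hF1 a _ (Part.get_mem _)⟩

/-- Strict inequalities between computable reals are semidecidable. -/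
theorem IsComputableReal.exists_decide_lt_one {t : α → ℝ} (ht : IsComputableReal t) :
    ∃ c : α × ℕ → Bool, Computable c ∧ ∀ x, (∃ k, c (x, k) = true) ↔ t x < 1 := by
  obtain ⟨r, hr, h⟩ := ht
  refine ⟨_, (hr.add (IsComputableRat.half_pow Computable.snd)).decide_lt (.const 1),
    fun x => ?_⟩
  simp only [decide_eq_true_eq]
  constructor
  · rintro ⟨k, hk⟩
    have hk' : ((r (x, k) + 2⁻¹ ^ k : ℚ) : ℝ) < 1 := by exact_mod_cast hk
    push_cast at hk'
    linarith [(abs_le.1 (h x k)).1]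
  · intro hx
    obtain ⟨k, hk⟩ := exists_pow_lt_of_lt_one (show (0 : ℝ) < (1 - t x) / 2 by linarith)
      (show (2⁻¹ : ℝ) < 1 by norm_num)
    refine ⟨k, ?_⟩
    have : ((r (x, k) + 2⁻¹ ^ k : ℚ) : ℝ) < 1 := by
      push_cast
      linarith [(abs_le.1 (h x k)).2]
    exact_mod_cast this

theorem exists_partrec_choice_lt_one {t : α × β → ℝ} (ht : IsComputableReal t) :
    ∃ F : α →. β, Partrec F ∧ (∀ a, ∀ b ∈ F a, t (a, b) < 1) ∧
      ∀ a b, t (a, b) < 1 → (F a).Dom := by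
  obtain ⟨c, hc, h⟩ := ht.exists_decide_lt_one
  obtain ⟨F, hF, hF1, hF2⟩ := exists_partrec_choice
    (p := fun x : α × β × ℕ => c ((x.1, x.2.1), x.2.2)) (hc.comp
      ((Computable.fst.pair (Computable.fst.comp Computable.snd)).pair
        (Computable.snd.comp Computable.snd)))
  refine ⟨fun a => (F a).map Prod.fst, hF.map (Computable.to₂
    (Computable.fst.comp Computable.snd)), fun a b hb => ?_, fun a b hab => ?_⟩
  · obtain ⟨⟨b', k⟩, hb', rfl⟩ := (Part.mem_map_iff _).1 hb
    exact (h _).1 ⟨k, hF1 a _ hb'⟩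
  · obtain ⟨k, hk⟩ := (h (a, b)).2 hab
    exact hF2 a (b, k) hk

theorem exists_computable_choice_lt_one {t : α × β → ℝ} (ht : IsComputableReal t)
    (h : ∀ a, ∃ b, t (a, b) < 1) : ∃ f : α → β, Computable f ∧ ∀ a, t (a, f a) < 1 := by
  obtain ⟨F, hF, hF1, hF2⟩ := exists_partrec_choice_lt_one ht
  have hd : ∀ a, (F a).Dom := fun a => let ⟨b, hb⟩ := h a; hF2 a b hb
  exact ⟨fun a => (F a).get (hd a), hF.of_eq_tot fun a => Part.get_mem _,
    fun a => hF1 a _ (Part.get_mem _)⟩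

/-- Unbounded search along a recursion: if every valid state has an admissible successor, and
admissible successors of valid states are valid, then there is a computable sequence of states each
of which is an admissible successor of the preceding one. -/
theorem exists_computable_chain {t : (ℕ × β) × β → ℝ} (ht : IsComputableReal t)
    (valid : ℕ → β → Prop) (b₀ : β) (h₀ : valid 0 b₀)
    (hex : ∀ n b, valid n b → ∃ b', t ((n, b), b') < 1)
    (hpres : ∀ n b b', valid n b → t ((n, b), b') < 1 → valid (n + 1) b') :
    ∃ f : ℕ → β, Computable f ∧ (∀ n, valid n (f n)) ∧ ∀ n, t ((n, f n), f (n + 1)) < 1 := by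
  obtain ⟨F, hF, hF1, hF2⟩ := exists_partrec_choice_lt_one ht
  let G : ℕ →. β := fun n => n.rec (Part.some b₀) fun k IH => IH.bind fun b => F (k, b)
  have hG : Partrec G := by
    have : Partrec₂ fun (_ : ℕ) (q : ℕ × β) => F q := hF.comp Computable.snd
    exact Partrec.nat_rec Computable.id (Partrec.some.comp (Computable.const b₀)) this
  have hv : ∀ n, ∃ b ∈ G n, valid n b := by
    intro n
    induction n with
    | zero => exact ⟨b₀, Part.mem_some _, h₀⟩
    | succ n ih =>
      obtain ⟨b, hb, hvb⟩ := ih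
      obtain ⟨b', hb'⟩ := hex n b hvb
      have hd := hF2 (n, b) b' hb'
      exact ⟨(F (n, b)).get hd, Part.mem_bind hb (Part.get_mem hd),
        hpres n b _ hvb (hF1 _ _ (Part.get_mem hd))⟩
  choose f hf hfv using hv
  refine ⟨f, hG.of_eq_tot hf, hfv, fun n => ?_⟩
  obtain ⟨b, hb, hb'⟩ := Part.mem_bind_iff.1 (hf (n + 1))
  rw [Part.mem_unique (hf n) hb]
  exact hF1 _ _ hb'

end Computability

/-! ### Positive operators and their strong limits -/

section Operators

set_option linter.unusedSectionVars false

variable {X : Type*} [NormedAddCommGroup X] [InnerProductSpace ℂ X] [CompleteSpace X]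

open ContinuousLinearMap Filter Topology InnerProductSpace

/-- The Loewner order is the pointwise order of quadratic forms. -/
theorem le_iff_re_inner_le {S T : X →L[ℂ] X} (hS : IsSelfAdjoint S) (hT : IsSelfAdjoint T) :
    S ≤ T ↔ ∀ x, (inner ℂ x (S x)).re ≤ (inner ℂ x (T x)).re := by
  rw [ContinuousLinearMap.le_def, isPositive_def']
  refine ⟨fun h x => ?_, fun h => ⟨hT.sub hS, fun x => ?_⟩⟩
  · have := h.2 x
    rw [reApplyInnerSelf_apply, inner_re_symm] at this
    simpa [inner_sub_right] using this
  · rw [reApplyInnerSelf_apply, inner_re_symm]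
    simpa [inner_sub_right] using h x

theorem re_inner_le_of_le {S T : X →L[ℂ] X} (h : S ≤ T) (x : X) :
    (inner ℂ x (S x)).re ≤ (inner ℂ x (T x)).re := by
  have := ((ContinuousLinearMap.le_def _ _).1 h).re_inner_nonneg_right x
  simpa [inner_sub_right] using this

theorem re_inner_nonneg_of_nonneg {T : X →L[ℂ] X} (h : 0 ≤ T) (x : X) :
    0 ≤ (inner ℂ x (T x)).re := by
  simpa using re_inner_le_of_le h x

theorem isSelfAdjoint_of_op_nonneg {T : X →L[ℂ] X} (h : 0 ≤ T) : IsSelfAdjoint T :=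
  ((nonneg_iff_isPositive T).1 h).isSelfAdjoint

theorem op_nonneg_smul {T : X →L[ℂ] X} (h : 0 ≤ T) {c : ℝ} (hc : 0 ≤ c) : 0 ≤ (c : ℂ) • T :=
  (nonneg_iff_isPositive _).2
    (((nonneg_iff_isPositive T).1 h).smul_of_nonneg (by exact_mod_cast hc))

theorem op_smul_le_smul {S T : X →L[ℂ] X} (h : S ≤ T) {c : ℝ} (hc : 0 ≤ c) :
    (c : ℂ) • S ≤ (c : ℂ) • T := by
  have := op_nonneg_smul (sub_nonneg.2 h) hc
  rwa [smul_sub, sub_nonneg] at this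

theorem op_smul_le_smul_of_le {T : X →L[ℂ] X} (h : 0 ≤ T) {c d : ℝ} (hcd : c ≤ d) :
    (c : ℂ) • T ≤ (d : ℂ) • T := by
  have := op_nonneg_smul h (sub_nonneg.2 hcd)
  rwa [Complex.ofReal_sub, sub_smul, sub_nonneg] at this

theorem op_one_nonneg : (0 : X →L[ℂ] X) ≤ 1 := (nonneg_iff_isPositive _).2 isPositive_one

theorem isSelfAdjoint_ofReal_smul {T : X →L[ℂ] X} (h : IsSelfAdjoint T) (c : ℝ) :
    IsSelfAdjoint ((c : ℂ) • T) :=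
  IsSelfAdjoint.smul (Complex.conj_ofReal c) h

theorem le_norm_smul_one {T : X →L[ℂ] X} (h : IsSelfAdjoint T) {c : ℝ} (hc : ‖T‖ ≤ c) :
    T ≤ (c : ℂ) • 1 := by
  rw [le_iff_re_inner_le h (isSelfAdjoint_ofReal_smul (.one _) c)]
  intro x
  have h1 : (inner ℂ x (T x)).re ≤ ‖x‖ * (c * ‖x‖) :=
    (Complex.re_le_norm _).trans ((norm_inner_le_norm _ _).trans (by
      gcongr; exact T.le_of_opNorm_le hc x))
  have h2 : (inner ℂ x (((c : ℂ) • (1 : X →L[ℂ] X)) x)).re = ‖x‖ * (c * ‖x‖) := by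
    simp only [_root_.smul_apply, one_apply_eq_self, inner_smul_right]
    rw [Complex.re_ofReal_mul,
      show (inner ℂ x x).re = ‖x‖ ^ 2 from inner_self_eq_norm_sq (𝕜 := ℂ) x]
    ring
  rw [h2]; exact h1

/-- A contraction `0 ≤ T ≤ 1` satisfies `T² ≤ T`. -/
theorem norm_sq_le_re_inner {T : X →L[ℂ] X} (h0 : 0 ≤ T) (h1 : T ≤ 1) (x : X) :
    ‖T x‖ ^ 2 ≤ (inner ℂ x (T x)).re := by
  have hs := ((nonneg_iff_isPositive T).1 h0).inner_left_eq_inner_right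
  -- add the nonnegative numbers `⟪x - T x, T (x - T x)⟫` and `⟪T x, (1 - T) (T x)⟫`
  have e1 := re_inner_nonneg_of_nonneg h0 (x - T x)
  have e2 := re_inner_le_of_le h1 (T x)
  have e3 : inner ℂ (T x) (T x) = inner ℂ x (T (T x)) := hs x (T x)
  have e4 : (inner ℂ (T x) (T x)).re = ‖T x‖ ^ 2 := by
    rw [inner_self_eq_norm_sq_to_K]; norm_cast
  simp only [map_sub, inner_sub_left, inner_sub_right, Complex.sub_re, one_apply_eq_self] at e1 e2
  rw [← e3, e4] at e1
  rw [e4] at e2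
  linarith

/-- A bounded increasing net of positive operators converges strongly. -/
theorem exists_tendsto_of_monotone {ι : Type*} [SemilatticeSup ι] [Nonempty ι] [Countable ι]
    {T : ι → X →L[ℂ] X} (hT : Monotone T) (h0 : ∀ i, 0 ≤ T i) (h1 : ∀ i, T i ≤ 1) :
    ∃ S : X →L[ℂ] X, ∀ x, Tendsto (fun i => T i x) atTop (𝓝 (S x)) := by
  have key : ∀ x, ∃ y, Tendsto (fun i => T i x) atTop (𝓝 y) := by
    intro x
    set q : ι → ℝ := fun i => (inner ℂ x (T i x)).re
    have hq : Monotone q := fun i j hij => re_inner_le_of_le (hT hij) x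
    have hb : BddAbove (Set.range q) := ⟨_, by
      rintro _ ⟨i, rfl⟩; exact re_inner_le_of_le (h1 i) x⟩
    have hc : CauchySeq q := (tendsto_atTop_ciSup hq hb).cauchySeq
    refine cauchySeq_tendsto_of_complete (Metric.cauchySeq_iff'.2 fun ε hε => ?_)
    obtain ⟨N, hN⟩ := Metric.cauchySeq_iff'.1 hc (ε ^ 2) (by positivity)
    refine ⟨N, fun n hn => ?_⟩
    have h2 := norm_sq_le_re_inner (sub_nonneg.2 (hT hn))
      ((sub_le_self _ (h0 N)).trans (h1 n)) x
    have h3 := (le_abs_self _).trans_lt (hN n hn)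
    rw [dist_eq_norm]
    refine lt_of_pow_lt_pow_left₀ 2 hε.le (lt_of_le_of_lt ?_ h3)
    simpa [q, inner_sub_right] using h2
  choose S hS using key
  exact ⟨continuousLinearMapOfTendsto (σ₁₂ := RingHom.id ℂ) T (tendsto_pi_nhds.2 hS), hS⟩

section Limits

variable {ι : Type*} {l : Filter ι} [l.NeBot] {T T' : ι → X →L[ℂ] X} {S S' : X →L[ℂ] X}

theorem isSelfAdjoint_of_tendsto (hT : ∀ i, IsSelfAdjoint (T i))
    (h : ∀ x, Tendsto (fun i => T i x) l (𝓝 (S x))) : IsSelfAdjoint S := by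
  rw [isSelfAdjoint_iff_isSymmetric]
  intro x y
  have h1 := (h x).inner (𝕜 := ℂ) (tendsto_const_nhds (x := y))
  have h2 := (tendsto_const_nhds (x := x)).inner (𝕜 := ℂ) (h y)
  refine tendsto_nhds_unique h1 (h2.congr fun i => ?_)
  exact ((isSelfAdjoint_iff_isSymmetric.1 (hT i)) x y).symm

theorem op_le_of_tendsto (h : ∀ x, Tendsto (fun i => T i x) l (𝓝 (S x)))
    (h' : ∀ x, Tendsto (fun i => T' i x) l (𝓝 (S' x)))
    (hle : ∀ᶠ i in l, T i ≤ T' i) (hT : ∀ i, IsSelfAdjoint (T i))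
    (hT' : ∀ i, IsSelfAdjoint (T' i)) : S ≤ S' := by
  rw [le_iff_re_inner_le (isSelfAdjoint_of_tendsto hT h) (isSelfAdjoint_of_tendsto hT' h')]
  intro x
  have h1 := (Complex.continuous_re.tendsto _).comp
    ((tendsto_const_nhds (x := x)).inner (𝕜 := ℂ) (h x))
  have h2 := (Complex.continuous_re.tendsto _).comp
    ((tendsto_const_nhds (x := x)).inner (𝕜 := ℂ) (h' x))
  exact le_of_tendsto_of_tendsto h1 h2 (hle.mono fun i hi => re_inner_le_of_le hi x)

theorem op_le_of_tendsto_const {A : X →L[ℂ] X} (h : ∀ x, Tendsto (fun i => T i x) l (𝓝 (S x)))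
    (hT : ∀ i, IsSelfAdjoint (T i)) (hA : IsSelfAdjoint A) (hle : ∀ᶠ i in l, T i ≤ A) : S ≤ A :=
  op_le_of_tendsto h (fun _ => tendsto_const_nhds) hle hT fun _ => hA

theorem op_ge_of_tendsto_const {A : X →L[ℂ] X} (h : ∀ x, Tendsto (fun i => T i x) l (𝓝 (S x)))
    (hT : ∀ i, IsSelfAdjoint (T i)) (hA : IsSelfAdjoint A) (hle : ∀ᶠ i in l, A ≤ T i) : A ≤ S :=
  op_le_of_tendsto (fun _ => tendsto_const_nhds) h hle (fun _ => hA) hT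

end Limits

/-- Operators are determined by their matrix with respect to a generating sequence. -/
theorem op_ext_of_generating {e : ℕ → X} (he : IsGeneratingSet e) {S T : X →L[ℂ] X}
    (h : ∀ k l, inner ℂ (e l) (S (e k)) = inner ℂ (e l) (T (e k))) : S = T := by
  refine ContinuousLinearMap.ext_on he ?_
  rintro _ ⟨k, rfl⟩
  rw [← sub_eq_zero]
  have h2 : ∀ y ∈ (Submodule.span ℂ (Set.range e) : Set X),
      inner ℂ y (S (e k) - T (e k)) = 0 := by
    intro y hy
    induction hy using Submodule.span_induction with
    | mem y hy => obtain ⟨l, rfl⟩ := hy; rw [inner_sub_right, h, sub_self]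
    | zero => simp
    | add y z _ _ hy hz => rw [inner_add_left, hy, hz, add_zero]
    | smul a y _ hy => rw [inner_smul_left, hy, mul_zero]
  exact he.eq_zero_of_inner_left ℂ fun y hy => by rw [← inner_conj_symm, h2 y hy, map_zero]

/-- The orthogonal projection onto the span of the first `N` terms of an orthonormal sequence. -/
noncomputable def initialProj (e : ℕ → X) (N : ℕ) : X →L[ℂ] X :=
  ∑ i ∈ Finset.range N, rankOne ℂ (e i) (e i)

theorem initialProj_apply (e : ℕ → X) (N : ℕ) (x : X) :
    initialProj e N x = ∑ i ∈ Finset.range N, (inner ℂ (e i) x : ℂ) • e i := by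
  simp [initialProj]

theorem initialProj_nonneg (e : ℕ → X) (N : ℕ) : 0 ≤ initialProj e N :=
  Finset.sum_nonneg fun _ _ => (nonneg_iff_isPositive _).2 (isPositive_rankOne_self _)

theorem initialProj_mono (e : ℕ → X) : Monotone (initialProj e) := fun _ _ h =>
  Finset.sum_le_sum_of_subset_of_nonneg (Finset.range_mono h)
    fun _ _ _ => (nonneg_iff_isPositive _).2 (isPositive_rankOne_self _)

theorem initialProj_basis {e : ℕ → X} (he : Orthonormal ℂ e) (N k : ℕ) :
    initialProj e N (e k) = if k < N then e k else 0 := by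
  rw [initialProj_apply]
  simp [orthonormal_iff_ite.1 he, ite_smul]

theorem inner_initialProj {e : ℕ → X} (he : Orthonormal ℂ e) (N k l : ℕ) :
    inner ℂ (e l) (initialProj e N (e k)) = if k = l ∧ k < N then 1 else 0 := by
  rw [initialProj_basis he]
  by_cases h : k < N <;> simp [h, orthonormal_iff_ite.1 he, eq_comm]

theorem initialProj_le_one {e : ℕ → X} (he : Orthonormal ℂ e) (N : ℕ) : initialProj e N ≤ 1 := by
  rw [le_iff_re_inner_le (isSelfAdjoint_of_op_nonneg (initialProj_nonneg e N)) (.one _)]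
  intro x
  have h := he.sum_inner_products_le (s := Finset.range N) x
  have h2 : (inner ℂ x ((1 : X →L[ℂ] X) x)).re = ‖x‖ ^ 2 := by
    rw [one_apply_eq_self, inner_self_eq_norm_sq_to_K]; norm_cast
  rw [h2]
  refine le_of_eq_of_le ?_ h
  rw [initialProj_apply, inner_sum, Complex.re_sum]
  refine Finset.sum_congr rfl fun i _ => ?_
  rw [inner_smul_right, ← inner_conj_symm x (e i), Complex.mul_conj, Complex.ofReal_re,
    Complex.normSq_eq_norm_sq]

/-- An operator that is supported on the first `N` basis vectors and is `≤ c I` is already below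
`c` times the projection. -/
theorem le_smul_initialProj {e : ℕ → X} (he : Orthonormal ℂ e) (hg : IsGeneratingSet e)
    {T : X →L[ℂ] X} {N : ℕ} (hT : IsSelfAdjoint T)
    (hN : ∀ k l, N ≤ k ∨ N ≤ l → inner ℂ (e l) (T (e k)) = 0) {c : ℝ}
    (hc : T ≤ (c : ℂ) • 1) : T ≤ (c : ℂ) • initialProj e N := by
  have hQ := isSelfAdjoint_of_op_nonneg (initialProj_nonneg e N)
  have hQs := isSelfAdjoint_iff_isSymmetric.1 hQ
  have e1 : initialProj e N * T * initialProj e N = T := by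
    refine op_ext_of_generating hg fun k l => ?_
    have : inner ℂ (e l) ((initialProj e N * T * initialProj e N) (e k)) =
        inner ℂ (initialProj e N (e l)) (T (initialProj e N (e k))) := (hQs _ _).symm
    rw [this, initialProj_basis he, initialProj_basis he]
    by_cases hk : k < N
    · by_cases hl : l < N
      · simp [hk, hl]
      · simp [hl, hN k l (Or.inr (not_lt.1 hl))]
    · simp [hk, hN k l (Or.inl (not_lt.1 hk))]
  have e2 : initialProj e N * initialProj e N = initialProj e N := by
    refine op_ext_of_generating hg fun k l => ?_
    change inner ℂ (e l) (initialProj e N (initialProj e N (e k))) = _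
    rw [initialProj_basis he]
    by_cases hk : k < N
    · simp [hk, initialProj_basis he]
    · simp [hk]
  rw [le_iff_re_inner_le hT (isSelfAdjoint_ofReal_smul hQ c)]
  intro x
  have h1 := re_inner_le_of_le hc (initialProj e N x)
  have h2 : inner ℂ x (T x) = inner ℂ (initialProj e N x) (T (initialProj e N x)) := by
    conv_lhs => rw [← e1]
    exact (hQs _ _).symm
  have h3 : inner ℂ (initialProj e N x) (((c : ℂ) • (1 : X →L[ℂ] X)) (initialProj e N x)) =
      inner ℂ x (((c : ℂ) • initialProj e N) x) := by
    simp only [_root_.smul_apply, one_apply_eq_self, inner_smul_right]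
    congr 1
    conv_rhs => rw [← e2]
    exact hQs _ _
  rw [h2, ← h3]
  exact h1

end Operators

/-! ### Gaussian rational vectors and operators -/

section Codes

open InnerProductSpace ContinuousLinearMap

/-- Codes of Gaussian rationals, see `gaussVal`. -/
abbrev GaussCode := ℕ × ℕ × ℕ × ℕ × ℕ

/-- The tuple `(a, b, c, d, m)` stands for `((a - b) + (c - d) i) / (m + 1)`. -/
noncomputable def gaussVal (c : GaussCode) : ℂ :=
  (((c.1 : ℂ) - c.2.1) + ((c.2.2.1 : ℂ) - c.2.2.2.1) * Complex.I) * ((c.2.2.2.2 : ℂ) + 1)⁻¹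

theorem exists_gaussVal_eq {z : ℂ} (hz : IsComplexRational z) : ∃ c, gaussVal c = z := by
  obtain ⟨p, q, rfl⟩ := hz
  have key : ∀ (r : ℚ) (n : ℕ), ((r.num * n).toNat : ℂ) - ((-(r.num * n)).toNat : ℂ)
      = (r * (r.den * n : ℕ) : ℂ) := by
    intro r n
    have h1 : ((r.num * n).toNat : ℤ) - ((-(r.num * n)).toNat : ℤ) = r.num * n := by omega
    have h2 : ((r.num * n).toNat : ℂ) - ((-(r.num * n)).toNat : ℂ) = r.num * n := by
      exact_mod_cast h1
    have h3 : (r : ℂ) * r.den = r.num := by exact_mod_cast Rat.mul_den_eq_num r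
    rw [h2, ← h3]; push_cast; ring
  refine ⟨((p.num * q.den).toNat, (-(p.num * q.den)).toNat, (q.num * p.den).toNat,
    (-(q.num * p.den)).toNat, p.den * q.den - 1), ?_⟩
  have hpos : 0 < p.den * q.den := Nat.mul_pos p.den_pos q.den_pos
  have h4 : (((p.den * q.den - 1 : ℕ) : ℂ) + 1) = (p.den * q.den : ℕ) := by
    rw [← Nat.cast_succ]; congr 1; omega
  have h5 : ((p.den * q.den : ℕ) : ℂ) ≠ 0 := Nat.cast_ne_zero.2 hpos.ne'
  simp only [gaussVal]
  rw [key, key, h4, mul_comm q.den p.den]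
  field_simp

/-- Codes of finitely supported sequences of Gaussian rationals. -/
abbrev VecCode := List GaussCode

/-- The `i`-th coefficient of a coded vector; it is `0` beyond the length of the code. -/
noncomputable def coef (v : VecCode) (i : ℕ) : ℂ := gaussVal (v[i]?.getD (0, 0, 0, 0, 0))

theorem coef_of_length_le {v : VecCode} {i : ℕ} (h : v.length ≤ i) : coef v i = 0 := by
  simp [coef, List.getElem?_eq_none h, gaussVal]

theorem exists_coef_eq {z : ℕ → ℂ} (hz : ∀ i, IsComplexRational (z i)) (m : ℕ) :
    ∃ v : VecCode, v.length = m ∧ ∀ i, coef v i = if i < m then z i else 0 := by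
  choose c hc using fun i => exists_gaussVal_eq (hz i)
  refine ⟨(List.range m).map c, by simp, fun i => ?_⟩
  split_ifs with h
  · simp [coef, h, hc]
  · exact coef_of_length_le (by simpa using h)

theorem isRecursiveComplexRational_coef :
    IsRecursiveComplexRational fun x : VecCode × ℕ => coef x.1 x.2 := by
  have h : IsRecursiveComplexRational gaussVal := by
    have h1 : Computable fun c : GaussCode => c.1 := Computable.fst
    have h2 : Computable fun c : GaussCode => c.2.1 := Computable.fst.comp Computable.snd
    have h3 : Computable fun c : GaussCode => c.2.2.1 :=
      Computable.fst.comp (Computable.snd.comp Computable.snd)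
    have h4 : Computable fun c : GaussCode => c.2.2.2 :=
      Computable.snd.comp (Computable.snd.comp Computable.snd)
    refine ⟨_, _, ((IsComputableRat.natCast h1).sub (.natCast h2)).mul
      (.inv_natCast_succ (Computable.snd.comp h4)),
      ((IsComputableRat.natCast h3).sub (.natCast (Computable.fst.comp h4))).mul
      (.inv_natCast_succ (Computable.snd.comp h4)), fun c => ?_⟩
    simp only [gaussVal]
    push_cast
    ring
  exact h.comp (Computable.option_getD (Computable.list_getElem?.comp Computable.fst Computable.snd)
    (Computable.const _))

theorem isComplexRational_coef (v : VecCode) (i : ℕ) : IsComplexRational (coef v i) := by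
  obtain ⟨p, q, -, -, h⟩ := isRecursiveComplexRational_coef
  exact ⟨_, _, h (v, i)⟩

namespace IsComplexRational

variable {z w : ℂ}

theorem mul (hz : IsComplexRational z) (hw : IsComplexRational w) : IsComplexRational (z * w) := by
  obtain ⟨p, q, rfl⟩ := hz
  obtain ⟨p', q', rfl⟩ := hw
  refine ⟨p * p' - q * q', p * q' + q * p', ?_⟩
  push_cast; linear_combination (q * q' : ℂ) * Complex.I_mul_I

theorem add (hz : IsComplexRational z) (hw : IsComplexRational w) : IsComplexRational (z + w) := by
  obtain ⟨p, q, rfl⟩ := hz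
  obtain ⟨p', q', rfl⟩ := hw
  exact ⟨p + p', q + q', by push_cast; ring⟩

theorem ratCast (r : ℚ) : IsComplexRational r := ⟨r, 0, by simp⟩

theorem sub (hz : IsComplexRational z) (hw : IsComplexRational w) : IsComplexRational (z - w) := by
  simpa [sub_eq_add_neg] using hz.add ((ratCast (-1)).mul hw)

end IsComplexRational

theorem IsRecursiveComplexRational.isComplexRational {α : Type*} [Primcodable α] {z : α → ℂ}
    (hz : IsRecursiveComplexRational z) (x : α) : IsComplexRational (z x) :=
  let ⟨_, _, _, _, h⟩ := hz
  ⟨_, _, h x⟩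

/-- The matrix entries of the operator `opOf e l`, see `inner_opOf`. -/
noncomputable def entry (l : List VecCode) (k j : ℕ) : ℂ :=
  (l.map fun v => coef v j * (starRingEnd ℂ) (coef v k)).sum

/-- A bound for the supports of the vectors in `l`. -/
def width (l : List VecCode) : ℕ := (l.map List.length).sum

theorem length_le_width {l : List VecCode} {v : VecCode} (h : v ∈ l) : v.length ≤ width l :=
  List.single_le_sum (by simp) _ (List.mem_map_of_mem h)

theorem sum_range_getD {M : Type*} [AddCommMonoid M] {β : Type*} (l : List β) (d : β) (f : β → M) :
    ∑ i ∈ Finset.range l.length, f (l[i]?.getD d) = (l.map f).sum := by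
  induction l with
  | nil => simp
  | cons a l ih => simp [Finset.sum_range_succ', ih, add_comm]

theorem computable_width : Computable width := by
  have h : Computable fun l : List VecCode => ∑ i ∈ Finset.range l.length, (l[i]?.getD []).length :=
    Computable.nat_sum_range (f := fun x : List VecCode × ℕ => (x.1[x.2]?.getD []).length)
      (Computable.list_length.comp (Computable.option_getD (Computable.list_getElem?.comp
        Computable.fst Computable.snd) (Computable.const _))) Computable.list_length
  exact h.of_eq fun l => sum_range_getD l [] List.length

theorem isRecursiveComplexRational_entry :
    IsRecursiveComplexRational fun x : List VecCode × ℕ × ℕ => entry x.1 x.2.1 x.2.2 := by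
  have hv : Computable fun y : (List VecCode × ℕ × ℕ) × ℕ => y.1.1[y.2]?.getD [] :=
    Computable.option_getD (Computable.list_getElem?.comp
      (Computable.fst.comp Computable.fst) Computable.snd) (Computable.const _)
  have h1 := isRecursiveComplexRational_coef.comp
    (hv.pair (Computable.snd.comp (Computable.snd.comp Computable.fst)))
  have h2 := isRecursiveComplexRational_coef.comp
    (hv.pair (Computable.fst.comp (Computable.snd.comp Computable.fst)))
  exact ((h1.mul h2.conj).sum_range (Computable.list_length.comp Computable.fst)).of_eq
    fun x => sum_range_getD x.1 [] fun v => coef v x.2.2 * (starRingEnd ℂ) (coef v x.2.1)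

theorem entry_eq_zero {l : List VecCode} {k j : ℕ} (h : width l ≤ k ∨ width l ≤ j) :
    entry l k j = 0 := by
  refine List.sum_eq_zero fun z hz => ?_
  obtain ⟨v, hv, rfl⟩ := List.mem_map.1 hz
  rcases h with h | h
  · rw [coef_of_length_le ((length_le_width hv).trans h), map_zero, mul_zero]
  · rw [coef_of_length_le ((length_le_width hv).trans h), zero_mul]

section Vectors

variable {X : Type*} [NormedAddCommGroup X] [InnerProductSpace ℂ X]

/-- The linear combination of the terms of `e` with the coefficients coded by `v`. -/
noncomputable def vec (e : ℕ → X) (v : VecCode) : X :=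
  ∑ i ∈ Finset.range v.length, coef v i • e i

theorem vec_eq_sum_range (e : ℕ → X) {v : VecCode} {N : ℕ} (h : v.length ≤ N) :
    vec e v = ∑ i ∈ Finset.range N, coef v i • e i :=
  Finset.sum_subset (Finset.range_mono h) fun i _ hi => by
    rw [coef_of_length_le (by simpa using hi), zero_smul]

theorem inner_vec {e : ℕ → X} (he : Orthonormal ℂ e) (v : VecCode) (k : ℕ) :
    inner ℂ (e k) (vec e v) = coef v k := by
  rw [vec_eq_sum_range e (le_max_left v.length (k + 1)), inner_sum]
  simp only [inner_smul_right, orthonormal_iff_ite.1 he, mul_ite, mul_one, mul_zero,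
    Finset.sum_ite_eq, Finset.mem_range]
  rw [if_pos (lt_of_lt_of_le (Nat.lt_succ_self k) (le_max_right _ _))]

/-- The positive operator `∑ |v⟩⟨v|`, over the coded vectors `v` in `l`. -/
noncomputable def opOf (e : ℕ → X) (l : List VecCode) : X →L[ℂ] X :=
  (l.map fun v => rankOne ℂ (vec e v) (vec e v)).sum

theorem opOf_append (e : ℕ → X) (l l' : List VecCode) :
    opOf e (l ++ l') = opOf e l + opOf e l' := by
  simp [opOf]

@[simp]
theorem opOf_nil (e : ℕ → X) : opOf e [] = 0 := rfl

@[simp]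
theorem opOf_cons (e : ℕ → X) (v : VecCode) (l : List VecCode) :
    opOf e (v :: l) = rankOne ℂ (vec e v) (vec e v) + opOf e l := by
  simp [opOf]

theorem inner_opOf {e : ℕ → X} (he : Orthonormal ℂ e) (l : List VecCode) (k j : ℕ) :
    inner ℂ (e j) (opOf e l (e k)) = entry l k j := by
  induction l with
  | nil => simp [entry]
  | cons v l ih =>
    have : entry (v :: l) k j = coef v j * (starRingEnd ℂ) (coef v k) + entry l k j := by
      simp [entry]
    rw [this, ← ih, opOf_cons, _root_.add_apply, inner_add_right, rankOne_apply, inner_smul_right,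
      inner_vec he, ← inner_conj_symm, inner_vec he, mul_comm]

theorem isSquareRationalOperator_opOf {e : ℕ → X} (he : Orthonormal ℂ e) (l : List VecCode) :
    IsSquareRationalOperator e (width l) (opOf e l) := by
  refine ⟨fun k j h => ?_, fun k j => ?_⟩
  · rw [inner_opOf he, entry_eq_zero h]
  · rw [inner_opOf he]
    exact isRecursiveComplexRational_entry.isComplexRational (l, k, j)

variable [CompleteSpace X]

theorem opOf_nonneg (e : ℕ → X) (l : List VecCode) : 0 ≤ opOf e l := by
  refine List.sum_nonneg fun T hT => ?_
  obtain ⟨v, -, rfl⟩ := List.mem_map.1 hT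
  exact (nonneg_iff_isPositive _).2 (isPositive_rankOne_self _)

/-- One step of the symmetric Gaussian elimination of a positive operator. -/
theorem sub_rankOne_nonneg {T : X →L[ℂ] X} (hT : 0 ≤ T) (x : X) {a : ℝ} (ha : 0 < a)
    (hx : inner ℂ x (T x) = a) :
    0 ≤ T - ((a⁻¹ : ℝ) : ℂ) • rankOne ℂ (T x) (T x) := by
  have hs := ((nonneg_iff_isPositive T).1 hT).inner_left_eq_inner_right
  have hr : (0 : X →L[ℂ] X) ≤ rankOne ℂ (T x) (T x) :=
    (nonneg_iff_isPositive _).2 (isPositive_rankOne_self _)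
  rw [sub_nonneg, le_iff_re_inner_le
    (isSelfAdjoint_of_op_nonneg (op_nonneg_smul hr (by positivity)))
    (isSelfAdjoint_of_op_nonneg hT)]
  intro y
  -- minimize the form over `y - c x`
  set b : ℂ := inner ℂ (T x) y with hb
  have h1 := re_inner_nonneg_of_nonneg hT (y - ((a⁻¹ : ℝ) * b : ℂ) • x)
  have e1 : inner ℂ y (T x) = (starRingEnd ℂ) b := (inner_conj_symm _ _).symm
  have e2 : inner ℂ x (T y) = b := (hs x y).symm
  have ha' : (a : ℂ) ≠ 0 := by exact_mod_cast ha.ne'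
  simp only [map_sub, map_smul, inner_sub_left, inner_sub_right, inner_smul_left,
    inner_smul_right, e1, e2, hx, map_mul, Complex.conj_ofReal] at h1
  simp only [_root_.smul_apply, rankOne_apply, inner_smul_right, e1, ← hb]
  have e3 : inner ℂ y (T y) - (a⁻¹ : ℝ) * b * (starRingEnd ℂ) b -
      ((a⁻¹ : ℝ) * (starRingEnd ℂ) b * b - (a⁻¹ : ℝ) * b * ((a⁻¹ : ℝ) * (starRingEnd ℂ) b * a))
      = inner ℂ y (T y) - (a⁻¹ : ℝ) * (b * (starRingEnd ℂ) b) := by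
    push_cast; field_simp; ring
  have h2 : 0 ≤ (inner ℂ y (T y) - (a⁻¹ : ℝ) * (b * (starRingEnd ℂ) b)).re := by
    rw [← e3]; convert h1 using 2; ring
  rw [Complex.sub_re] at h2
  linarith

theorem apply_eq_zero_of_inner_eq_zero {T : X →L[ℂ] X} (hT : 0 ≤ T) {x : X}
    (hx : (inner ℂ x (T x)).re = 0) : T x = 0 := by
  have hs := ((nonneg_iff_isPositive T).1 hT).inner_left_eq_inner_right
  -- the form is nonnegative at `t T x - x` for all real `t`, hence has no linear term there
  by_contra h
  have hpos : 0 < ‖T x‖ ^ 2 := by positivity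
  have e1 : (inner ℂ (T x) (T x)).re = ‖T x‖ ^ 2 := inner_self_eq_norm_sq (𝕜 := ℂ) _
  have e2 : (inner ℂ x (T (T x))).re = ‖T x‖ ^ 2 := by rw [← hs, e1]
  set q := (inner ℂ (T x) (T (T x))).re with hq
  have key : ∀ t : ℝ, 0 ≤ t ^ 2 * q - 2 * t * ‖T x‖ ^ 2 := by
    intro t
    have h1 := re_inner_nonneg_of_nonneg hT ((t : ℂ) • T x - x)
    simp only [map_sub, map_smul, inner_sub_left, inner_sub_right, inner_smul_left,
      inner_smul_right, Complex.conj_ofReal, Complex.sub_re, Complex.re_ofReal_mul, e1, e2, hx,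
      ← hq] at h1
    linarith
  have hq0 : 0 ≤ q := re_inner_nonneg_of_nonneg hT _
  have h1 := key (‖T x‖ ^ 2 / (q + 1))
  have h2 : (‖T x‖ ^ 2 / (q + 1)) ^ 2 * q - 2 * (‖T x‖ ^ 2 / (q + 1)) * ‖T x‖ ^ 2
      = - ((‖T x‖ ^ 2 / (q + 1)) ^ 2 * (q + 2)) := by
    field_simp; ring
  rw [h2] at h1
  have : 0 < (‖T x‖ ^ 2 / (q + 1)) ^ 2 * (q + 2) := by positivity
  linarith

theorem exists_rat_four_squares {r : ℚ} (hr : 0 ≤ r) :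
    ∃ a b c d : ℚ, a ^ 2 + b ^ 2 + c ^ 2 + d ^ 2 = r := by
  obtain ⟨a, b, c, d, h⟩ := Nat.sum_four_squares (r.num.toNat * r.den)
  have hn : ((r.num.toNat : ℤ) : ℚ) = r.num := by
    rw [Int.toNat_of_nonneg (Rat.num_nonneg.2 hr)]
  have hd : (r.den : ℚ) ≠ 0 := Nat.cast_ne_zero.2 r.den_nz
  have h' : (a : ℚ) ^ 2 + b ^ 2 + c ^ 2 + d ^ 2 = r.num * r.den := by
    rw [← hn]; exact_mod_cast h
  refine ⟨a / r.den, b / r.den, c / r.den, d / r.den, ?_⟩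
  rw [div_pow, div_pow, div_pow, div_pow, ← add_div, ← add_div, ← add_div, h', pow_two,
    mul_div_mul_right _ _ hd, Rat.num_div_den]

/-- A positive operator whose matrix is finite with Gaussian rational entries is a finite sum of
operators `|v⟩⟨v|` with Gaussian rational vectors `v`: symmetric Gaussian elimination gives such a
sum with positive rational weights, and these are sums of four squares. -/
theorem exists_opOf_eq {e : ℕ → X} (he : Orthonormal ℂ e) (hg : IsGeneratingSet e)
    {T : X →L[ℂ] X} (hT : 0 ≤ T) {m : ℕ} (hm : IsSquareRationalOperator e m T) :
    ∃ l, opOf e l = T := by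
  -- induction on the number of basis vectors that `T` is not known to annihilate
  suffices H : ∀ d k, k + d = m → ∀ T : X →L[ℂ] X, 0 ≤ T → IsSquareRationalOperator e m T →
      (∀ i < k, T (e i) = 0) → ∃ l, opOf e l = T from
    H m 0 (zero_add m) T hT hm fun i hi => absurd hi (Nat.not_lt_zero i)
  intro d
  induction d with
  | zero =>
    intro k hk T hT hm h0
    refine ⟨[], op_ext_of_generating hg fun i j => ?_⟩
    rcases lt_or_ge i k with h | h
    · simp [h0 i h]
    · rw [hm.1 i j (Or.inl (by omega))]; simp
  | succ d ih =>
    intro k hk T hT hm h0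
    have hs := ((nonneg_iff_isPositive T).1 hT).inner_left_eq_inner_right
    obtain ⟨p, q, hpq⟩ := hm.2 k k
    have hre : (inner ℂ (e k) (T (e k))).re = p := by rw [hpq]; simp
    have hp0 : 0 ≤ p := by
      have := re_inner_nonneg_of_nonneg hT (e k)
      rw [hre] at this; exact_mod_cast this
    have hval : inner ℂ (e k) (T (e k)) = ((p : ℝ) : ℂ) := by
      have hsa : (starRingEnd ℂ) (inner ℂ (e k) (T (e k))) = inner ℂ (e k) (T (e k)) := by
        rw [inner_conj_symm, hs]
      rw [← Complex.conj_eq_iff_re.1 hsa, hre]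
    -- if the pivot `p = ⟪eₖ, T eₖ⟫` is zero, then so is `T eₖ`; otherwise subtract
    -- `p⁻¹ |T eₖ⟩⟨T eₖ|`, with `p⁻¹` written as a sum of four squares
    rcases hp0.eq_or_lt with hp | hp
    · have hk0 : T (e k) = 0 := apply_eq_zero_of_inner_eq_zero hT (by rw [hre, ← hp]; simp)
      refine ih (k + 1) (by omega) T hT hm fun i hi => ?_
      rcases Nat.lt_succ_iff_lt_or_eq.1 hi with h | rfl
      · exact h0 i h
      · exact hk0
    · have hpR : (0 : ℝ) < p := by exact_mod_cast hp
      obtain ⟨a, b, c, r, habc⟩ := exists_rat_four_squares (inv_nonneg.2 hp0)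
      -- `w s` codes the vector `s T eₖ`
      have hw : ∀ s : ℚ, ∃ w : VecCode, vec e w = (s : ℂ) • T (e k) := by
        intro s
        obtain ⟨w, hwl, hwc⟩ := exists_coef_eq
          (z := fun j => (s : ℂ) * inner ℂ (e j) (T (e k)))
          (fun j => (IsComplexRational.ratCast s).mul (hm.2 k j)) m
        refine ⟨w, hg.eq_of_inner_right ℂ fun v hv => ?_⟩
        induction hv using Submodule.span_induction with
        | mem y hy =>
          obtain ⟨j, rfl⟩ := hy
          rw [inner_vec he, hwc, inner_smul_right]
          split_ifs with hj
          · rfl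
          · rw [hm.1 k j (Or.inr (not_lt.1 hj)), mul_zero]
        | zero => simp
        | add y z _ _ hy hz => rw [inner_add_left, hy, hz, inner_add_left]
        | smul a y _ hy => rw [inner_smul_left, hy, inner_smul_left]
      choose w hw using hw
      have hop : opOf e [w a, w b, w c, w r] =
          (((p : ℝ)⁻¹ : ℝ) : ℂ) • rankOne ℂ (T (e k)) (T (e k)) := by
        have : (((p : ℝ)⁻¹ : ℝ) : ℂ) = (a : ℂ) ^ 2 + b ^ 2 + c ^ 2 + r ^ 2 := by
          have h2 : ((p⁻¹ : ℚ) : ℂ) = ((a ^ 2 + b ^ 2 + c ^ 2 + r ^ 2 : ℚ) : ℂ) := by rw [habc]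
          push_cast at h2 ⊢
          exact h2
        rw [this]
        ext x
        simp only [opOf_cons, opOf_nil, hw, _root_.add_apply, _root_.smul_apply, rankOne_apply,
          inner_smul_left, map_ratCast, smul_smul, add_zero, ← add_smul]
        congr 1
        ring
      have hk0 : ∀ i, T (e i) = 0 → (T - opOf e [w a, w b, w c, w r]) (e i) = 0 := by
        intro i hi
        rw [hop]
        simp only [_root_.sub_apply, _root_.smul_apply, rankOne_apply, hs, hi, inner_zero_right,
          zero_smul, smul_zero, sub_zero]
      have hsq : IsSquareRationalOperator e m (T - opOf e [w a, w b, w c, w r]) := by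
        refine ⟨fun i j hij => ?_, fun i j => ?_⟩
        · rw [_root_.sub_apply, inner_sub_right, hm.1 i j hij, hop, _root_.smul_apply,
            rankOne_apply, inner_smul_right, inner_smul_right, hs]
          rcases hij with h | h
          · rw [hm.1 i k (Or.inl h)]; simp
          · rw [hm.1 k j (Or.inr h)]; simp
        · rw [_root_.sub_apply, inner_sub_right, inner_opOf he]
          exact (hm.2 i j).sub (isRecursiveComplexRational_entry.isComplexRational (_, i, j))
      have hker : ∀ i < k + 1, (T - opOf e [w a, w b, w c, w r]) (e i) = 0 := by
        intro i hi
        rcases Nat.lt_succ_iff_lt_or_eq.1 hi with h | rfl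
        · exact hk0 i (h0 i h)
        · have hp' : (p : ℂ) ≠ 0 := by exact_mod_cast hp.ne'
          rw [hop]
          simp only [_root_.sub_apply, _root_.smul_apply, rankOne_apply, hs, hval, smul_smul]
          push_cast
          rw [inv_mul_cancel₀ hp', one_smul, sub_self]
      obtain ⟨l, hl⟩ := ih (k + 1) (by omega) (T - opOf e [w a, w b, w c, w r])
        (by rw [hop]; exact sub_rankOne_nonneg hT (e k) hpR hval) hsq hker
      exact ⟨[w a, w b, w c, w r] ++ l, by rw [opOf_append, hl, add_sub_cancel]⟩

/-- Bounded quantification preserves decidability. -/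
theorem exists_decide_forall_lt {α : Type*} [Primcodable α] {c : α × ℕ → Bool} (hc : Computable c)
    {N : α → ℕ} (hN : Computable N) :
    ∃ d : α → Bool, Computable d ∧ ∀ x, d x = true ↔ ∀ k < N x, c (x, k) = true := by
  refine ⟨fun x => (N x).rec (motive := fun _ => Bool) true fun k b => b && c (x, k),
    Computable.nat_rec hN (Computable.const true) (Computable.to₂
      (Primrec.and.to_comp.comp (Computable.snd.comp Computable.snd)
        (hc.comp (Computable.fst.pair (Computable.fst.comp Computable.snd))))), fun x => ?_⟩
  beta_reduce
  induction N x with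
  | zero => simp
  | succ n ih =>
    change ((_ && c (x, n)) = true) ↔ _
    rw [Bool.and_eq_true, ih]
    exact (Nat.forall_lt_succ_right (p := fun k => c (x, k) = true)).symm

/-- Equality of finite matrices of Gaussian rationals is decidable. -/
theorem exists_decide_matrix_eq {α : Type*} [Primcodable α] {z z' : α × ℕ × ℕ → ℂ}
    (hz : IsRecursiveComplexRational z) (hz' : IsRecursiveComplexRational z') {N : α → ℕ}
    (hN : Computable N) :
    ∃ d : α → Bool, Computable d ∧
      ∀ x, d x = true ↔ ∀ k < N x, ∀ j < N x, z (x, k, j) = z' (x, k, j) := by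
  obtain ⟨c, hc, h⟩ := hz.exists_decide_eq hz'
  obtain ⟨c', hc', h'⟩ := exists_decide_forall_lt
    (c := fun y : (α × ℕ) × ℕ => c (y.1.1, y.1.2, y.2))
    (hc.comp ((Computable.fst.comp Computable.fst).pair
      ((Computable.snd.comp Computable.fst).pair Computable.snd)))
    (N := fun y => N y.1) (hN.comp Computable.fst)
  obtain ⟨d, hd, h''⟩ := exists_decide_forall_lt hc' hN
  exact ⟨d, hd, fun x => by simp only [h'', h', h]⟩

/-- The decomposition of `exists_opOf_eq` can be computed from the matrix, by search. -/
theorem exists_computable_opOf_eq {e : ℕ → X} (he : Orthonormal ℂ e) (hg : IsGeneratingSet e)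
    {α : Type*} [Primcodable α] {T : α → X →L[ℂ] X} (hT : ∀ a, 0 ≤ T a) {m : α → ℕ}
    (hm : Computable m) (hsq : ∀ a, IsSquareRationalOperator e (m a) (T a))
    (hrec : IsRecursiveComplexRational
      fun p : α × ℕ × ℕ => inner ℂ (e p.2.2) (T p.1 (e p.2.1))) :
    ∃ l : α → List VecCode, Computable l ∧ ∀ a, opOf e (l a) = T a := by
  have h1 : IsRecursiveComplexRational fun p : (α × List VecCode) × ℕ × ℕ =>
      entry p.1.2 p.2.1 p.2.2 :=
    isRecursiveComplexRational_entry.comp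
      (f := fun p : (α × List VecCode) × ℕ × ℕ => (p.1.2, p.2))
      ((Computable.snd.comp Computable.fst).pair Computable.snd)
  have h2 : IsRecursiveComplexRational fun p : (α × List VecCode) × ℕ × ℕ =>
      inner ℂ (e p.2.2) (T p.1.1 (e p.2.1)) :=
    hrec.comp (f := fun p : (α × List VecCode) × ℕ × ℕ => (p.1.1, p.2))
      ((Computable.fst.comp Computable.fst).pair Computable.snd)
  obtain ⟨d, hd, hdd⟩ := exists_decide_matrix_eq (α := α × List VecCode) h1 h2
    (N := fun x => m x.1 + width x.2)
    ((hm.comp Computable.fst).nat_add (computable_width.comp Computable.snd))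
  obtain ⟨l, hl, hll⟩ := exists_computable_choice hd fun a => by
    obtain ⟨l, hl⟩ := exists_opOf_eq he hg (hT a) (hsq a)
    exact ⟨l, (hdd (a, l)).2 fun k _ j _ => by rw [← inner_opOf he, hl]⟩
  refine ⟨l, hl, fun a => op_ext_of_generating hg fun k j => ?_⟩
  by_cases h : k < m a + width (l a) ∧ j < m a + width (l a)
  · rw [inner_opOf he]
    exact (hdd _).1 (hll a) k h.1 j h.2
  · have h' : m a + width (l a) ≤ k ∨ m a + width (l a) ≤ j := by
      by_contra h'
      push Not at h'
      exact h h'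
    rw [inner_opOf he, entry_eq_zero (h'.imp (by omega) (by omega)),
      (hsq a).1 k j (h'.imp (by omega) (by omega))]

end Vectors

end Codes

/-! ### A universal enumeration of admissible sequences -/

section Enumeration

open Encodable Denumerable Nat.Partrec

variable {β γ : Type*} [Primcodable β] [Primcodable γ]

/-- The `k`-th output of the `i`-th program, decoded. -/
def programItem (β : Type*) [Primcodable β] (i k : ℕ) : Part β :=
  ((ofNat Code i).eval k).bind fun m => (decode (α := β) m : Part β)

theorem partrec_programItem : Partrec fun p : ℕ × ℕ => programItem β p.1 p.2 :=
  (Code.eval_part.comp ((Computable.ofNat Code).comp Computable.fst) Computable.snd).bind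
    (Computable.ofOption (Computable.decode.comp Computable.snd)).to₂

/-- The first `K` outputs of the `i`-th program. -/
def programPrefix (β : Type*) [Primcodable β] (i K : ℕ) : Part (List β) :=
  K.rec (Part.some []) fun k IH => IH.bind fun L => (programItem β i k).map fun b => L ++ [b]

theorem partrec_programPrefix : Partrec fun p : ℕ × ℕ => programPrefix β p.1 p.2 := by
  have h : Partrec₂ fun (p : ℕ × ℕ) (q : ℕ × List β) =>
      (programItem β p.1 q.1).map fun b => q.2 ++ [b] :=
    Partrec.map (partrec_programItem.comp (g := fun y : (ℕ × ℕ) × ℕ × List β => (y.1.1, y.2.1))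
      ((Computable.fst.comp Computable.fst).pair (Computable.fst.comp Computable.snd)))
      (Computable.list_concat.comp
        ((Computable.snd.comp Computable.snd).comp Computable.fst) Computable.snd).to₂
  exact Partrec.nat_rec Computable.snd (Partrec.some.comp (Computable.const [])) h

theorem mem_programPrefix {i K : ℕ} {L : List β} (h : L ∈ programPrefix β i K) :
    L.length = K ∧ ∀ k < K, ∀ b, L[k]? = some b ↔ b ∈ programItem β i k := by
  induction K generalizing L with
  | zero =>
    obtain rfl := Part.mem_some_iff.1 h
    exact ⟨rfl, fun k hk => absurd hk (Nat.not_lt_zero k)⟩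
  | succ K ih =>
    obtain ⟨L', hL', h⟩ := Part.mem_bind_iff.1 h
    obtain ⟨b, hb, rfl⟩ := (Part.mem_map_iff _).1 h
    obtain ⟨h1, h2⟩ := ih hL'
    refine ⟨by simp [h1], fun k hk b' => ?_⟩
    rcases Nat.lt_succ_iff_lt_or_eq.1 hk with hk | rfl
    · rw [List.getElem?_append_left (by omega), h2 k hk]
    · subst h1
      rw [List.getElem?_concat_length, Option.some_inj]
      exact ⟨fun h => h ▸ hb, fun h => Part.mem_unique hb h⟩

theorem programPrefix_eq {i : ℕ} {x : ℕ → β} (h : ∀ k, x k ∈ programItem β i k) (K : ℕ) :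
    (List.range K).map x ∈ programPrefix β i K := by
  induction K with
  | zero => exact Part.mem_some _
  | succ K ih =>
    rw [List.range_succ, List.map_append]
    exact Part.mem_bind ih ((Part.mem_map_iff _).2 ⟨x K, h K, rfl⟩)

theorem exists_program {x : ℕ → β} (hx : Computable x) : ∃ i, ∀ k, x k ∈ programItem β i k := by
  have h : Nat.Partrec fun k => Part.some (encode (x k)) :=
    Partrec.nat_iff.1 (Computable.encode.comp hx).partrec
  obtain ⟨c, hc⟩ := Code.exists_code.1 h
  refine ⟨encode c, fun k => ?_⟩
  rw [programItem, ofNat_encode, hc]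
  exact Part.mem_bind (Part.mem_some _) (by simp)

/-- Let `adm` be a semidecidable property of finite sequences. There is a computable array of
processes, of which the `i`-th has delivered the item `B (i, k, n)` (or nothing yet) in place `k` at
time `n`, such that all delivered items belong to an admissible sequence, and every computable
sequence all of whose initial segments are admissible is delivered by some process. -/
theorem exists_universal_enumeration {F : List β →. γ} (hF : Partrec F) :
    ∃ B : ℕ × ℕ × ℕ → Option β, Computable B ∧
      (∀ i k n n' b, B (i, k, n) = some b → n ≤ n' → B (i, k, n') = some b) ∧
      (∀ i K n b, B (i, K, n) = some b → ∃ L : List β, L.length = K + 1 ∧ (F L).Dom ∧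
        ∀ k ≤ K, ∀ m b', B (i, k, m) = some b' → L[k]? = some b') ∧
      ∀ x : ℕ → β, Computable x → (∀ K, (F ((List.range K).map x)).Dom) →
        ∃ i, ∀ k, ∃ n, B (i, k, n) = some (x k) := by
  let Φ : ℕ × ℕ →. β := fun p => (programPrefix β p.1 (p.2 + 1)).bind fun L =>
    (F L).bind fun _ => (L[p.2]? : Part β)
  have hΦ : Partrec Φ := by
    refine (partrec_programPrefix.comp (g := fun p : ℕ × ℕ => (p.1, p.2 + 1))
      (Computable.fst.pair (Computable.succ.comp Computable.snd))).bind ?_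
    refine Partrec.bind (hF.comp Computable.snd) ?_
    exact (Computable.ofOption (Computable.list_getElem?.comp (Computable.snd.comp Computable.fst)
      ((Computable.snd.comp Computable.fst).comp Computable.fst))).to₂
  have hmem : ∀ i k b, b ∈ Φ (i, k) → ∃ L ∈ programPrefix β i (k + 1), (F L).Dom ∧
      L[k]? = some b := by
    intro i k b hb
    obtain ⟨L, hL, hb⟩ := Part.mem_bind_iff.1 hb
    obtain ⟨y, hy, hb⟩ := Part.mem_bind_iff.1 hb
    exact ⟨L, hL, Part.dom_iff_mem.2 ⟨y, hy⟩, by simpa using hb⟩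
  obtain ⟨c, hc⟩ := Code.exists_code.1 hΦ
  have heval : ∀ p : ℕ × ℕ, c.eval (encode p) = (Φ p).map encode := by
    intro p
    rw [hc]
    simp only [encodek, Part.coe_some, Part.bind_some]
  let B : ℕ × ℕ × ℕ → Option β := fun q =>
    (c.evaln q.2.2 (encode (q.1, q.2.1))).bind fun m => decode (α := β) m
  have hB : Computable B := by
    have h1 : Computable fun q : ℕ × ℕ × ℕ => encode (q.1, q.2.1) :=
      Computable.encode.comp (Computable.fst.pair (Computable.fst.comp Computable.snd))
    have h2 : Computable fun q : ℕ × ℕ × ℕ => c.evaln q.2.2 (encode (q.1, q.2.1)) :=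
      Code.primrec_evaln.to_comp.comp (f := fun a : (ℕ × Code) × ℕ => Code.evaln a.1.1 a.1.2 a.2)
        (g := fun q : ℕ × ℕ × ℕ => ((q.2.2, c), encode (q.1, q.2.1)))
        (((Computable.snd.comp Computable.snd).pair (Computable.const c)).pair h1)
    exact Computable.option_bind h2 (Computable.decode.comp Computable.snd).to₂
  have hBmem : ∀ i k n b, B (i, k, n) = some b → b ∈ Φ (i, k) := by
    intro i k n b hb
    obtain ⟨m, hm, hb⟩ := Option.bind_eq_some_iff.1 hb
    have h1 := Code.evaln_sound (Option.mem_def.2 hm)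
    rw [heval] at h1
    obtain ⟨b', hb', rfl⟩ := (Part.mem_map_iff _).1 h1
    rw [encodek] at hb
    exact Option.some_inj.1 hb ▸ hb'
  refine ⟨B, hB, ?_, ?_, ?_⟩
  · intro i k n n' b hb hn
    obtain ⟨m, hm, hb⟩ := Option.bind_eq_some_iff.1 hb
    have h1 := Option.mem_def.1 (Code.evaln_mono hn (Option.mem_def.2 hm))
    simp only [B]
    rw [h1]
    exact hb
  · intro i K n b hb
    obtain ⟨L, hL, hd, -⟩ := hmem i K b (hBmem i K n b hb)
    obtain ⟨h1, h2⟩ := mem_programPrefix hL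
    refine ⟨L, h1, hd, fun k hk m b' hb' => ?_⟩
    obtain ⟨L', hL', -, hb''⟩ := hmem i k b' (hBmem i k m b' hb')
    rw [h2 k (by omega)]
    exact ((mem_programPrefix hL').2 k (Nat.lt_succ_self k) b').1 hb''
  · intro x hx hadm
    obtain ⟨i, hi⟩ := exists_program hx
    refine ⟨i, fun k => ?_⟩
    have h1 : x k ∈ Φ (i, k) :=
      Part.mem_bind (programPrefix_eq hi (k + 1)) (Part.mem_bind (Part.get_mem (hadm (k + 1)))
        (by simp))
    have h2 : encode (x k) ∈ c.eval (encode (i, k)) := by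
      rw [heval]; exact Part.mem_map _ h1
    obtain ⟨n, hn⟩ := Code.evaln_complete.1 h2
    refine ⟨n, ?_⟩
    simp only [B]
    rw [Option.mem_def.1 hn]
    simp

end Enumeration

/-! ### A universal lower-computable semi-POVM for a fixed basis -/

section Universal

set_option linter.unusedSectionVars false

open InnerProductSpace ContinuousLinearMap Filter Topology

variable {X : Type*} [NormedAddCommGroup X] [InnerProductSpace ℂ X] [CompleteSpace X] {e : ℕ → X}

/-- `∑ |v⟩⟨v| ≤ I` is semidecidable: a certificate is a list `u` of vectors for which
`∑ |v⟩⟨v| + ∑ |u⟩⟨u|` is the projection onto the span of the first `N` basis vectors. -/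
theorem exists_partrec_opOf_le_one (he : Orthonormal ℂ e) (hg : IsGeneratingSet e) :
    ∃ F : List VecCode →. List VecCode × ℕ, Partrec F ∧ ∀ l, (F l).Dom ↔ opOf e l ≤ 1 := by
  let A := List VecCode × List VecCode × ℕ
  have happ : Computable fun x : A => x.1 ++ x.2.1 :=
    Computable.list_append.comp Computable.fst (Computable.fst.comp Computable.snd)
  have h1 : IsRecursiveComplexRational fun p : A × ℕ × ℕ =>
      entry (p.1.1 ++ p.1.2.1) p.2.1 p.2.2 :=
    isRecursiveComplexRational_entry.comp
      (f := fun p : A × ℕ × ℕ => (p.1.1 ++ p.1.2.1, p.2))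
      ((happ.comp Computable.fst).pair Computable.snd)
  have h2 : IsRecursiveComplexRational fun p : A × ℕ × ℕ =>
      bif decide (p.2.1 = p.2.2) && decide (p.2.1 < p.1.2.2) then ((1 : ℚ) : ℂ)
        else ((0 : ℚ) : ℂ) :=
    .cond (Primrec.and.to_comp.comp
      (Computable.decide_eq (Computable.fst.comp Computable.snd)
        (Computable.snd.comp Computable.snd))
      (Computable.decide_nat_lt (Computable.fst.comp Computable.snd)
        (Computable.snd.comp (Computable.snd.comp Computable.fst))))
      (.ratCast (.const 1)) (.ratCast (.const 0))
  obtain ⟨d, hd, hdd⟩ := exists_decide_matrix_eq (α := A) h1 h2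
    (N := fun x => x.2.2 + width (x.1 ++ x.2.1))
    ((Computable.snd.comp Computable.snd).nat_add (computable_width.comp happ))
  -- the decidable condition says what it should
  have hdd' : ∀ l u N, d (l, u, N) = true ↔ opOf e l + opOf e u = initialProj e N := by
    intro l u N
    rw [hdd, ← opOf_append]
    constructor
    · intro h
      refine op_ext_of_generating hg fun k j => ?_
      rw [inner_opOf he, inner_initialProj he]
      by_cases hkj : k < N + width (l ++ u) ∧ j < N + width (l ++ u)
      · rw [h k hkj.1 j hkj.2]
        by_cases h1 : k = j <;> by_cases h2 : k < N <;> simp [h1, h2]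
      · have h' : N + width (l ++ u) ≤ k ∨ N + width (l ++ u) ≤ j := by
          by_contra h'
          push Not at h'
          exact hkj h'
        rw [entry_eq_zero (h'.imp (by omega) (by omega)), if_neg (by omega)]
    · intro h k _ j _
      have := inner_initialProj he N k j
      rw [← h, inner_opOf he] at this
      simp only [this]
      by_cases h1 : k = j <;> by_cases h2 : k < N <;> simp [h1, h2]
  obtain ⟨F, hF, hF1, hF2⟩ := exists_partrec_choice hd
  refine ⟨F, hF, fun l => ⟨fun h => ?_, fun h => ?_⟩⟩
  · have h3 := (hdd' l _ _).1 (hF1 l _ (Part.get_mem h))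
    exact ((le_add_of_nonneg_right (opOf_nonneg e _)).trans h3.le).trans (initialProj_le_one he _)
  · have hl := isSelfAdjoint_of_op_nonneg (opOf_nonneg e l)
    have hsq := isSquareRationalOperator_opOf he l
    have h3 : opOf e l ≤ initialProj e (width l) := by
      simpa using le_smul_initialProj he hg hl hsq.1 (c := 1) (by simpa using h)
    obtain ⟨u, hu⟩ := exists_opOf_eq he hg (sub_nonneg.2 h3) (m := width l) <| by
      refine ⟨fun k j hkj => ?_, fun k j => ?_⟩
      · rw [_root_.sub_apply, inner_sub_right, hsq.1 k j hkj, inner_initialProj he,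
          if_neg (by omega), sub_zero]
      · rw [_root_.sub_apply, inner_sub_right, inner_initialProj he]
        refine IsComplexRational.sub ?_ (hsq.2 k j)
        split_ifs
        · exact ⟨1, 0, by simp⟩
        · exact ⟨0, 0, by simp⟩
    exact hF2 l (u, width l) ((hdd' _ _ _).2 (by rw [hu, add_sub_cancel]))

/-- An item `(s, l)` stands for the contribution `opOf e l` to the operator at `s`. -/
abbrev Item := List Bool × List VecCode

/-- The vectors which a possibly undelivered item contributes to the operator at `s`. -/
def itemAt (o : Option Item) (s : List Bool) : List VecCode :=
  o.elim [] fun x => bif decide (x.1 = s) then x.2 else []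

theorem computable_itemAt : Computable fun x : Option Item × List Bool => itemAt x.1 x.2 := by
  have h : Computable fun y : (Option Item × List Bool) × Item =>
      bif decide (y.2.1 = y.1.2) then y.2.2 else [] :=
    Computable.cond (Computable.decide_eq (Computable.fst.comp Computable.snd)
      (Computable.snd.comp Computable.fst)) (Computable.snd.comp Computable.snd)
      (Computable.const [])
  refine (Computable.option_casesOn (f := fun _ => ([] : List VecCode)) Computable.fst
    (Computable.const []) h.to₂).of_eq fun x => ?_
  rcases x with ⟨_ | _, _⟩ <;> rfl

theorem sum_itemAt_le (o : Option Item) (S : Finset (List Bool)) :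
    ∑ s ∈ S, opOf e (itemAt o s) ≤ opOf e (o.elim [] Prod.snd) := by
  cases o with
  | none => simp [itemAt]
  | some x =>
    have h : ∀ s, opOf e (itemAt (some x) s) = if x.1 = s then opOf e x.2 else 0 := by
      intro s
      by_cases h : x.1 = s <;> simp [itemAt, h]
    simp only [h, Finset.sum_ite_eq]
    split_ifs
    · exact le_rfl
    · exact opOf_nonneg e _

theorem opOf_flatMap (L : List Item) (d : Item) :
    opOf e (L.flatMap Prod.snd) = ∑ k ∈ Finset.range L.length, opOf e (L[k]?.getD d).2 := by
  rw [sum_range_getD L d fun x => opOf e x.2]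
  induction L with
  | nil => rfl
  | cons x L ih => simp [opOf_append, ih]

/-- For each basis there is a lower-computable semi-POVM that dominates, up to constants, all those
which are given by a computable sequence of items whose operators add up to at most `I`: the
weighted sum of the outcomes of all processes of `exists_universal_enumeration`. -/
theorem exists_dominating_semiPOVM (he : Orthonormal ℂ e) (hg : IsGeneratingSet e) :
    ∃ M : List Bool → X →L[ℂ] X, IsSemiPOVM M ∧ IsLowerComputableWrt e M ∧
      ∀ x : ℕ → Item, Computable x → (∀ K, ∑ k ∈ Finset.range K, opOf e (x k).2 ≤ 1) →
        ∃ c : ℝ, 0 < c ∧ ∀ K s,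
          (c : ℂ) • ∑ k ∈ Finset.range K, opOf e (itemAt (some (x k)) s) ≤ M s := by
  obtain ⟨F₀, hF₀, hF₀d⟩ := exists_partrec_opOf_le_one he hg
  have hflat : Computable fun L : List Item => L.flatMap Prod.snd :=
    (Primrec.list_flatMap (f := fun L : List Item => L) (g := fun _ x => x.2) Primrec.id
      (Primrec.snd.comp Primrec.snd).to₂).to_comp
  obtain ⟨B, hB, hBmono, hBadm, hBuniv⟩ := exists_universal_enumeration (hF₀.comp hflat)
  -- `G i n s` is the operator at `s` assembled by process `i` up to time `n`
  let ℓ : ℕ → ℕ → ℕ → List Bool → List VecCode := fun i k n s => itemAt (B (i, k, n)) s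
  let G : ℕ → ℕ → List Bool → X →L[ℂ] X := fun i n s => ∑ k ∈ Finset.range n, opOf e (ℓ i k n s)
  let w : ℕ → ℝ := fun i => (2⁻¹ : ℝ) ^ (i + 1)
  let f : ℕ → List Bool → X →L[ℂ] X := fun n s => ∑ i ∈ Finset.range n, (w i : ℂ) • G i n s
  have hw : ∀ i, 0 ≤ w i := fun i => by positivity
  have hwsum : ∀ n, ∑ i ∈ Finset.range n, w i ≤ 1 := by
    intro n
    have : ∑ i ∈ Finset.range n, w i = 1 - (2⁻¹ : ℝ) ^ n := by
      induction n with
      | zero => simp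
      | succ n ih => rw [Finset.sum_range_succ, ih]; simp only [w]; ring
    rw [this]
    linarith [show (0 : ℝ) ≤ (2⁻¹ : ℝ) ^ n by positivity]
  have hG0 : ∀ i n s, 0 ≤ G i n s := fun i n s => Finset.sum_nonneg fun k _ => opOf_nonneg e _
  have hℓmono : ∀ i k n s, opOf e (ℓ i k n s) ≤ opOf e (ℓ i k (n + 1) s) := by
    intro i k n s
    simp only [ℓ]
    cases h : B (i, k, n) with
    | none => exact opOf_nonneg e _
    | some b => rw [hBmono i k n (n + 1) b h n.le_succ]
  have hGmono : ∀ i n s, G i n s ≤ G i (n + 1) s := by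
    intro i n s
    simp only [G]
    rw [Finset.sum_range_succ]
    exact (Finset.sum_le_sum fun k _ => hℓmono i k n s).trans
      (le_add_of_nonneg_right (opOf_nonneg e _))
  have hfmono : ∀ s, Monotone fun n => f n s := by
    intro s
    refine monotone_nat_of_le_succ fun n => ?_
    simp only [f]
    rw [Finset.sum_range_succ]
    exact (Finset.sum_le_sum fun i _ => op_smul_le_smul (hGmono i n s) (hw i)).trans
      (le_add_of_nonneg_right (op_nonneg_smul (hG0 _ _ _) (hw n)))
  have hf0 : ∀ n s, 0 ≤ f n s := fun n s =>
    Finset.sum_nonneg fun i _ => op_nonneg_smul (hG0 i n s) (hw i)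
  -- everything delivered by process `i` belongs to one admissible sequence
  have hdel : ∀ i n K, ∑ k ∈ Finset.range K, opOf e ((B (i, k, n)).elim [] Prod.snd) ≤ 1 := by
    intro i n K
    induction K with
    | zero => simp
    | succ K ih =>
      cases hK : B (i, K, n) with
      | none => rw [Finset.sum_range_succ, hK]; simpa using ih
      | some b =>
        obtain ⟨L, hL1, hL2, hL3⟩ := hBadm i K n b hK
        refine le_trans ?_ ((hF₀d _).1 hL2)
        rw [opOf_flatMap L b, hL1]
        refine Finset.sum_le_sum fun k hk => ?_
        cases hk' : B (i, k, n) with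
        | none => exact opOf_nonneg e _
        | some b' =>
          rw [hL3 k (Nat.lt_succ_iff.1 (Finset.mem_range.1 hk)) n b' hk']
          exact le_rfl
  have hGsum : ∀ i n (S : Finset (List Bool)), ∑ s ∈ S, G i n s ≤ 1 := by
    intro i n S
    simp only [G]
    rw [Finset.sum_comm]
    exact (Finset.sum_le_sum fun k _ => sum_itemAt_le _ S).trans (hdel i n n)
  have hfsum : ∀ n (S : Finset (List Bool)), ∑ s ∈ S, f n s ≤ 1 := by
    intro n S
    simp only [f]
    rw [Finset.sum_comm]
    simp only [← Finset.smul_sum]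
    refine (Finset.sum_le_sum fun i _ => op_smul_le_smul (hGsum i n S) (hw i)).trans ?_
    rw [← Finset.sum_smul, ← Complex.ofReal_sum]
    simpa using op_smul_le_smul_of_le (X := X) op_one_nonneg (hwsum n)
  have hf1 : ∀ n s, f n s ≤ 1 := fun n s => by simpa using hfsum n {s}
  have hfs : ∀ n s, IsSelfAdjoint (f n s) := fun n s => isSelfAdjoint_of_op_nonneg (hf0 n s)
  choose M hM using fun s => exists_tendsto_of_monotone (hfmono s)
    (fun n => hf0 n s) fun n => hf1 n s
  have hfM : ∀ n s, f n s ≤ M s := fun n s =>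
    op_ge_of_tendsto_const (hM s) (fun n => hfs n s) (hfs n s)
      (eventually_atTop.2 ⟨n, fun m hm => hfmono s hm⟩)
  have hM0 : ∀ s, 0 ≤ M s := fun s => (hf0 0 s).trans (hfM 0 s)
  have hMsum : ∀ S : Finset (List Bool), ∑ s ∈ S, M s ≤ 1 := by
    intro S
    refine op_le_of_tendsto_const (l := atTop) (T := fun n => ∑ s ∈ S, f n s) (fun x => ?_)
      (fun n => isSelfAdjoint_of_op_nonneg (Finset.sum_nonneg fun s _ => hf0 n s)) (.one _)
      (Eventually.of_forall fun n => hfsum n S)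
    simp only [_root_.sum_apply]
    exact tendsto_finsetSum _ fun s _ => hM s x
  have hℓc : Computable fun y : ((ℕ × List Bool) × ℕ) × ℕ => ℓ y.1.2 y.2 y.1.1.1 y.1.1.2 :=
    computable_itemAt.comp
      (g := fun y : ((ℕ × List Bool) × ℕ) × ℕ => (B (y.1.2, y.2, y.1.1.1), y.1.1.2))
      ((hB.comp ((Computable.snd.comp Computable.fst).pair (Computable.snd.pair
        (Computable.fst.comp (Computable.fst.comp Computable.fst))))).pair
        (Computable.snd.comp (Computable.fst.comp Computable.fst)))
  have hentry : ∀ n s k j, inner ℂ (e j) (f n s (e k)) =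
      ∑ a ∈ Finset.range n, (w a : ℂ) * ∑ b ∈ Finset.range n, entry (ℓ a b n s) k j := by
    intro n s k j
    simp only [f, G, _root_.sum_apply, _root_.smul_apply, inner_sum, inner_smul_right,
      inner_opOf he]
  have hrec : IsRecursiveComplexRational fun p : ℕ × List Bool × ℕ × ℕ =>
      inner ℂ (e p.2.2.2) (f p.1 p.2.1 (e p.2.2.1)) := by
    have h1 : IsRecursiveComplexRational fun y : ((ℕ × List Bool × ℕ × ℕ) × ℕ) × ℕ =>
        entry (ℓ y.1.2 y.2 y.1.1.1 y.1.1.2.1) y.1.1.2.2.1 y.1.1.2.2.2 := by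
      have hp : Computable fun y : ((ℕ × List Bool × ℕ × ℕ) × ℕ) × ℕ => y.1.1 :=
        Computable.fst.comp Computable.fst
      refine isRecursiveComplexRational_entry.comp
        (f := fun y : ((ℕ × List Bool × ℕ × ℕ) × ℕ) × ℕ =>
          (ℓ y.1.2 y.2 y.1.1.1 y.1.1.2.1, y.1.1.2.2)) (Computable.pair ?_
            (Computable.snd.comp (Computable.snd.comp hp)))
      exact hℓc.comp
        (f := fun y : ((ℕ × List Bool) × ℕ) × ℕ => ℓ y.1.2 y.2 y.1.1.1 y.1.1.2)
        (g := fun y : ((ℕ × List Bool × ℕ × ℕ) × ℕ) × ℕ => (((y.1.1.1, y.1.1.2.1), y.1.2), y.2))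
        ((((Computable.fst.comp hp).pair (Computable.fst.comp (Computable.snd.comp hp))).pair
          (Computable.snd.comp Computable.fst)).pair Computable.snd)
    have h2 := h1.sum_range (N := fun y : (ℕ × List Bool × ℕ × ℕ) × ℕ => y.1.1)
      (Computable.fst.comp Computable.fst)
    have h3 : IsRecursiveComplexRational fun y : (ℕ × List Bool × ℕ × ℕ) × ℕ =>
        (((2⁻¹ : ℚ) ^ (y.2 + 1) : ℚ) : ℂ) :=
      .ratCast (.half_pow (Computable.succ.comp Computable.snd))
    refine ((h3.mul h2).sum_range (N := fun y : ℕ × List Bool × ℕ × ℕ => y.1)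
      Computable.fst).of_eq fun p => ?_
    rw [hentry]
    refine Finset.sum_congr rfl fun a _ => ?_
    simp only [w]
    push_cast
    rfl
  refine ⟨M, ⟨fun s => (nonneg_iff_isPositive _).1 (hM0 s), ?_⟩,
    ⟨f, fun p => ∑ i ∈ Finset.range p.1, ∑ k ∈ Finset.range p.1, width (ℓ i k p.1 p.2),
      fun n s => (nonneg_iff_isPositive _).1 (hf0 n s), ?_, hM, ?_, ?_, ?_⟩, ?_⟩
  · obtain ⟨S, hS⟩ := exists_tendsto_of_monotone (T := fun A : Finset (List Bool) => ∑ s ∈ A, M s)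
      (fun A A' h => Finset.sum_le_sum_of_subset_of_nonneg h fun s _ _ => hM0 s)
      (fun A => Finset.sum_nonneg fun s _ => hM0 s) hMsum
    refine ⟨S, fun x => ?_, op_le_of_tendsto_const hS
      (fun A => isSelfAdjoint_of_op_nonneg (Finset.sum_nonneg fun s _ => hM0 s)) (.one _)
      (Eventually.of_forall hMsum)⟩
    have := hS x
    simp only [_root_.sum_apply] at this
    exact this
  · exact Computable.nat_sum_range (N := fun p : ℕ × List Bool => p.1)
      (f := fun y : (ℕ × List Bool) × ℕ =>
        ∑ k ∈ Finset.range y.1.1, width (ℓ y.2 k y.1.1 y.1.2))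
      (Computable.nat_sum_range (N := fun y : (ℕ × List Bool) × ℕ => y.1.1)
        (f := fun y : ((ℕ × List Bool) × ℕ) × ℕ => width (ℓ y.1.2 y.2 y.1.1.1 y.1.1.2))
        (computable_width.comp hℓc) (Computable.fst.comp Computable.fst)) Computable.fst
  · intro n s
    refine sub_le_sub (hfmono s n.le_succ) ?_
    have := op_smul_le_smul_of_le (X := X) op_one_nonneg
      (show (2⁻¹ : ℝ) ^ (n + 1) ≤ (2⁻¹ : ℝ) ^ n from
        pow_le_pow_of_le_one (by norm_num) (by norm_num) n.le_succ)
    simpa using this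
  · intro n s
    refine ⟨fun k j hkj => ?_, fun k j => hrec.isComplexRational (n, s, k, j)⟩
    rw [hentry]
    refine Finset.sum_eq_zero fun a ha => ?_
    rw [Finset.sum_eq_zero, mul_zero]
    intro b hb
    have h1 : width (ℓ a b n s) ≤
        ∑ i ∈ Finset.range n, ∑ k ∈ Finset.range n, width (ℓ i k n s) :=
      (Finset.single_le_sum (f := fun k => width (ℓ a k n s)) (fun _ _ => Nat.zero_le _) hb).trans
        (Finset.single_le_sum (f := fun i => ∑ k ∈ Finset.range n, width (ℓ i k n s))
          (fun _ _ => Nat.zero_le _) ha)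
    exact entry_eq_zero (hkj.imp h1.trans h1.trans)
  · exact hrec
  · intro x hx hxadm
    obtain ⟨i, hi⟩ := hBuniv x hx fun K => (hF₀d _).2 <| by
      rw [opOf_flatMap _ (x 0)]
      refine le_of_eq_of_le ?_ (hxadm K)
      rw [List.length_map, List.length_range]
      refine Finset.sum_congr rfl fun k hk => ?_
      rw [List.getElem?_map, List.getElem?_range (Finset.mem_range.1 hk)]
      rfl
    refine ⟨w i, by positivity, fun K s => ?_⟩
    choose n hn using hi
    -- a time at which process `i` has delivered its first `K` items
    let N := (∑ k ∈ Finset.range K, n k) + K + i + 1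
    refine le_trans ?_ (hfM N s)
    have h1 : ∑ k ∈ Finset.range K, opOf e (itemAt (some (x k)) s) ≤ G i N s := by
      simp only [G]
      refine le_trans (le_of_eq ?_) (Finset.sum_le_sum_of_subset_of_nonneg
        (Finset.range_mono (show K ≤ N by omega)) fun k _ _ => opOf_nonneg e _)
      refine Finset.sum_congr rfl fun k hk => ?_
      simp only [ℓ]
      rw [hBmono i k (n k) N (x k) (hn k) ?_]
      have := Finset.single_le_sum (f := n) (fun _ _ => Nat.zero_le _) hk
      omega
    refine (op_smul_le_smul h1 (hw i)).trans ?_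
    exact Finset.single_le_sum (f := fun i => (w i : ℂ) • G i N s)
      (fun j _ => op_nonneg_smul (hG0 j N s) (hw j)) (Finset.mem_range.2 (by omega))

end Universal

/-! ### Computability in Hilbert space -/

section ComputableVectors

set_option linter.unusedSectionVars false

variable {X : Type*} [NormedAddCommGroup X] [InnerProductSpace ℂ X]
  {φ : ComputabilityStructure X} {α : Type*} [Primcodable α]

theorem IsComputableComplex.comp {β : Type*} [Primcodable β] {z : β → ℂ}
    (hz : IsComputableComplex z) {f : α → β} (hf : Computable f) :
    IsComputableComplex fun x => z (f x) :=
  ⟨hz.1.comp hf, hz.2.comp hf⟩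

theorem computable_norm_linearCombination [Inhabited α] {x y : ℕ → X} (hx : x ∈ φ.seqs)
    (hy : y ∈ φ.seqs) {a b : α × ℕ → ℂ} (ha : IsComputableComplex a) (hb : IsComputableComplex b)
    {d : α → ℕ} (hd : Computable d) :
    IsComputableReal fun p : α =>
      ‖∑ k ∈ Finset.range (d p + 1), (a (p, k) • x k + b (p, k) • y k)‖ := by
  let δ : ℕ → α := fun n => (Encodable.decode n).getD default
  have hδ : Computable δ := Computable.option_getD Computable.decode (Computable.const _)
  have hδ' : Computable fun q : ℕ × ℕ => (δ q.1, q.2) :=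
    (hδ.comp Computable.fst).pair Computable.snd
  have h := φ.norms _ (φ.linear_forms x hx y hy _ _ (ha.comp hδ') (hb.comp hδ') _ (hd.comp hδ))
  refine (h.comp (Computable.encode (α := α))).of_eq fun p => ?_
  simp [δ]

theorem computable_norm_vec_add_smul {x y : ℕ → X} (hx : x ∈ φ.seqs) (hy : y ∈ φ.seqs) {θ : ℂ}
    (hθ : IsComplexRational θ) :
    IsComputableReal fun p : VecCode × VecCode => ‖vec x p.1 + θ • vec y p.2‖ := by
  have hθ' : IsRecursiveComplexRational fun _ : (VecCode × VecCode) × ℕ => θ := by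
    obtain ⟨p, q, h⟩ := hθ
    exact ⟨_, _, .const p, .const q, fun _ => h⟩
  have h1 : IsRecursiveComplexRational fun p : (VecCode × VecCode) × ℕ => coef p.1.1 p.2 :=
    isRecursiveComplexRational_coef.comp (f := fun p : (VecCode × VecCode) × ℕ => (p.1.1, p.2))
      ((Computable.fst.comp Computable.fst).pair Computable.snd)
  have h2 : IsRecursiveComplexRational fun p : (VecCode × VecCode) × ℕ => coef p.1.2 p.2 :=
    isRecursiveComplexRational_coef.comp (f := fun p : (VecCode × VecCode) × ℕ => (p.1.2, p.2))
      ((Computable.snd.comp Computable.fst).pair Computable.snd)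
  refine (computable_norm_linearCombination hx hy h1.isComputableComplex
    (hθ'.mul h2).isComputableComplex (d := fun p : VecCode × VecCode => p.1.length + p.2.length)
    ((Computable.list_length.comp Computable.fst).nat_add
      (Computable.list_length.comp Computable.snd))).of_eq fun p => ?_
  rw [Finset.sum_add_distrib,
    vec_eq_sum_range x (show p.1.length ≤ p.1.length + p.2.length + 1 by omega),
    vec_eq_sum_range y (show p.2.length ≤ p.1.length + p.2.length + 1 by omega), Finset.smul_sum]
  simp only [mul_smul]

theorem computable_norm_vec_sub {x y : ℕ → X} (hx : x ∈ φ.seqs) (hy : y ∈ φ.seqs) :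
    IsComputableReal fun p : VecCode × VecCode => ‖vec x p.1 - vec y p.2‖ :=
  (computable_norm_vec_add_smul hx hy (θ := -1) ⟨-1, 0, by simp⟩).of_eq fun p => by
    rw [neg_one_smul, sub_eq_add_neg]

theorem exists_vec_eq (e : ℕ → X) {z : ℕ → ℂ} (hz : ∀ i, IsComplexRational (z i)) (m : ℕ) :
    ∃ v, vec e v = ∑ i ∈ Finset.range m, z i • e i := by
  obtain ⟨v, hv, hc⟩ := exists_coef_eq hz m
  refine ⟨v, ?_⟩
  rw [vec, hv]
  exact Finset.sum_congr rfl fun i hi => by rw [hc, if_pos (Finset.mem_range.1 hi)]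

theorem isComplexRational_gaussVal (c : GaussCode) : IsComplexRational (gaussVal c) := by
  simpa [coef] using isComplexRational_coef [c] 0

theorem denseRange_gaussVal : DenseRange gaussVal := by
  have h1 : DenseRange fun p : ℚ × ℚ => ((p.1 : ℝ), (p.2 : ℝ)) :=
    Rat.denseRange_cast.prodMap Rat.denseRange_cast
  have h2 : DenseRange fun p : ℚ × ℚ => Complex.equivRealProdCLM.symm ((p.1 : ℝ), (p.2 : ℝ)) :=
    Complex.equivRealProdCLM.symm.surjective.denseRange.comp h1
      Complex.equivRealProdCLM.symm.continuous
  refine h2.mono ?_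
  rintro _ ⟨p, rfl⟩
  obtain ⟨c, hc⟩ := exists_gaussVal_eq (z := (p.1 : ℂ) + p.2 * Complex.I) ⟨p.1, p.2, rfl⟩
  exact ⟨c, by rw [hc]; simp [Complex.equivRealProdCLM_symm_apply]⟩

/-- The Gaussian rational combinations of a generating sequence are dense. -/
theorem denseRange_vec {e : ℕ → X} (he : IsGeneratingSet e) : DenseRange (vec e) := by
  refine dense_closure.1 (he.mono fun y hy => ?_)
  obtain ⟨c, rfl⟩ := (Finsupp.mem_span_range_iff_exists_finsupp).1 hy
  obtain ⟨m, hm⟩ : ∃ m, c.support ⊆ Finset.range m :=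
    ⟨c.support.sup id + 1, fun i hi => Finset.mem_range.2
      (Nat.lt_succ_of_le (Finset.le_sup (f := id) hi))⟩
  have h1 : c.sum (fun i a => a • e i) = ∑ i ∈ Finset.range m, c i • e i :=
    Finset.sum_subset hm fun i _ hi => by simp [Finsupp.notMem_support_iff.1 hi]
  have hc : Continuous fun z : ℕ → ℂ => ∑ i ∈ Finset.range m, z i • e i := by fun_prop
  have hd : DenseRange fun (q : ℕ → GaussCode) i => gaussVal (q i) :=
    DenseRange.piMap fun _ => denseRange_gaussVal
  rw [h1]
  refine closure_mono ?_ (image_closure_subset_closure_image hc ⟨_, hd c, rfl⟩)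
  rintro _ ⟨_, ⟨q, rfl⟩, rfl⟩
  exact exists_vec_eq e (fun i => isComplexRational_gaussVal (q i)) m

theorem exists_norm_sub_vec_lt {e : ℕ → X} (he : IsGeneratingSet e) (y : X) {ε : ℝ} (hε : 0 < ε) :
    ∃ v, ‖y - vec e v‖ < ε := by
  obtain ⟨v, hv⟩ := (denseRange_vec he).exists_dist_lt y hε
  exact ⟨v, by rwa [← dist_eq_norm]⟩

/-- Gaussian rational combinations of one computable sequence can be approximated effectively by
those of any computable generating sequence. -/
theorem exists_computable_approx {e e' : ℕ → X} (he : e ∈ φ.seqs) (he' : e' ∈ φ.seqs)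
    (hg : IsGeneratingSet e) :
    ∃ u : VecCode × ℕ → VecCode, Computable u ∧
      ∀ v k, ‖vec e' v - vec e (u (v, k))‖ ≤ (2⁻¹ : ℝ) ^ k := by
  have h1 : IsComputableReal fun p : (VecCode × ℕ) × VecCode =>
      (((2 : ℚ) ^ p.1.2 : ℚ) : ℝ) * ‖vec e' p.1.1 - vec e p.2‖ :=
    (IsComputableReal.ratCast (.two_pow (Computable.snd.comp Computable.fst))).mul
      ((computable_norm_vec_sub he' he).comp
        (f := fun p : (VecCode × ℕ) × VecCode => (p.1.1, p.2))
        ((Computable.fst.comp Computable.fst).pair Computable.snd))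
  obtain ⟨u, hu, h⟩ := exists_computable_choice_lt_one h1 fun a => by
    obtain ⟨v, hv⟩ := exists_norm_sub_vec_lt hg (vec e' a.1)
      (show (0 : ℝ) < (2 ^ a.2)⁻¹ by positivity)
    refine ⟨v, ?_⟩
    push_cast
    rwa [← lt_inv_mul_iff₀ (by positivity), mul_one]
  refine ⟨u, hu, fun v k => ?_⟩
  have := h (v, k)
  push_cast at this
  rw [← lt_inv_mul_iff₀ (by positivity), mul_one] at this
  rw [inv_pow]
  exact this.le

end ComputableVectors

/-! ### Change of basis -/

section ChangeOfBasis

set_option linter.unusedSectionVars false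

open InnerProductSpace ContinuousLinearMap Filter Topology

variable {X : Type*} [NormedAddCommGroup X] [InnerProductSpace ℂ X] [CompleteSpace X]
  {φ : ComputabilityStructure X} {e e' : ℕ → X}

theorem norm_rankOne_sub_le (x y : X) :
    ‖rankOne ℂ x x - rankOne ℂ y y‖ ≤ ‖x - y‖ * (2 * ‖x‖ + ‖x - y‖) := by
  have h : rankOne ℂ x x - rankOne ℂ y y = rankOne ℂ (x - y) x + rankOne ℂ y (x - y) := by
    simp only [map_sub, _root_.sub_apply]
    abel
  have hy : ‖y‖ ≤ ‖x‖ + ‖x - y‖ := by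
    have := norm_sub_le x (x - y)
    rwa [sub_sub_cancel] at this
  calc _ ≤ ‖x - y‖ * ‖x‖ + ‖y‖ * ‖x - y‖ := by
        rw [h, ← norm_rankOne (𝕜 := ℂ) (x - y) x, ← norm_rankOne (𝕜 := ℂ) y (x - y)]
        exact norm_add_le _ _
    _ ≤ ‖x - y‖ * ‖x‖ + (‖x‖ + ‖x - y‖) * ‖x - y‖ := by gcongr
    _ = _ := by ring

theorem rankOne_le_opOf (e : ℕ → X) {l : List VecCode} {v : VecCode} (h : v ∈ l) :
    rankOne ℂ (vec e v) (vec e v) ≤ opOf e l := by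
  induction l with
  | nil => simp at h
  | cons a l ih =>
    rw [opOf_cons]
    rcases List.mem_cons.1 h with rfl | h
    · exact le_add_of_nonneg_right (opOf_nonneg e l)
    · exact (ih h).trans (le_add_of_nonneg_left
        ((nonneg_iff_isPositive _).2 (isPositive_rankOne_self _)))

theorem norm_le_of_rankOne_le {x : X} {c : ℝ} (hc : 0 ≤ c) (h : rankOne ℂ x x ≤ (c : ℂ) • 1) :
    ‖x‖ ^ 2 ≤ c := by
  rcases eq_or_ne x 0 with rfl | hx
  · simpa using hc
  have h1 := re_inner_le_of_le h x
  have hpos : 0 < ‖x‖ ^ 2 := by positivity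
  have e1 : inner ℂ x x = ((‖x‖ ^ 2 : ℝ) : ℂ) := by
    rw [inner_self_eq_norm_sq_to_K]; norm_cast
  simp only [rankOne_apply, inner_smul_right, _root_.smul_apply, one_apply_eq_self, e1,
    ← Complex.ofReal_mul, Complex.ofReal_re] at h1
  exact le_of_mul_le_mul_right h1 hpos

/-- Approximating each vector of a decomposition approximates the operator. -/
theorem norm_opOf_sub_le {l : List VecCode} {u : VecCode → VecCode} {δ : ℝ} (hδ : δ ≤ 1)
    (hu : ∀ v ∈ l, ‖vec e' v - vec e (u v)‖ ≤ δ) (hl : ∀ v ∈ l, ‖vec e' v‖ ≤ 2) :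
    ‖opOf e' l - opOf e (l.map u)‖ ≤ l.length * (δ * 5) := by
  induction l with
  | nil => simp
  | cons v l ih =>
    rw [List.map_cons, opOf_cons, opOf_cons, add_sub_add_comm]
    have h1 := ih (fun v hv => hu v (List.mem_cons_of_mem _ hv))
      fun v hv => hl v (List.mem_cons_of_mem _ hv)
    have h2 := hu v List.mem_cons_self
    have h3 := hl v List.mem_cons_self
    have h4 := norm_rankOne_sub_le (vec e' v) (vec e (u v))
    have h5 : ‖vec e' v - vec e (u v)‖ * (2 * ‖vec e' v‖ + ‖vec e' v - vec e (u v)‖) ≤ δ * 5 := by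
      have := norm_nonneg (vec e' v - vec e (u v))
      gcongr
      · linarith
      · linarith
    rw [List.length_cons]
    push_cast
    linarith [norm_add_le (rankOne ℂ (vec e' v) (vec e' v) -
      rankOne ℂ (vec e (u v)) (vec e (u v))) (opOf e' l - opOf e (l.map u))]

theorem IsSemiPOVM.sum_le_one {R : List Bool → X →L[ℂ] X} (hR : IsSemiPOVM R)
    (A : Finset (List Bool)) : ∑ s ∈ A, R s ≤ 1 := by
  obtain ⟨hR0, S, hS, hS1⟩ := hR
  have h0 : ∀ s, 0 ≤ R s := fun s => (nonneg_iff_isPositive _).2 (hR0 s)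
  have hsa : ∀ A : Finset (List Bool), IsSelfAdjoint (∑ s ∈ A, R s) := fun A =>
    isSelfAdjoint_of_op_nonneg (Finset.sum_nonneg fun s _ => h0 s)
  refine le_trans ?_ hS1
  refine op_ge_of_tendsto_const (l := atTop) (T := fun A : Finset (List Bool) => ∑ s ∈ A, R s)
    (fun x => ?_) hsa (hsa A) (eventually_atTop.2 ⟨A, fun A' h =>
      Finset.sum_le_sum_of_subset_of_nonneg h fun s _ _ => h0 s⟩)
  have := hS x
  simp only [_root_.sum_apply]
  exact this

/-- A lower-computable semi-POVM with respect to `e'` is approximated by Gaussian rational operators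
with respect to any other computable orthonormal basis `e`, increasing up to an error `4 / 2ᵗ`. -/
theorem exists_approx_change_basis (he : IsComputableOrthonormalBasis φ e)
    (he' : IsComputableOrthonormalBasis φ e') {R : List Bool → X →L[ℂ] X} (hR : IsSemiPOVM R)
    (hR' : IsLowerComputableWrt e' R) :
    ∃ l : ℕ × List Bool → List VecCode, Computable l ∧
      (∀ s x, Tendsto (fun t => opOf e (l (t, s)) x) atTop (𝓝 (R s x))) ∧
      (∀ s t, opOf e (l (t, s)) ≤ opOf e (l (t + 1, s)) + ((4 * 2⁻¹ ^ (t + 1) : ℝ) : ℂ) • 1) ∧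
      ∀ s t, opOf e (l (t, s)) ≤ R s + ((4 * 2⁻¹ ^ t : ℝ) : ℂ) • 1 := by
  obtain ⟨f, g, hf0, hg, hlim, hmono, hsq, hrec⟩ := hR'
  have hf0' : ∀ n s, 0 ≤ f n s := fun n s => (nonneg_iff_isPositive _).2 (hf0 n s)
  have hfs : ∀ n s, IsSelfAdjoint (f n s) := fun n s => isSelfAdjoint_of_op_nonneg (hf0' n s)
  have hR1 : ∀ s, R s ≤ 1 := fun s => by simpa using hR.sum_le_one {s}
  have hcast : ∀ n : ℕ, ((2⁻¹ : ℂ) ^ n) = (((2⁻¹ : ℝ) ^ n : ℝ) : ℂ) := fun n => by push_cast; rfl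
  have hone : ∀ c : ℝ, IsSelfAdjoint ((c : ℂ) • (1 : X →L[ℂ] X)) := fun c =>
    isSelfAdjoint_ofReal_smul (.one _) c
  have hmono' : ∀ s, Monotone fun n => f n s - (((2⁻¹ : ℝ) ^ n : ℝ) : ℂ) • (1 : X →L[ℂ] X) :=
    fun s => monotone_nat_of_le_succ fun n => by simpa only [hcast] using hmono n s
  have hfR : ∀ n s, f n s ≤ R s + (((2⁻¹ : ℝ) ^ n : ℝ) : ℂ) • 1 := by
    intro n s
    rw [← sub_le_iff_le_add]
    refine op_ge_of_tendsto_const (l := atTop)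
      (T := fun m => f m s - (((2⁻¹ : ℝ) ^ m : ℝ) : ℂ) • (1 : X →L[ℂ] X)) (fun x => ?_)
      (fun m => (hfs m s).sub (hone _)) ((hfs n s).sub (hone _))
      (eventually_atTop.2 ⟨n, fun m hm => hmono' s hm⟩)
    have h1 : Tendsto (fun m : ℕ => (((2⁻¹ : ℝ) ^ m : ℝ) : ℂ)) atTop (𝓝 0) := by
      have := (Complex.continuous_ofReal.tendsto 0).comp
        (tendsto_pow_atTop_nhds_zero_of_lt_one (r := (2⁻¹ : ℝ)) (by norm_num) (by norm_num))
      simpa [Function.comp_def] using this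
    have h2 := (hlim s x).sub (h1.smul_const x)
    simpa using h2
  obtain ⟨l', hl', hl'eq⟩ := exists_computable_opOf_eq (α := ℕ × List Bool) he'.2.1 he'.2.2
    (T := fun p => f p.1 p.2) (fun p => hf0' _ _) hg (fun p => hsq _ _)
    (hrec.comp (f := fun p : (ℕ × List Bool) × ℕ × ℕ => (p.1.1, p.1.2, p.2.1, p.2.2))
      ((Computable.fst.comp Computable.fst).pair ((Computable.snd.comp Computable.fst).pair
        Computable.snd)))
  obtain ⟨u, hu, huv⟩ := exists_computable_approx he.1 he'.1 he.2.2
  -- the accuracy grows with the number of vectors, whose errors add up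
  let l : ℕ × List Bool → List VecCode := fun p =>
    (l' p).map fun v => u (v, p.1 + 3 + (l' p).length)
  have hl : Computable l := Computable.list_map
    (g := fun y : (ℕ × List Bool) × VecCode => u (y.2, y.1.1 + 3 + (l' y.1).length)) hl'
    (hu.comp (Computable.snd.pair (((Computable.fst.comp Computable.fst).nat_add
      (Computable.const 3)).nat_add (Computable.list_length.comp (hl'.comp Computable.fst)))))
  have hnorm : ∀ t s, ‖f t s - opOf e (l (t, s))‖ ≤ (2⁻¹ : ℝ) ^ t := by
    intro t s
    -- `|v⟩⟨v| ≤ f t s ≤ R s + I ≤ 2 I` bounds the vectors independently of the stage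
    have h1 : ∀ v ∈ l' (t, s), ‖vec e' v‖ ≤ 2 := by
      intro v hv
      have h2 : rankOne ℂ (vec e' v) (vec e' v) ≤ ((2 : ℝ) : ℂ) • 1 := by
        refine (rankOne_le_opOf e' hv).trans ?_
        rw [hl'eq]
        refine (hfR t s).trans ?_
        have h3 := op_smul_le_smul_of_le (X := X) op_one_nonneg
          (show (2⁻¹ : ℝ) ^ t ≤ 1 from pow_le_one₀ (by norm_num) (by norm_num))
        refine (add_le_add (hR1 s) h3).trans (le_of_eq ?_)
        rw [Complex.ofReal_one, one_smul, Complex.ofReal_ofNat, two_smul]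
      have h3 := norm_le_of_rankOne_le (by norm_num) h2
      nlinarith [norm_nonneg (vec e' v)]
    have h2 := norm_opOf_sub_le (e := e) (l := l' (t, s))
      (u := fun v => u (v, t + 3 + (l' (t, s)).length))
      (δ := (2⁻¹ : ℝ) ^ (t + 3 + (l' (t, s)).length))
      (pow_le_one₀ (by norm_num) (by norm_num)) (fun v _ => huv v _) h1
    rw [hl'eq] at h2
    refine h2.trans ?_
    have h3 : ((l' (t, s)).length : ℝ) ≤ 2 ^ (l' (t, s)).length := by
      exact_mod_cast Nat.lt_two_pow_self.le
    have h4 : ((l' (t, s)).length : ℝ) * (2⁻¹ : ℝ) ^ (l' (t, s)).length ≤ 1 := by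
      rw [inv_pow, ← div_eq_mul_inv]
      exact div_le_one_of_le₀ h3 (by positivity)
    have h5 : (0 : ℝ) < (2⁻¹ : ℝ) ^ t := by positivity
    calc ((l' (t, s)).length : ℝ) * ((2⁻¹ : ℝ) ^ (t + 3 + (l' (t, s)).length) * 5)
        = ((l' (t, s)).length * (2⁻¹ : ℝ) ^ (l' (t, s)).length) * ((2⁻¹ : ℝ) ^ t * (5 / 8)) := by
          rw [pow_add, pow_add]; ring
      _ ≤ 1 * ((2⁻¹ : ℝ) ^ t * (5 / 8)) := by gcongr
      _ ≤ _ := by linarith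
  have hls : ∀ p, IsSelfAdjoint (opOf e (l p)) := fun p =>
    isSelfAdjoint_of_op_nonneg (opOf_nonneg e _)
  have hle1 : ∀ t s, f t s ≤ opOf e (l (t, s)) + (((2⁻¹ : ℝ) ^ t : ℝ) : ℂ) • 1 := fun t s =>
    sub_le_iff_le_add'.1 (le_norm_smul_one ((hfs t s).sub (hls _)) (hnorm t s))
  have hle2 : ∀ t s, opOf e (l (t, s)) ≤ f t s + (((2⁻¹ : ℝ) ^ t : ℝ) : ℂ) • 1 := fun t s =>
    sub_le_iff_le_add'.1 (le_norm_smul_one ((hls _).sub (hfs t s))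
      (by rw [norm_sub_rev]; exact hnorm t s))
  refine ⟨l, hl, fun s x => ?_, fun s t => ?_, fun s t => ?_⟩
  · have h1 : Tendsto (fun t => f t s x - opOf e (l (t, s)) x) atTop (𝓝 0) := by
      refine squeeze_zero_norm (a := fun t => (2⁻¹ : ℝ) ^ t * ‖x‖)
        (fun t => (f t s - opOf e (l (t, s))).le_of_opNorm_le (hnorm t s) x) ?_
      simpa using (tendsto_pow_atTop_nhds_zero_of_lt_one (r := (2⁻¹ : ℝ)) (by norm_num)
        (by norm_num)).mul_const ‖x‖
    simpa using (hlim s x).sub h1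
  · have h1 : f t s - (((2⁻¹ : ℝ) ^ t : ℝ) : ℂ) • (1 : X →L[ℂ] X) ≤
        f (t + 1) s - (((2⁻¹ : ℝ) ^ (t + 1) : ℝ) : ℂ) • 1 := hmono' s t.le_succ
    have h2 : f t s ≤ f (t + 1) s + (((2⁻¹ : ℝ) ^ (t + 1) : ℝ) : ℂ) • 1 := by
      rw [sub_le_iff_le_add] at h1
      refine h1.trans (le_of_eq ?_)
      rw [pow_succ]
      push_cast
      module
    refine (hle2 t s).trans ((add_le_add (h2.trans (add_le_add (hle1 (t + 1) s) le_rfl))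
      le_rfl).trans (le_of_eq ?_))
    rw [pow_succ]
    push_cast
    module
  · refine (hle2 t s).trans ((add_le_add (hfR t s) le_rfl).trans ?_)
    rw [add_assoc, ← add_smul, ← Complex.ofReal_add]
    refine add_le_add le_rfl (op_smul_le_smul_of_le op_one_nonneg ?_)
    have h5 : (0 : ℝ) < (2⁻¹ : ℝ) ^ t := by positivity
    linarith

end ChangeOfBasis

/-! ### Exactly increasing approximations -/

section Increments

open InnerProductSpace ContinuousLinearMap Filter Topology

variable {X : Type*} [NormedAddCommGroup X] [InnerProductSpace ℂ X] [CompleteSpace X]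
  {φ : ComputabilityStructure X} {e e' : ℕ → X}

theorem sum_half_pow_encode_le_one (S : Finset (List Bool)) :
    ∑ s ∈ S, (2⁻¹ : ℝ) ^ (Encodable.encode s + 1) ≤ 1 := by
  have h1 : ∀ n, ∑ i ∈ Finset.range n, (2⁻¹ : ℝ) ^ (i + 1) = 1 - (2⁻¹ : ℝ) ^ n := by
    intro n
    induction n with
    | zero => simp
    | succ n ih => rw [Finset.sum_range_succ, ih]; ring
  let N := S.sup Encodable.encode + 1
  have h2 : S.image Encodable.encode ⊆ Finset.range N := by
    intro i hi
    obtain ⟨s, hs, rfl⟩ := Finset.mem_image.1 hi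
    exact Finset.mem_range.2 (Nat.lt_succ_of_le (Finset.le_sup (f := Encodable.encode) hs))
  calc ∑ s ∈ S, (2⁻¹ : ℝ) ^ (Encodable.encode s + 1)
      = ∑ i ∈ S.image Encodable.encode, (2⁻¹ : ℝ) ^ (i + 1) :=
        (Finset.sum_image (g := Encodable.encode) (f := fun i => (2⁻¹ : ℝ) ^ (i + 1))
          fun _ _ _ _ h => Encodable.encode_injective h).symm
    _ ≤ ∑ i ∈ Finset.range N, (2⁻¹ : ℝ) ^ (i + 1) :=
        Finset.sum_le_sum_of_subset_of_nonneg h2 fun _ _ _ => by positivity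
    _ ≤ 1 := by rw [h1]; linarith [show (0 : ℝ) ≤ (2⁻¹ : ℝ) ^ N by positivity]

/-- Adding the summable family `ε s • I`, cut off to growing finite-dimensional subspaces, to
approximations which increase up to an error makes them increase exactly. After halving, this gives
a computable family of increments whose sum dominates `R / 2` and is at most `I` in total. -/
theorem exists_increments (he : IsComputableOrthonormalBasis φ e)
    (he' : IsComputableOrthonormalBasis φ e') {R : List Bool → X →L[ℂ] X} (hR : IsSemiPOVM R)
    (hR' : IsLowerComputableWrt e' R) :
    ∃ d : ℕ × List Bool → List VecCode, Computable d ∧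
      (∀ T (S : Finset (List Bool)), ∑ s ∈ S, ∑ t ∈ Finset.range T, opOf e (d (t, s)) ≤ 1) ∧
      ∀ s, ∃ F : ℕ → X →L[ℂ] X, (∀ t, 0 ≤ F t) ∧ (∀ x, Tendsto (fun t => F t x) atTop (𝓝 (R s x))) ∧
        ∀ T, ((2⁻¹ : ℝ) : ℂ) • F T ≤ ∑ t ∈ Finset.range (T + 1), opOf e (d (t, s)) := by
  obtain ⟨l, hl, hlim, hmono, hle⟩ := exists_approx_change_basis he he' hR hR'
  have hon := he.2.1
  have hgen := he.2.2
  let ε : List Bool → ℝ := fun s => (2⁻¹ : ℝ) ^ (Encodable.encode s + 1)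
  have hε : ∀ s, 0 < ε s := fun s => by positivity
  -- the shift is chosen so that the error at time `t` is `ε s / 2ᵗ`
  let F : ℕ → List Bool → List VecCode := fun t s => l (Encodable.encode s + 3 + t, s)
  have herr : ∀ s t, (4 * (2⁻¹ : ℝ) ^ (Encodable.encode s + 3 + t)) = ε s * (2⁻¹ : ℝ) ^ t := by
    intro s t
    simp only [ε]
    rw [pow_add, pow_add, pow_add]
    ring
  -- `q (t + 1) s - q t s` is the error at time `t + 1`, and `q t s ≤ ε s`
  let q : ℕ → List Bool → ℝ := fun t s => ε s * (1 - (2⁻¹ : ℝ) ^ t)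
  have hpow : ∀ t : ℕ, (2⁻¹ : ℝ) ^ t ≤ 1 := fun t => pow_le_one₀ (by norm_num) (by norm_num)
  have hpow0 : ∀ t : ℕ, 0 < (2⁻¹ : ℝ) ^ t := fun t => by positivity
  have hq : ∀ t s, 0 ≤ q t s := fun t s => mul_nonneg (hε s).le (by linarith [hpow t])
  -- the approximations up to time `t` live on the first `N t s` basis vectors, so that the cut-off
  -- multiples of the identity suffice to compensate the errors
  let N : ℕ → List Bool → ℕ := fun t s => ∑ i ∈ Finset.range (t + 1), width (F i s)
  have hNmono : ∀ t s, N t s ≤ N (t + 1) s := fun t s =>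
    Finset.sum_le_sum_of_subset (Finset.range_mono (by omega))
  have hFN : ∀ t s, width (F t s) ≤ N t s := fun t s =>
    Finset.single_le_sum (f := fun i => width (F i s)) (fun _ _ => Nat.zero_le _)
      (Finset.self_mem_range_succ t)
  let A : ℕ → List Bool → X →L[ℂ] X := fun t s =>
    opOf e (F t s) + (q t s : ℂ) • initialProj e (N t s)
  have hA0 : ∀ t s, 0 ≤ A t s := fun t s =>
    add_nonneg (opOf_nonneg e _) (op_nonneg_smul (initialProj_nonneg e _) (hq t s))
  have hAF : ∀ t s, opOf e (F t s) ≤ A t s := fun t s =>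
    le_add_of_nonneg_right (op_nonneg_smul (initialProj_nonneg e _) (hq t s))
  have hAmono : ∀ t s, A t s ≤ A (t + 1) s := by
    intro t s
    have hsa : ∀ p, IsSelfAdjoint (opOf e (l p)) := fun p =>
      isSelfAdjoint_of_op_nonneg (opOf_nonneg e _)
    have h1 : opOf e (F t s) - opOf e (F (t + 1) s) ≤ ((ε s * 2⁻¹ ^ (t + 1) : ℝ) : ℂ) • 1 := by
      rw [sub_le_iff_le_add', ← herr]
      exact hmono s (Encodable.encode s + 3 + t)
    have h2 : opOf e (F t s) - opOf e (F (t + 1) s) ≤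
        ((ε s * 2⁻¹ ^ (t + 1) : ℝ) : ℂ) • initialProj e (N (t + 1) s) := by
      refine le_smul_initialProj hon hgen ((hsa _).sub (hsa _)) (fun k j hkj => ?_) h1
      have h3 := (hFN t s).trans (hNmono t s)
      have h4 := hFN (t + 1) s
      rw [_root_.sub_apply, inner_sub_right, inner_opOf hon, inner_opOf hon,
        entry_eq_zero (hkj.imp h3.trans h3.trans), entry_eq_zero (hkj.imp h4.trans h4.trans),
        sub_zero]
    have h3 : (q t s : ℂ) • initialProj e (N t s) ≤ (q t s : ℂ) • initialProj e (N (t + 1) s) :=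
      op_smul_le_smul (initialProj_mono e (hNmono t s)) (hq t s)
    rw [sub_le_iff_le_add'] at h2
    refine (add_le_add h2 h3).trans (le_of_eq ?_)
    rw [add_assoc, ← add_smul, ← Complex.ofReal_add]
    congr 3
    simp only [q]
    rw [pow_succ]
    ring
  have hAR : ∀ t s, A t s ≤ R s + (ε s : ℂ) • 1 := by
    intro t s
    have h1 := hle s (Encodable.encode s + 3 + t)
    rw [herr] at h1
    refine (add_le_add h1 (op_smul_le_smul (initialProj_le_one hon _) (hq t s))).trans
      (le_of_eq ?_)
    rw [add_assoc, ← add_smul, ← Complex.ofReal_add]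
    congr 3
    simp only [q]
    ring
  let D : ℕ × List Bool → X →L[ℂ] X := fun p =>
    ((2⁻¹ : ℝ) : ℂ) • (A p.1 p.2 - bif decide (p.1 = 0) then 0 else A (p.1 - 1) p.2)
  have hD0 : ∀ p, 0 ≤ D p := by
    rintro ⟨t, s⟩
    refine op_nonneg_smul ?_ (by norm_num)
    rcases t with _ | t
    · simpa using hA0 0 s
    · simpa using hAmono t s
  have hDsum : ∀ T s, ∑ t ∈ Finset.range (T + 1), D (t, s) = ((2⁻¹ : ℝ) : ℂ) • A T s := by
    intro T s
    induction T with
    | zero => simp [D]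
    | succ T ih =>
      rw [Finset.sum_range_succ, ih]
      simp [D, ← smul_add]
  -- the matrix of the increments is recursive
  have hFc : Computable fun p : ℕ × List Bool => F p.1 p.2 :=
    hl.comp (((Computable.encode.comp Computable.snd).nat_add (Computable.const 3)).nat_add
      Computable.fst |>.pair Computable.snd)
  have hNc : Computable fun p : ℕ × List Bool => N p.1 p.2 :=
    Computable.nat_sum_range (f := fun y : (ℕ × List Bool) × ℕ => width (F y.2 y.1.2))
      (N := fun p => p.1 + 1) (computable_width.comp (hFc.comp
        (g := fun y : (ℕ × List Bool) × ℕ => (y.2, y.1.2))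
        (Computable.snd.pair (Computable.snd.comp Computable.fst))))
      (Computable.succ.comp Computable.fst)
  have hAe : ∀ t s k j, inner ℂ (e j) (A t s (e k)) = entry (F t s) k j +
      (((2⁻¹ : ℚ) ^ (Encodable.encode s + 1) * (1 - (2⁻¹ : ℚ) ^ t) : ℚ) : ℂ) *
        bif decide (k = j) && decide (k < N t s) then ((1 : ℚ) : ℂ) else ((0 : ℚ) : ℂ) := by
    intro t s k j
    simp only [A, _root_.add_apply, _root_.smul_apply, inner_add_right, inner_smul_right,
      inner_opOf hon, inner_initialProj hon]
    congr 1
    congr 1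
    · simp [q, ε]
    · by_cases h1 : k = j <;> by_cases h2 : k < N t s <;> simp [h1, h2]
  have hArec : IsRecursiveComplexRational fun p : (ℕ × List Bool) × ℕ × ℕ =>
      inner ℂ (e p.2.2) (A p.1.1 p.1.2 (e p.2.1)) := by
    have h1 : IsRecursiveComplexRational fun p : (ℕ × List Bool) × ℕ × ℕ =>
        entry (F p.1.1 p.1.2) p.2.1 p.2.2 :=
      isRecursiveComplexRational_entry.comp
        (f := fun p : (ℕ × List Bool) × ℕ × ℕ => (F p.1.1 p.1.2, p.2))
        ((hFc.comp Computable.fst).pair Computable.snd)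
    have h2 : IsComputableRat fun p : (ℕ × List Bool) × ℕ × ℕ =>
        (2⁻¹ : ℚ) ^ (Encodable.encode p.1.2 + 1) * (1 - (2⁻¹ : ℚ) ^ p.1.1) :=
      (IsComputableRat.half_pow (Computable.succ.comp (Computable.encode.comp
        (Computable.snd.comp Computable.fst)))).mul
        ((IsComputableRat.const 1).sub (.half_pow (Computable.fst.comp Computable.fst)))
    have h3 : IsRecursiveComplexRational fun p : (ℕ × List Bool) × ℕ × ℕ =>
        bif decide (p.2.1 = p.2.2) && decide (p.2.1 < N p.1.1 p.1.2)
          then ((1 : ℚ) : ℂ) else ((0 : ℚ) : ℂ) :=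
      .cond (Primrec.and.to_comp.comp
        (Computable.decide_eq (Computable.fst.comp Computable.snd)
          (Computable.snd.comp Computable.snd))
        (Computable.decide_nat_lt (Computable.fst.comp Computable.snd) (hNc.comp Computable.fst)))
        (.ratCast (.const 1)) (.ratCast (.const 0))
    exact (h1.add ((IsRecursiveComplexRational.ratCast h2).mul h3)).of_eq fun p =>
      (hAe p.1.1 p.1.2 p.2.1 p.2.2).symm
  have hDrec : IsRecursiveComplexRational fun p : (ℕ × List Bool) × ℕ × ℕ =>
      inner ℂ (e p.2.2) (D p.1 (e p.2.1)) := by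
    have h1 := hArec.comp
      (f := fun p : (ℕ × List Bool) × ℕ × ℕ => ((p.1.1 - 1, p.1.2), p.2))
      ((((Computable.fst.comp Computable.fst).nat_sub (Computable.const 1)).pair
        (Computable.snd.comp Computable.fst)).pair Computable.snd)
    have h2 : IsRecursiveComplexRational fun _ : (ℕ × List Bool) × ℕ × ℕ => ((2⁻¹ : ℚ) : ℂ) :=
      .ratCast (.const _)
    have h3 : IsRecursiveComplexRational fun _ : (ℕ × List Bool) × ℕ × ℕ => ((0 : ℚ) : ℂ) :=
      .ratCast (.const _)
    have h4 : Computable fun p : (ℕ × List Bool) × ℕ × ℕ => decide (p.1.1 = 0) :=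
      Computable.decide_eq (f := fun p : (ℕ × List Bool) × ℕ × ℕ => p.1.1) (g := fun _ => 0)
        (Computable.fst.comp Computable.fst) (Computable.const 0)
    refine (h2.mul (hArec.sub (IsRecursiveComplexRational.cond h4 h3 h1))).of_eq fun p => ?_
    rcases p with ⟨⟨_ | t, s⟩, k, j⟩ <;> simp [D]
  have hDrange : ∀ p, IsSquareRationalOperator e (N p.1 p.2) (D p) := by
    intro p
    refine ⟨fun k j hkj => ?_, fun k j => hDrec.isComplexRational (p, k, j)⟩
    have h1 : ∀ t, N t p.2 ≤ N p.1 p.2 → inner ℂ (e j) (A t p.2 (e k)) = 0 := by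
      intro t ht
      have h2 := ht
      have h3 := (hFN t p.2).trans ht
      rw [hAe, entry_eq_zero (hkj.imp h3.trans h3.trans)]
      have : (decide (k = j) && decide (k < N t p.2)) = false := by
        rw [Bool.and_eq_false_iff, decide_eq_false_iff_not, decide_eq_false_iff_not]
        omega
      rw [this]
      simp
    rcases p with ⟨_ | t, s⟩
    · simp [D, h1 0 le_rfl]
    · have h2 := h1 (t + 1) le_rfl
      have h3 := h1 t (hNmono t s)
      simp only [D, _root_.smul_apply, _root_.sub_apply, inner_smul_right, inner_sub_right]
      simp [h2, h3]
  obtain ⟨d, hd, hdD⟩ := exists_computable_opOf_eq hon hgen hD0 hNc hDrange hDrec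
  refine ⟨d, hd, fun T S => ?_, fun s => ⟨fun t => opOf e (F t s), fun t => opOf_nonneg e _,
    fun x => ?_, fun T => ?_⟩⟩
  · simp only [hdD]
    rcases T with _ | T
    · simp
    · simp only [hDsum]
      rw [← Finset.smul_sum]
      have h1 : ∑ s ∈ S, A T s ≤ ((2 : ℝ) : ℂ) • 1 := by
        refine (Finset.sum_le_sum fun s _ => hAR T s).trans ?_
        rw [Finset.sum_add_distrib, ← Finset.sum_smul, ← Complex.ofReal_sum]
        refine (add_le_add (hR.sum_le_one S)
          (op_smul_le_smul_of_le op_one_nonneg (sum_half_pow_encode_le_one S))).trans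
          (le_of_eq ?_)
        rw [Complex.ofReal_one, one_smul, Complex.ofReal_ofNat, two_smul]
      refine (op_smul_le_smul h1 (by norm_num)).trans (le_of_eq ?_)
      rw [smul_smul, ← Complex.ofReal_mul]
      norm_num
  · have := (hlim s x).comp (tendsto_add_atTop_nat (Encodable.encode s + 3))
    refine this.congr fun t => ?_
    simp only [F, Function.comp_apply]
    rw [add_comm]
  · simp only [hdD, hDsum]
    exact op_smul_le_smul (hAF T s) (by norm_num)

/-- A lower-computable semi-POVM is dominated by a computable sequence of items. -/
theorem exists_item_sequence (he : IsComputableOrthonormalBasis φ e)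
    (he' : IsComputableOrthonormalBasis φ e') {R : List Bool → X →L[ℂ] X} (hR : IsSemiPOVM R)
    (hR' : IsLowerComputableWrt e' R) :
    ∃ x : ℕ → Item, Computable x ∧ (∀ K, ∑ k ∈ Finset.range K, opOf e (x k).2 ≤ 1) ∧
      ∀ s (c : ℝ) (M : X →L[ℂ] X), 0 ≤ c → IsSelfAdjoint M →
        (∀ K, (c : ℂ) • ∑ k ∈ Finset.range K, opOf e (itemAt (some (x k)) s) ≤ M) →
        ((c / 2 : ℝ) : ℂ) • R s ≤ M := by
  obtain ⟨d, hd, hd1, hd2⟩ := exists_increments he he' hR hR'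
  let x : ℕ → Item := fun k => (Encodable.decode₂ (List Bool) k.unpair.2).elim ([], [])
    fun s => (s, d (k.unpair.1, s))
  have hx0 : ∀ k, Encodable.decode₂ (List Bool) k.unpair.2 = none → (x k).2 = [] := by
    intro k hk
    simp only [x, hk, Option.elim_none]
  have hx1 : ∀ k s, Encodable.decode₂ (List Bool) k.unpair.2 = some s →
      x k = (s, d (k.unpair.1, s)) := by
    intro k s hk
    simp only [x, hk, Option.elim_some]
  have hx : Computable x := by
    have h1 : Computable fun y : ℕ × List Bool => (y.2, d (y.1.unpair.1, y.2)) :=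
      Computable.snd.pair (hd.comp (((Computable.fst.comp Computable.unpair).comp
        Computable.fst).pair Computable.snd))
    have h2 : Computable fun k : ℕ => Encodable.decode₂ (List Bool) k.unpair.2 :=
      Primrec.decode₂.to_comp.comp (Computable.snd.comp Computable.unpair)
    refine (Computable.option_casesOn (f := fun _ => (([], []) : Item)) h2
      (Computable.const _) h1.to₂).of_eq fun k => ?_
    cases h : Encodable.decode₂ (List Bool) k.unpair.2 with
    | none => simp only [x, h, Option.elim_none]
    | some s => simp only [x, h, Option.elim_some]
  refine ⟨x, hx, fun K => ?_, fun s c M hc hM h => ?_⟩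
  · -- the nontrivial ones of the first `K` items lie in a rectangle
    let Q : Finset ℕ := (Finset.range K).filter fun k =>
      (Encodable.decode₂ (List Bool) k.unpair.2).isSome = true
    have hQ : ∀ k ∈ Q, ∃ s, Encodable.decode₂ (List Bool) k.unpair.2 = some s ∧
        Encodable.encode s = k.unpair.2 := by
      intro k hk
      obtain ⟨s, hs⟩ := Option.isSome_iff_exists.1 (Finset.mem_filter.1 hk).2
      exact ⟨s, hs, Encodable.mem_decode₂.1 hs⟩
    let ρ : ℕ → List Bool × ℕ := fun k => ((x k).1, k.unpair.1)
    have hinj : Set.InjOn ρ Q := by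
      intro k hk k' hk' hkk'
      obtain ⟨s, hs, hs'⟩ := hQ k hk
      obtain ⟨r, hr, hr'⟩ := hQ k' hk'
      simp only [ρ, hx1 k s hs, hx1 k' r hr, Prod.mk.injEq] at hkk'
      rw [← Nat.pair_unpair k, ← Nat.pair_unpair k', hkk'.2, ← hs', ← hr', hkk'.1]
    have h1 : ∑ k ∈ Finset.range K, opOf e (x k).2 =
        ∑ p ∈ Q.image ρ, opOf e (d (p.2, p.1)) := by
      rw [Finset.sum_image hinj, ← Finset.sum_filter_of_ne (s := Finset.range K)
        (p := fun k => (Encodable.decode₂ (List Bool) k.unpair.2).isSome = true)]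
      · refine Finset.sum_congr rfl fun k hk => ?_
        obtain ⟨s, hs, -⟩ := hQ k hk
        simp only [ρ, hx1 k s hs]
      · intro k _ hk
        by_contra hn
        rw [Option.not_isSome_iff_eq_none] at hn
        exact hk (by rw [hx0 k hn, opOf_nil])
    have h2 : Q.image ρ ⊆ ((Q.image ρ).image Prod.fst) ×ˢ Finset.range K := by
      intro p hp
      refine Finset.mem_product.2 ⟨Finset.mem_image_of_mem _ hp, ?_⟩
      obtain ⟨k, hk, rfl⟩ := Finset.mem_image.1 hp
      exact Finset.mem_range.2 ((Nat.unpair_left_le k).trans_lt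
        (Finset.mem_range.1 (Finset.mem_filter.1 hk).1))
    rw [h1]
    refine (Finset.sum_le_sum_of_subset_of_nonneg h2 fun _ _ _ => opOf_nonneg e _).trans ?_
    rw [Finset.sum_product]
    exact hd1 K _
  · obtain ⟨F, hF0, hF, hFd⟩ := hd2 s
    refine op_le_of_tendsto_const (l := atTop) (T := fun t => ((c / 2 : ℝ) : ℂ) • F t)
      (fun y => ?_)
      (fun t => isSelfAdjoint_ofReal_smul (isSelfAdjoint_of_op_nonneg (hF0 t)) _) hM
      (Eventually.of_forall fun T => ?_)
    · exact (hF y).const_smul _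
    · let K := ∑ t ∈ Finset.range (T + 1), (Nat.pair t (Encodable.encode s) + 1)
      refine le_trans ?_ (h K)
      have h1 : ∑ t ∈ Finset.range (T + 1), opOf e (d (t, s)) ≤
          ∑ k ∈ Finset.range K, opOf e (itemAt (some (x k)) s) := by
        let P : Finset ℕ := (Finset.range (T + 1)).image fun t => Nat.pair t (Encodable.encode s)
        have hP : P ⊆ Finset.range K := by
          intro k hk
          obtain ⟨t, ht, rfl⟩ := Finset.mem_image.1 hk
          exact Finset.mem_range.2 (Nat.lt_of_succ_le (Finset.single_le_sum
            (f := fun t => Nat.pair t (Encodable.encode s) + 1) (fun _ _ => Nat.zero_le _) ht))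
        refine le_trans (le_of_eq ?_) (Finset.sum_le_sum_of_subset_of_nonneg hP
          fun _ _ _ => opOf_nonneg e _)
        rw [Finset.sum_image fun t _ t' _ htt' => (Nat.pair_eq_pair.1 htt').1]
        refine Finset.sum_congr rfl fun t _ => ?_
        rw [hx1 _ s (by rw [Nat.unpair_pair]; exact Encodable.encodek₂ s)]
        simp [itemAt]
      have h2 := op_smul_le_smul ((hFd T).trans h1) hc
      rw [smul_smul, ← Complex.ofReal_mul] at h2
      exact h2

end Increments

/-! ### Effective orthonormalization -/

section Orthonormalization

set_option linter.unusedSectionVars false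

open Filter Topology

variable {X : Type*} [NormedAddCommGroup X] [InnerProductSpace ℂ X]

theorem inner_self_eq_ofReal (y : X) : inner ℂ y y = ((‖y‖ ^ 2 : ℝ) : ℂ) := by
  rw [inner_self_eq_norm_sq_to_K]
  norm_cast

/-- The first `n` terms of `u` are orthonormal. -/
def OrthonormalUpTo (n : ℕ) (u : ℕ → X) : Prop :=
  ∀ i < n, ∀ j < n, inner ℂ (u i) (u j) = if i = j then (1 : ℂ) else 0

theorem OrthonormalUpTo.norm_eq_one {n : ℕ} {u : ℕ → X} (hu : OrthonormalUpTo n u) {i : ℕ}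
    (hi : i < n) : ‖u i‖ = 1 := by
  have h := hu i hi i hi
  have h' : ‖u i‖ ^ 2 = 1 := by
    rw [← inner_self_eq_norm_sq (𝕜 := ℂ), h]
    simp
  nlinarith [norm_nonneg (u i)]

/-- The component of `y` orthogonal to the first `n` terms of `u`. -/
noncomputable def orthResidual (n : ℕ) (u : ℕ → X) (y : X) : X :=
  y - ∑ j ∈ Finset.range n, (inner ℂ (u j) y : ℂ) • u j

theorem OrthonormalUpTo.inner_orthResidual {n : ℕ} {u : ℕ → X} (hu : OrthonormalUpTo n u) {i : ℕ}
    (hi : i < n) (y : X) : inner ℂ (u i) (orthResidual n u y) = 0 := by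
  rw [orthResidual, inner_sub_right, inner_sum]
  have : ∀ j ∈ Finset.range n, inner ℂ (u i) ((inner ℂ (u j) y : ℂ) • u j) =
      if i = j then inner ℂ (u j) y else 0 := by
    intro j hj
    rw [inner_smul_right, hu i hi j (Finset.mem_range.1 hj)]
    split_ifs <;> simp
  rw [Finset.sum_congr rfl this]
  simp [hi]

theorem OrthonormalUpTo.inner_orthResidual_self {n : ℕ} {u : ℕ → X} (hu : OrthonormalUpTo n u)
    (y : X) : inner ℂ (orthResidual n u y) y = ((‖orthResidual n u y‖ ^ 2 : ℝ) : ℂ) := by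
  have h : inner ℂ (orthResidual n u y) (orthResidual n u y) = inner ℂ (orthResidual n u y) y := by
    conv_lhs => enter [3]; rw [orthResidual]
    rw [inner_sub_right, inner_sum, Finset.sum_eq_zero, sub_zero]
    intro j hj
    rw [inner_smul_right, ← inner_conj_symm (orthResidual n u y),
      hu.inner_orthResidual (Finset.mem_range.1 hj)]
    simp
  rw [← h, inner_self_eq_ofReal]

theorem OrthonormalUpTo.norm_sq_eq {n : ℕ} {u : ℕ → X} (hu : OrthonormalUpTo n u) (y : X) :
    ‖y‖ ^ 2 = ∑ j ∈ Finset.range n, ‖(inner ℂ (u j) y : ℂ)‖ ^ 2 + ‖orthResidual n u y‖ ^ 2 := by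
  have h := hu.inner_orthResidual_self y
  conv_lhs at h => rw [orthResidual]
  rw [inner_sub_left, sum_inner, inner_self_eq_ofReal] at h
  have h2 : ∀ j ∈ Finset.range n, inner ℂ ((inner ℂ (u j) y : ℂ) • u j) y =
      ((‖(inner ℂ (u j) y : ℂ)‖ ^ 2 : ℝ) : ℂ) := by
    intro j _
    rw [inner_smul_left, mul_comm, Complex.mul_conj, Complex.normSq_eq_norm_sq]
  rw [Finset.sum_congr rfl h2, ← Complex.ofReal_sum] at h
  have h3 : ‖y‖ ^ 2 - ∑ j ∈ Finset.range n, ‖(inner ℂ (u j) y : ℂ)‖ ^ 2 =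
      ‖orthResidual n u y‖ ^ 2 := by exact_mod_cast h
  linarith

theorem OrthonormalUpTo.update {n : ℕ} {u : ℕ → X} (hu : OrthonormalUpTo n u) {v : X}
    (hv : ‖v‖ = 1) (huv : ∀ i < n, inner ℂ (u i) v = 0) :
    OrthonormalUpTo (n + 1) (Function.update u n v) := by
  intro i hi j hj
  rcases Nat.lt_succ_iff_lt_or_eq.1 hi with hi | rfl <;>
    rcases Nat.lt_succ_iff_lt_or_eq.1 hj with hj | rfl
  · rw [Function.update_of_ne hi.ne, Function.update_of_ne hj.ne]
    exact hu i hi j hj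
  · rw [Function.update_of_ne hi.ne, Function.update_self, huv i hi, if_neg hi.ne]
  · rw [Function.update_of_ne hj.ne, Function.update_self, ← inner_conj_symm, huv j hj,
      if_neg hj.ne', map_zero]
  · rw [Function.update_self, if_pos rfl, inner_self_eq_norm_sq_to_K, hv]
    simp

theorem OrthonormalUpTo.normalize_orthResidual {n : ℕ} {u : ℕ → X} (hu : OrthonormalUpTo n u)
    {y : X} (hy : orthResidual n u y ≠ 0) :
    ‖((‖orthResidual n u y‖⁻¹ : ℝ) : ℂ) • orthResidual n u y‖ = 1 ∧
      ∀ i < n, inner ℂ (u i) (((‖orthResidual n u y‖⁻¹ : ℝ) : ℂ) • orthResidual n u y) = 0 := by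
  refine ⟨?_, fun i hi => by rw [inner_smul_right, hu.inner_orthResidual hi, mul_zero]⟩
  rw [norm_smul, Complex.norm_real, norm_inv, norm_norm, inv_mul_cancel₀ (norm_ne_zero_iff.2 hy)]

/-- In infinite dimension, a finite orthonormal system can be extended by one vector so that its
span contains a given vector (which Parseval's identity expresses). -/
theorem OrthonormalUpTo.exists_extension (hX : ¬ FiniteDimensional ℂ X) {n : ℕ} {u : ℕ → X}
    (hu : OrthonormalUpTo n u) (y : X) :
    ∃ v : X, OrthonormalUpTo (n + 1) (Function.update u n v) ∧
      ‖y‖ ^ 2 = ∑ j ∈ Finset.range (n + 1), ‖(inner ℂ (Function.update u n v j) y : ℂ)‖ ^ 2 := by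
  have hsum : ∀ v, ∑ j ∈ Finset.range (n + 1), ‖(inner ℂ (Function.update u n v j) y : ℂ)‖ ^ 2 =
      ∑ j ∈ Finset.range n, ‖(inner ℂ (u j) y : ℂ)‖ ^ 2 + ‖(inner ℂ v y : ℂ)‖ ^ 2 := by
    intro v
    rw [Finset.sum_range_succ, Function.update_self]
    congr 1
    refine Finset.sum_congr rfl fun j hj => ?_
    rw [Function.update_of_ne (Finset.mem_range.1 hj).ne]
  by_cases hz : orthResidual n u y = 0
  · -- `y` is in the span already; any orthogonal unit vector will do
    obtain ⟨q, hq⟩ : ∃ q, orthResidual n u q ≠ 0 := by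
      by_contra hall
      push Not at hall
      classical
      refine hX (Module.finite_def.2 ⟨(Finset.range n).image u, ?_⟩)
      refine eq_top_iff.2 fun q _ => ?_
      rw [sub_eq_zero.1 (hall q)]
      exact Submodule.sum_mem _ fun j hj => Submodule.smul_mem _ _
        (Submodule.subset_span (Finset.mem_coe.2 (Finset.mem_image_of_mem u hj)))
    obtain ⟨h1, h2⟩ := hu.normalize_orthResidual hq
    refine ⟨_, hu.update h1 h2, ?_⟩
    rw [hsum, hu.norm_sq_eq y, hz]
    have hy : y = ∑ j ∈ Finset.range n, (inner ℂ (u j) y : ℂ) • u j := sub_eq_zero.1 hz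
    have : inner ℂ (((‖orthResidual n u q‖⁻¹ : ℝ) : ℂ) • orthResidual n u q) y = 0 := by
      rw [hy, inner_sum]
      refine Finset.sum_eq_zero fun j hj => ?_
      rw [inner_smul_right, ← inner_conj_symm _ (u j), h2 j (Finset.mem_range.1 hj)]
      simp
    rw [this]
    simp
  · obtain ⟨h1, h2⟩ := hu.normalize_orthResidual hz
    refine ⟨_, hu.update h1 h2, ?_⟩
    rw [hsum, hu.norm_sq_eq y, inner_smul_left, hu.inner_orthResidual_self, Complex.conj_ofReal,
      ← Complex.ofReal_mul, Complex.norm_real, Real.norm_eq_abs, sq_abs]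
    congr 1
    have := norm_ne_zero_iff.2 hz
    field_simp

/-- Vectors whose Gram matrix is close to the identity are close to an orthonormal system; the bound
comes from the Gram–Schmidt process. -/
theorem exists_orthonormalUpTo_near (K : ℕ) {δ : ℝ} (hδ : 0 ≤ δ) (hK : 8 ^ K * δ ≤ 8⁻¹) {w : ℕ → X}
    (hw : ∀ i < K, ∀ j < K, ‖(inner ℂ (w i) (w j) : ℂ) - if i = j then 1 else 0‖ ≤ δ) :
    ∃ u, OrthonormalUpTo K u ∧ ∀ i < K, ‖u i - w i‖ ≤ 8 ^ (i + 1) * δ := by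
  induction K with
  | zero => exact ⟨w, fun i hi => absurd hi (Nat.not_lt_zero i), fun i hi =>
      absurd hi (Nat.not_lt_zero i)⟩
  | succ K ih =>
    have hKδ : 8 ^ K * δ ≤ 8⁻¹ :=
      (mul_le_mul_of_nonneg_right (pow_le_pow_right₀ (by norm_num) K.le_succ) hδ).trans hK
    obtain ⟨u, hu, huw⟩ := ih hKδ fun i hi j hj => hw i (by omega) j (by omega)
    have hKlt := Nat.lt_succ_self K
    have h8 : (1 : ℝ) ≤ 8 ^ (K + 1) := one_le_pow₀ (by norm_num)
    have hδ1 : δ ≤ 1 := by nlinarith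
    have hnorm : |‖w K‖ - 1| ≤ δ := by
      have h1 := hw K hKlt K hKlt
      rw [if_pos rfl, inner_self_eq_norm_sq_to_K] at h1
      have h2 : |‖w K‖ ^ 2 - 1| ≤ δ := by
        rw [← Real.norm_eq_abs, ← Complex.norm_real]
        push_cast
        exact h1
      have h3 : ‖w K‖ ^ 2 - 1 = (‖w K‖ - 1) * (‖w K‖ + 1) := by ring
      rw [h3, abs_mul, abs_of_nonneg (by positivity : (0 : ℝ) ≤ ‖w K‖ + 1)] at h2
      nlinarith [abs_nonneg (‖w K‖ - 1), norm_nonneg (w K)]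
    have hwK : ‖w K‖ ≤ 2 := by linarith [(abs_le.1 hnorm).2]
    -- `S K` bounds the correction which makes `w K` orthogonal to `u 0, …, u (K - 1)`
    let S : ℕ → ℝ := fun k => ∑ j ∈ Finset.range k, (δ + 8 ^ (j + 1) * δ * 2)
    have hS : ∀ k, δ + 2 * S k ≤ 8 ^ (k + 1) * δ := by
      intro k
      induction k with
      | zero => simp [S]; linarith
      | succ k ih =>
        have h1 : S (k + 1) = S k + (δ + 8 ^ (k + 1) * δ * 2) := Finset.sum_range_succ _ _
        have h2 : (1 : ℝ) ≤ 8 ^ (k + 1) := one_le_pow₀ (by norm_num)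
        rw [h1, pow_succ _ (k + 1)]
        nlinarith [mul_nonneg hδ (sub_nonneg.2 h2)]
    have hcorr : ‖orthResidual K u (w K) - w K‖ ≤ S K := by
      have h1 : orthResidual K u (w K) - w K =
          -∑ j ∈ Finset.range K, (inner ℂ (u j) (w K) : ℂ) • u j := by
        rw [orthResidual]; abel
      rw [h1, norm_neg]
      refine (norm_sum_le _ _).trans (Finset.sum_le_sum fun j hj => ?_)
      have hj := Finset.mem_range.1 hj
      rw [norm_smul, hu.norm_eq_one hj, mul_one]
      have h2 : (inner ℂ (u j) (w K) : ℂ) = inner ℂ (w j) (w K) + inner ℂ (u j - w j) (w K) := by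
        rw [← inner_add_left, add_sub_cancel]
      have h3 := hw j (by omega) K hKlt
      rw [if_neg hj.ne, sub_zero] at h3
      rw [h2]
      refine (norm_add_le _ _).trans (add_le_add h3 ((norm_inner_le_norm _ _).trans ?_))
      exact mul_le_mul (huw j hj) hwK (norm_nonneg _) (by positivity)
    have hSK := hS K
    have hres : |‖orthResidual K u (w K)‖ - 1| ≤ δ + S K := by
      have h1 := (abs_norm_sub_norm_le _ _).trans hcorr
      calc |‖orthResidual K u (w K)‖ - 1|
          = |(‖orthResidual K u (w K)‖ - ‖w K‖) + (‖w K‖ - 1)| := by ring_nf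
        _ ≤ _ := (abs_add_le _ _).trans (by linarith)
    have hS0 : 0 ≤ S K := Finset.sum_nonneg fun j _ => by positivity
    have hne : orthResidual K u (w K) ≠ 0 := by
      intro h0
      rw [h0, norm_zero, zero_sub, abs_neg, abs_one] at hres
      linarith
    obtain ⟨h1, h2⟩ := hu.normalize_orthResidual hne
    refine ⟨_, hu.update h1 h2, fun i hi => ?_⟩
    rcases Nat.lt_succ_iff_lt_or_eq.1 hi with hi | rfl
    · rw [Function.update_of_ne hi.ne]
      exact huw i hi
    · rw [Function.update_self]
      set r := orthResidual i u (w i) with hr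
      have h3 : ‖((‖r‖⁻¹ : ℝ) : ℂ) • r - r‖ = |‖r‖ - 1| := by
        have : ((‖r‖⁻¹ : ℝ) : ℂ) • r - r = (((‖r‖⁻¹ - 1 : ℝ)) : ℂ) • r := by
          push_cast; rw [sub_smul, one_smul]
        rw [this, norm_smul, Complex.norm_real, Real.norm_eq_abs]
        nth_rewrite 2 [← abs_norm r]
        rw [← abs_mul, sub_mul, inv_mul_cancel₀ (norm_ne_zero_iff.2 hne), one_mul, abs_sub_comm]
      calc ‖((‖r‖⁻¹ : ℝ) : ℂ) • r - w i‖ = ‖(((‖r‖⁻¹ : ℝ) : ℂ) • r - r) + (r - w i)‖ := by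
            rw [sub_add_sub_cancel]
        _ ≤ (δ + S i) + S i := (norm_add_le _ _).trans (add_le_add (h3.trans_le hres) hcorr)
        _ ≤ _ := by linarith

/-- The quantity to be made `< 1` in step `n`, from the system `w` of length `n` to the system `w'`
of length `n + 1`: the systems are close, `w'` is nearly orthonormal, and `y` is nearly in the span
of `w'`. The weights are chosen so that the three kinds of deviation are then at most `4⁻ⁿ`,
`8⁻²⁽ⁿ⁺¹⁾` and `2⁻ⁿ`. -/
noncomputable def stepDefect (n : ℕ) (y : X) (w w' : ℕ → X) : ℝ :=
  ∑ i ∈ Finset.range n, 16 ^ n * ‖w' i - w i‖ ^ 2 +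
    ∑ i ∈ Finset.range (n + 1), ∑ j ∈ Finset.range (n + 1),
      8 ^ (4 * (n + 1)) * ‖(inner ℂ (w' i) (w' j) : ℂ) - if i = j then 1 else 0‖ ^ 2 +
    4 ^ n * (‖y‖ ^ 2 - ∑ i ∈ Finset.range (n + 1), ‖(inner ℂ (w' i) y : ℂ)‖ ^ 2) ^ 2

section StepDefect

variable {n : ℕ} {y : X} {w w' : ℕ → X}

theorem norm_sub_le_of_stepDefect_lt (h : stepDefect n y w w' < 1) {i : ℕ} (hi : i < n) :
    ‖w' i - w i‖ ≤ (4⁻¹ : ℝ) ^ n := by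
  have h1 := Finset.single_le_sum (f := fun i => (16 : ℝ) ^ n * ‖w' i - w i‖ ^ 2)
    (fun _ _ => by positivity) (Finset.mem_range.2 hi)
  have h2 : (16 : ℝ) ^ n * ‖w' i - w i‖ ^ 2 ≤ 1 := by
    refine h1.trans (le_trans ?_ h.le)
    rw [stepDefect, add_assoc]
    exact le_add_of_nonneg_right (by positivity)
  refine le_of_sq_le_sq ?_ (by positivity)
  have h3 : ((4⁻¹ : ℝ) ^ n) ^ 2 = ((16 : ℝ) ^ n)⁻¹ := by
    rw [← pow_mul, mul_comm, pow_mul, ← inv_pow]; norm_num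
  rw [h3, inv_eq_one_div, le_div_iff₀ (by positivity), mul_comm]
  exact h2

theorem norm_gram_sub_le_of_stepDefect_lt (h : stepDefect n y w w' < 1) {i j : ℕ} (hi : i < n + 1)
    (hj : j < n + 1) :
    ‖(inner ℂ (w' i) (w' j) : ℂ) - if i = j then 1 else 0‖ ≤ (8⁻¹ : ℝ) ^ (2 * (n + 1)) := by
  have h0 := Finset.single_le_sum (f := fun j => (8 : ℝ) ^ (4 * (n + 1)) *
    ‖(inner ℂ (w' i) (w' j) : ℂ) - if i = j then 1 else 0‖ ^ 2)
    (fun _ _ => by positivity) (Finset.mem_range.2 hj)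
  have h1 := Finset.single_le_sum (f := fun i => ∑ j ∈ Finset.range (n + 1),
    (8 : ℝ) ^ (4 * (n + 1)) * ‖(inner ℂ (w' i) (w' j) : ℂ) - if i = j then 1 else 0‖ ^ 2)
    (fun _ _ => by positivity) (Finset.mem_range.2 hi)
  have h2 : (8 : ℝ) ^ (4 * (n + 1)) *
      ‖(inner ℂ (w' i) (w' j) : ℂ) - if i = j then 1 else 0‖ ^ 2 ≤ 1 := by
    refine (h0.trans h1).trans (le_trans ?_ h.le)
    rw [stepDefect, add_right_comm]
    exact le_add_of_nonneg_left (by positivity)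
  refine le_of_sq_le_sq ?_ (by positivity)
  have h3 : ((8⁻¹ : ℝ) ^ (2 * (n + 1))) ^ 2 = ((8 : ℝ) ^ (4 * (n + 1)))⁻¹ := by
    rw [← pow_mul, ← inv_pow]; congr 1; ring
  rw [h3, inv_eq_one_div, le_div_iff₀ (by positivity), mul_comm]
  exact h2

theorem norm_sq_sub_le_of_stepDefect_lt (h : stepDefect n y w w' < 1) :
    ‖y‖ ^ 2 - ∑ i ∈ Finset.range (n + 1), ‖(inner ℂ (w' i) y : ℂ)‖ ^ 2 ≤ (2⁻¹ : ℝ) ^ n := by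
  have h2 : (4 : ℝ) ^ n * (‖y‖ ^ 2 - ∑ i ∈ Finset.range (n + 1),
      ‖(inner ℂ (w' i) y : ℂ)‖ ^ 2) ^ 2 ≤ 1 := by
    refine le_trans ?_ h.le
    rw [stepDefect]
    exact le_add_of_nonneg_left (by positivity)
  refine le_of_sq_le_sq ?_ (by positivity)
  have h3 : ((2⁻¹ : ℝ) ^ n) ^ 2 = ((4 : ℝ) ^ n)⁻¹ := by
    rw [← pow_mul, mul_comm, pow_mul, ← inv_pow]; norm_num
  rw [h3, inv_eq_one_div, le_div_iff₀ (by positivity), mul_comm]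
  exact h2

theorem stepDefect_congr {w₁ w₁' : ℕ → X} (h : ∀ i < n, w i = w₁ i)
    (h' : ∀ i < n + 1, w' i = w₁' i) :
    stepDefect n y w w' = stepDefect n y w₁ w₁' := by
  have h1 : ∑ i ∈ Finset.range n, (16 : ℝ) ^ n * ‖w' i - w i‖ ^ 2 =
      ∑ i ∈ Finset.range n, 16 ^ n * ‖w₁' i - w₁ i‖ ^ 2 := by
    refine Finset.sum_congr rfl fun i hi => ?_
    have := Finset.mem_range.1 hi
    rw [h i this, h' i (by omega)]
  have h2 : ∑ i ∈ Finset.range (n + 1), ∑ j ∈ Finset.range (n + 1),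
      (8 : ℝ) ^ (4 * (n + 1)) * ‖(inner ℂ (w' i) (w' j) : ℂ) - if i = j then 1 else 0‖ ^ 2 =
      ∑ i ∈ Finset.range (n + 1), ∑ j ∈ Finset.range (n + 1),
        8 ^ (4 * (n + 1)) * ‖(inner ℂ (w₁' i) (w₁' j) : ℂ) - if i = j then 1 else 0‖ ^ 2 := by
    refine Finset.sum_congr rfl fun i hi => Finset.sum_congr rfl fun j hj => ?_
    rw [h' i (Finset.mem_range.1 hi), h' j (Finset.mem_range.1 hj)]
  have h3 : ∑ i ∈ Finset.range (n + 1), ‖(inner ℂ (w' i) y : ℂ)‖ ^ 2 =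
      ∑ i ∈ Finset.range (n + 1), ‖(inner ℂ (w₁' i) y : ℂ)‖ ^ 2 :=
    Finset.sum_congr rfl fun i hi => by rw [h' i (Finset.mem_range.1 hi)]
  rw [stepDefect, stepDefect, h1, h2, h3]

theorem continuous_stepDefect : Continuous fun w' : ℕ → X => stepDefect n y w w' := by
  unfold stepDefect
  fun_prop

end StepDefect

end Orthonormalization

/-! ### A computable orthonormal basis -/

section OrthonormalBasis

set_option linter.unusedSectionVars false

open Filter Topology

section Inner

variable {X : Type*} [NormedAddCommGroup X] [InnerProductSpace ℂ X]
  {φ : ComputabilityStructure X} {α : Type*} [Primcodable α] {x : ℕ → X}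

/-- By polarization, inner products are computable along with norms. -/
theorem isComputableComplex_inner_vec (hx : x ∈ φ.seqs) :
    IsComputableComplex fun p : VecCode × VecCode => (inner ℂ (vec x p.1) (vec x p.2) : ℂ) := by
  have key : ∀ {s t : VecCode × VecCode → ℝ}, IsComputableReal s → IsComputableReal t →
      IsComputableReal fun p => (s p * s p - t p * t p) / 4 := fun hs ht =>
    (((hs.mul hs).sub (ht.mul ht)).mul (.const (1 / 4))).of_eq fun p => by push_cast; ring
  have h1 := computable_norm_vec_add_smul hx hx (θ := 1) ⟨1, 0, by simp⟩
  have h2 := computable_norm_vec_add_smul hx hx (θ := -1) ⟨-1, 0, by simp⟩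
  have h3 := computable_norm_vec_add_smul hx hx (θ := Complex.I) ⟨0, 1, by simp⟩
  have h4 := computable_norm_vec_add_smul hx hx (θ := -Complex.I) ⟨0, -1, by simp⟩
  refine ⟨(key h1 h2).of_eq fun p => ?_, (key h4 h3).of_eq fun p => ?_⟩
  · have := re_inner_eq_norm_add_mul_self_sub_norm_sub_mul_self_div_four (𝕜 := ℂ)
      (vec x p.1) (vec x p.2)
    rw [one_smul, neg_one_smul, ← sub_eq_add_neg]
    exact this.symm
  · have := im_inner_eq_norm_sub_i_smul_mul_self_sub_norm_add_i_smul_mul_self_div_four (𝕜 := ℂ)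
      (vec x p.1) (vec x p.2)
    rw [neg_smul, ← sub_eq_add_neg]
    exact this.symm

theorem isComputableReal_norm_inner_sub_sq (hx : x ∈ φ.seqs) {a b : α → VecCode}
    (ha : Computable a) (hb : Computable b) {r : α → ℚ} (hr : IsComputableRat r) :
    IsComputableReal fun p => ‖(inner ℂ (vec x (a p)) (vec x (b p)) : ℂ) - (r p : ℂ)‖ ^ 2 := by
  have h := isComputableComplex_inner_vec hx
  have h1 := (h.1.comp (f := fun p => (a p, b p)) (ha.pair hb)).sub (.ratCast hr)
  have h2 := h.2.comp (f := fun p => (a p, b p)) (ha.pair hb)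
  refine ((h1.mul h1).add (h2.mul h2)).of_eq fun p => ?_
  rw [← Complex.normSq_eq_norm_sq, Complex.normSq_apply]
  simp

theorem isComputableReal_stepDefect (hx : x ∈ φ.seqs) {n : α → ℕ} (hn : Computable n)
    {c : α → VecCode} (hc : Computable c) {a b : α × ℕ → VecCode} (ha : Computable a)
    (hb : Computable b) :
    IsComputableReal fun p => stepDefect (n p) (vec x (c p)) (fun i => vec x (a (p, i)))
      fun i => vec x (b (p, i)) := by
  have hn1 : Computable fun p : α => n p + 1 := Computable.succ.comp hn
  have hc1 : Computable fun q : α × ℕ => c q.1 := hc.comp Computable.fst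
  have pow : ∀ {γ : Type _} [Primcodable γ] {k : γ → ℕ}, Computable k →
      IsComputableReal fun q => (((2 : ℚ) ^ k q : ℚ) : ℝ) :=
    fun hk => .ratCast (.two_pow hk)
  have h1 : IsComputableReal fun q : α × ℕ =>
      (16 : ℝ) ^ n q.1 * ‖vec x (b q) - vec x (a q)‖ ^ 2 := by
    have h := (computable_norm_vec_sub hx hx).comp (f := fun q : α × ℕ => (b q, a q)) (hb.pair ha)
    have hk : Computable fun q : α × ℕ => 4 * n q.1 :=
      (Computable.const 4).nat_mul (hn.comp Computable.fst)
    refine ((pow hk).mul (h.mul h)).of_eq fun q => ?_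
    push_cast
    rw [pow_mul, ← sq]
    norm_num
  have h2 : IsComputableReal fun q : (α × ℕ) × ℕ => (8 : ℝ) ^ (4 * (n q.1.1 + 1)) *
      ‖(inner ℂ (vec x (b q.1)) (vec x (b (q.1.1, q.2))) : ℂ) -
        if q.1.2 = q.2 then 1 else 0‖ ^ 2 := by
    have hb1 : Computable fun q : (α × ℕ) × ℕ => b q.1 := hb.comp Computable.fst
    have hi : Computable fun q : (α × ℕ) × ℕ => (q.1.1, q.2) :=
      (Computable.fst.comp Computable.fst).pair Computable.snd
    have hb2 : Computable fun q : (α × ℕ) × ℕ => b (q.1.1, q.2) := hb.comp hi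
    have hd : Computable fun q : (α × ℕ) × ℕ => decide (q.1.2 = q.2) :=
      (Computable.snd.comp Computable.fst).decide_eq Computable.snd
    have hk : Computable fun q : (α × ℕ) × ℕ => 3 * (4 * (n q.1.1 + 1)) :=
      (Computable.const 3).nat_mul ((Computable.const 4).nat_mul
        (hn1.comp (Computable.fst.comp Computable.fst)))
    refine ((pow hk).mul (isComputableReal_norm_inner_sub_sq hx hb1 hb2
      (.cond hd (.const 1) (.const 0)))).of_eq fun q => ?_
    push_cast
    rw [pow_mul]
    by_cases h : q.1.2 = q.2 <;> simp [h] <;> norm_num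
  have h3 : IsComputableReal fun q : α × ℕ => ‖(inner ℂ (vec x (b q)) (vec x (c q.1)) : ℂ)‖ ^ 2 :=
    (isComputableReal_norm_inner_sub_sq hx hb hc1 (.const 0)).of_eq fun q => by simp
  have h4 := (((computable_norm_vec_sub hx hx).comp (f := fun p : α => (c p, ([] : VecCode)))
    (hc.pair (Computable.const [])))).of_eq (t' := fun p => ‖vec x (c p)‖) fun p => by simp [vec]
  have h5 := (h4.mul h4).sub (h3.sum_range hn1)
  have h6 : IsComputableReal fun q : α × ℕ => ∑ j ∈ Finset.range (n q.1 + 1),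
      (8 : ℝ) ^ (4 * (n q.1 + 1)) *
      ‖(inner ℂ (vec x (b q)) (vec x (b (q.1, j))) : ℂ) - if q.2 = j then 1 else 0‖ ^ 2 :=
    h2.sum_range (hn1.comp Computable.fst)
  have h7 := (h1.sum_range hn).add (h6.sum_range hn1)
  have hk : Computable fun p : α => 2 * n p := (Computable.const 2).nat_mul hn
  refine (h7.add ((pow hk).mul (h5.mul h5))).of_eq fun p => ?_
  rw [stepDefect]
  congr 1
  push_cast
  rw [pow_mul, ← sq, ← sq]
  norm_num

end Inner

section Limit

variable {X : Type*} [NormedAddCommGroup X] [InnerProductSpace ℂ X] [CompleteSpace X]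

/-- Systems `w n` of length `n` whose step defects are small converge to an orthonormal sequence,
whose closed span contains every vector that is treated infinitely often. -/
theorem exists_orthonormal_limit {y : ℕ → X} {w : ℕ → ℕ → X}
    (h : ∀ n, stepDefect n (y n) (w n) (w (n + 1)) < 1) :
    ∃ e : ℕ → X, Orthonormal ℂ e ∧ (∀ n i, i < n → ‖w n i - e i‖ ≤ 2 * (4⁻¹ : ℝ) ^ n) ∧
      ∀ z, (∃ᶠ n in atTop, y n = z) → z ∈ closure (Submodule.span ℂ (Set.range e) : Set X) := by
  have hstep : ∀ i n, dist (w (n + i + 1) i) (w (n + 1 + i + 1) i) ≤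
      (4⁻¹ : ℝ) ^ (i + 1) * 4⁻¹ ^ n := by
    intro i n
    rw [dist_comm, dist_eq_norm, ← pow_add, show n + 1 + i + 1 = n + i + 1 + 1 by ring,
      show i + 1 + n = n + i + 1 by ring]
    exact norm_sub_le_of_stepDefect_lt (h (n + i + 1)) (by omega)
  choose e he using fun i => cauchySeq_tendsto_of_complete
    (cauchySeq_of_le_geometric _ _ (by norm_num) (hstep i))
  have hdist : ∀ n i, i < n → ‖w n i - e i‖ ≤ 2 * (4⁻¹ : ℝ) ^ n := by
    intro n i hi
    obtain ⟨k, rfl⟩ : ∃ k, n = k + i + 1 := ⟨n - i - 1, by omega⟩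
    have h1 := dist_le_of_le_geometric_of_tendsto _ _ (by norm_num) (hstep i) (he i) k
    rw [dist_eq_norm, ← pow_add, show i + 1 + k = k + i + 1 by ring] at h1
    refine h1.trans ?_
    rw [div_le_iff₀ (by norm_num)]
    have : (0 : ℝ) < 4⁻¹ ^ (k + i + 1) := by positivity
    linarith
  have hlim : ∀ i, Tendsto (fun n => w n i) atTop (𝓝 (e i)) := by
    intro i
    rw [← tendsto_add_atTop_iff_nat (i + 1)]
    exact he i
  have horth : Orthonormal ℂ e := by
    rw [orthonormal_iff_ite]
    intro i j
    have h1 : Tendsto (fun n => (inner ℂ (w (n + 1) i) (w (n + 1) j) : ℂ)) atTop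
        (𝓝 (inner ℂ (e i) (e j))) :=
      ((hlim i).inner (hlim j)).comp (tendsto_add_atTop_nat 1)
    refine tendsto_nhds_unique h1 ?_
    rw [tendsto_iff_norm_sub_tendsto_zero]
    have h2 : Tendsto (fun n : ℕ => (8⁻¹ : ℝ) ^ (2 * (n + 1))) atTop (𝓝 0) :=
      (tendsto_pow_atTop_nhds_zero_of_lt_one (by norm_num) (by norm_num)).comp
        (tendsto_atTop_mono (fun n => show n ≤ 2 * (n + 1) by omega) tendsto_id)
    refine squeeze_zero' (Eventually.of_forall fun n => norm_nonneg _) ?_ h2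
    filter_upwards [eventually_ge_atTop (max i j)] with n hn
    exact norm_gram_sub_le_of_stepDefect_lt (h n) (by omega) (by omega)
  refine ⟨e, horth, hdist, fun z hz => ?_⟩
  have hup : ∀ n, OrthonormalUpTo n e := fun n i _ j _ => orthonormal_iff_ite.1 horth i j
  -- the distance of `z` from the span of the first `n + 1` basis vectors
  have hres : ∀ n, y n = z →
      ‖orthResidual (n + 1) e z‖ ^ 2 ≤ (1 + 4 * ‖z‖ ^ 2) * (2⁻¹ : ℝ) ^ n := by
    intro n hn
    have h1 := norm_sq_sub_le_of_stepDefect_lt (h n)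
    rw [hn] at h1
    have h2 := (hup (n + 1)).norm_sq_eq z
    have h3 : ∑ i ∈ Finset.range (n + 1), ‖(inner ℂ (w (n + 1) i) z : ℂ)‖ ^ 2 ≤
        ∑ i ∈ Finset.range (n + 1),
          (‖(inner ℂ (e i) z : ℂ)‖ ^ 2 + 8 * (4⁻¹ : ℝ) ^ (n + 1) * ‖z‖ ^ 2) := by
      refine Finset.sum_le_sum fun i hi => ?_
      have h4 := hdist (n + 1) i (Finset.mem_range.1 hi)
      have h5 : ‖(inner ℂ (w (n + 1) i) z : ℂ)‖ ≤
          ‖(inner ℂ (e i) z : ℂ)‖ + 2 * (4⁻¹ : ℝ) ^ (n + 1) * ‖z‖ := by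
        calc ‖(inner ℂ (w (n + 1) i) z : ℂ)‖
            = ‖(inner ℂ (e i) z : ℂ) + inner ℂ (w (n + 1) i - e i) z‖ := by
              rw [← inner_add_left, add_sub_cancel]
          _ ≤ _ := (norm_add_le _ _).trans (add_le_add le_rfl ((norm_inner_le_norm _ _).trans
              (mul_le_mul_of_nonneg_right h4 (norm_nonneg _))))
      have h6 : ‖(inner ℂ (e i) z : ℂ)‖ ≤ ‖z‖ := by
        simpa [horth.1 i] using norm_inner_le_norm (𝕜 := ℂ) (e i) z
      have h7 : (4⁻¹ : ℝ) ^ (n + 1) ≤ 1 := pow_le_one₀ (by norm_num) (by norm_num)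
      have h8 : (0 : ℝ) ≤ 4⁻¹ ^ (n + 1) := by positivity
      set q := (4⁻¹ : ℝ) ^ (n + 1)
      have h9 := norm_nonneg z
      calc ‖(inner ℂ (w (n + 1) i) z : ℂ)‖ ^ 2
          ≤ (‖(inner ℂ (e i) z : ℂ)‖ + 2 * q * ‖z‖) ^ 2 := pow_le_pow_left₀ (norm_nonneg _) h5 2
        _ = ‖(inner ℂ (e i) z : ℂ)‖ ^ 2 + 4 * q * ‖z‖ * ‖(inner ℂ (e i) z : ℂ)‖ +
            4 * q * ‖z‖ ^ 2 * q := by ring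
        _ ≤ ‖(inner ℂ (e i) z : ℂ)‖ ^ 2 + 4 * q * ‖z‖ * ‖z‖ + 4 * q * ‖z‖ ^ 2 * 1 := by gcongr
        _ = _ := by ring
    rw [Finset.sum_add_distrib, Finset.sum_const, Finset.card_range, nsmul_eq_mul] at h3
    have h4 : ((n + 1 : ℕ) : ℝ) ≤ 2 ^ (n + 1) := by exact_mod_cast (Nat.lt_two_pow_self).le
    have h5 : ((n + 1 : ℕ) : ℝ) * (8 * (4⁻¹ : ℝ) ^ (n + 1) * ‖z‖ ^ 2) ≤
        4 * ‖z‖ ^ 2 * (2⁻¹ : ℝ) ^ n := by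
      calc ((n + 1 : ℕ) : ℝ) * (8 * (4⁻¹ : ℝ) ^ (n + 1) * ‖z‖ ^ 2)
          ≤ 2 ^ (n + 1) * (8 * (4⁻¹ : ℝ) ^ (n + 1) * ‖z‖ ^ 2) := by gcongr
        _ = 8 * ‖z‖ ^ 2 * (2 * 4⁻¹ : ℝ) ^ (n + 1) := by rw [mul_pow]; ring
        _ = 4 * ‖z‖ ^ 2 * (2⁻¹ : ℝ) ^ n := by
          rw [show (2 * 4⁻¹ : ℝ) = 2⁻¹ by norm_num, pow_succ]; ring
    linarith
  refine Metric.mem_closure_iff.2 fun ε hε => ?_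
  have h0 : Tendsto (fun n : ℕ => (1 + 4 * ‖z‖ ^ 2) * (2⁻¹ : ℝ) ^ n) atTop (𝓝 0) := by
    simpa using (tendsto_pow_atTop_nhds_zero_of_lt_one (r := (2⁻¹ : ℝ)) (by norm_num)
      (by norm_num)).const_mul (1 + 4 * ‖z‖ ^ 2)
  obtain ⟨n, hn, hε'⟩ := (hz.and_eventually (h0.eventually_lt_const (pow_pos hε 2))).exists
  refine ⟨∑ j ∈ Finset.range (n + 1), (inner ℂ (e j) z : ℂ) • e j, Submodule.sum_mem _ fun j _ =>
    Submodule.smul_mem _ _ (Submodule.subset_span ⟨j, rfl⟩), ?_⟩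
  rw [dist_eq_norm]
  exact lt_of_pow_lt_pow_left₀ 2 hε.le ((hres n hn).trans_lt hε')

end Limit

section Chain

variable {X : Type*} [NormedAddCommGroup X] [InnerProductSpace ℂ X]
  {φ : ComputabilityStructure X} {x : ℕ → X}

/-- The sequence of Gaussian rational combinations of `x` coded by the list `W`, continued by
`0`. -/
noncomputable def vecSeq (x : ℕ → X) (W : List VecCode) (i : ℕ) : X := vec x (W[i]?.getD [])

/-- The search in step `n` succeeds: extend the orthonormal system near `w`, and approximate it by
Gaussian rational combinations. -/
theorem exists_stepDefect_vecSeq_lt (hX : ¬ FiniteDimensional ℂ X) (hg : IsGeneratingSet x) {n : ℕ}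
    {u w : ℕ → X} (y : X) (hu : OrthonormalUpTo n u) (huw : ∀ i < n, ‖u i - w i‖ ≤ (8⁻¹ : ℝ) ^ n) :
    ∃ W, stepDefect n y w (vecSeq x W) < 1 := by
  obtain ⟨v, hv, hy⟩ := hu.exists_extension hX y
  have h1 : stepDefect n y w (Function.update u n v) < 1 := by
    have h2 : ∑ i ∈ Finset.range (n + 1), ∑ j ∈ Finset.range (n + 1), (8 : ℝ) ^ (4 * (n + 1)) *
        ‖(inner ℂ (Function.update u n v i) (Function.update u n v j) : ℂ) -
          if i = j then 1 else 0‖ ^ 2 = 0 :=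
      Finset.sum_eq_zero fun i hi => Finset.sum_eq_zero fun j hj => by
        rw [hv i (Finset.mem_range.1 hi) j (Finset.mem_range.1 hj)]; simp
    have h3 : ∑ i ∈ Finset.range n, (16 : ℝ) ^ n * ‖Function.update u n v i - w i‖ ^ 2 ≤
        ∑ i ∈ Finset.range n, (4⁻¹ : ℝ) ^ n := by
      refine Finset.sum_le_sum fun i hi => ?_
      have hi := Finset.mem_range.1 hi
      rw [Function.update_of_ne hi.ne]
      calc (16 : ℝ) ^ n * ‖u i - w i‖ ^ 2 ≤ 16 ^ n * ((8⁻¹ : ℝ) ^ n) ^ 2 := by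
            gcongr; exact huw i hi
        _ = 4⁻¹ ^ n := by rw [← pow_mul, mul_comm n 2, pow_mul, ← mul_pow]; norm_num
    rw [Finset.sum_const, Finset.card_range, nsmul_eq_mul] at h3
    have h4 : (n : ℝ) * 4⁻¹ ^ n < 1 := by
      rw [inv_pow, ← div_eq_mul_inv, div_lt_one (by positivity)]
      exact_mod_cast Nat.lt_pow_self (by norm_num)
    rw [stepDefect, h2, ← hy, sub_self]
    simp only [ne_eq, OfNat.ofNat_ne_zero, not_false_eq_true, zero_pow, mul_zero, add_zero]
    exact h3.trans_lt h4
  have hd : DenseRange (Pi.map fun _ : ℕ => vec x) := DenseRange.piMap fun _ => denseRange_vec hg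
  obtain ⟨q, hq⟩ := hd.exists_mem_open (continuous_stepDefect.isOpen_preimage _ isOpen_Iio) ⟨_, h1⟩
  refine ⟨(List.range (n + 1)).map q, lt_of_eq_of_lt (stepDefect_congr (fun _ _ => rfl)
    fun i hi => ?_) hq⟩
  simp [vecSeq, hi]

/-- The system found in one step is good enough for the next step. -/
theorem exists_orthonormalUpTo_of_stepDefect_lt {n : ℕ} {y : X} {w w' : ℕ → X}
    (h : stepDefect n y w w' < 1) :
    ∃ u, OrthonormalUpTo (n + 1) u ∧ ∀ i < n + 1, ‖u i - w' i‖ ≤ (8⁻¹ : ℝ) ^ (n + 1) := by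
  have h1 : (8 : ℝ) ^ (n + 1) * 8⁻¹ ^ (2 * (n + 1)) = 8⁻¹ ^ (n + 1) := by
    generalize n + 1 = m
    rw [two_mul, pow_add, ← mul_assoc, ← mul_pow]
    norm_num
  have h2 : (8⁻¹ : ℝ) ^ (n + 1) ≤ 8⁻¹ := by
    rw [pow_succ]
    exact mul_le_of_le_one_left (by norm_num) (pow_le_one₀ (by norm_num) (by norm_num))
  obtain ⟨u, hu, huw⟩ := exists_orthonormalUpTo_near (n + 1) (w := w')
    (δ := (8⁻¹ : ℝ) ^ (2 * (n + 1))) (by positivity) (h1.trans_le h2)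
    fun i hi j hj => norm_gram_sub_le_of_stepDefect_lt h hi hj
  refine ⟨u, hu, fun i hi => (huw i hi).trans (le_of_le_of_eq ?_ h1)⟩
  gcongr
  · norm_num
  · omega

theorem exists_computable_chain_stepDefect (hX : ¬ FiniteDimensional ℂ X) (hx : x ∈ φ.seqs)
    (hg : IsGeneratingSet x) {γ : ℕ → VecCode} (hγ : Computable γ) :
    ∃ f : ℕ → List VecCode, Computable f ∧
      ∀ n, stepDefect n (vec x (γ n)) (vecSeq x (f n)) (vecSeq x (f (n + 1))) < 1 := by
  have hn : Computable fun p : (ℕ × List VecCode) × List VecCode => p.1.1 :=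
    Computable.fst.comp Computable.fst
  have hγn : Computable fun p : (ℕ × List VecCode) × List VecCode => γ p.1.1 := hγ.comp hn
  have h1 : Computable fun q : ((ℕ × List VecCode) × List VecCode) × ℕ =>
      (q.1.1.2[q.2]?.getD [] : VecCode) :=
    Computable.option_getD (Computable.list_getElem?.comp
      (Computable.snd.comp (Computable.fst.comp Computable.fst)) Computable.snd)
      (Computable.const [])
  have h2 : Computable fun q : ((ℕ × List VecCode) × List VecCode) × ℕ =>
      (q.1.2[q.2]?.getD [] : VecCode) :=
    Computable.option_getD (Computable.list_getElem?.comp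
      (Computable.snd.comp Computable.fst) Computable.snd) (Computable.const [])
  have ht : IsComputableReal fun p : (ℕ × List VecCode) × List VecCode =>
      stepDefect p.1.1 (vec x (γ p.1.1)) (vecSeq x p.1.2) (vecSeq x p.2) :=
    isComputableReal_stepDefect hx hn hγn
      (a := fun q : ((ℕ × List VecCode) × List VecCode) × ℕ => q.1.1.2[q.2]?.getD [])
      (b := fun q : ((ℕ × List VecCode) × List VecCode) × ℕ => q.1.2[q.2]?.getD []) h1 h2
  let valid : ℕ → List VecCode → Prop := fun n W =>
    ∃ u, OrthonormalUpTo n u ∧ ∀ i < n, ‖u i - vecSeq x W i‖ ≤ (8⁻¹ : ℝ) ^ n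
  have h₀ : valid 0 [] := ⟨0, fun i hi => absurd hi (Nat.not_lt_zero i),
    fun i hi => absurd hi (Nat.not_lt_zero i)⟩
  have hex : ∀ n W, valid n W →
      ∃ W', stepDefect n (vec x (γ n)) (vecSeq x W) (vecSeq x W') < 1 :=
    fun n W ⟨u, hu, huw⟩ => exists_stepDefect_vecSeq_lt hX hg _ hu huw
  have hpres : ∀ n W W', valid n W →
      stepDefect n (vec x (γ n)) (vecSeq x W) (vecSeq x W') < 1 → valid (n + 1) W' :=
    fun n W W' _ hW => exists_orthonormalUpTo_of_stepDefect_lt hW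
  obtain ⟨f, hf, -, h⟩ := exists_computable_chain ht valid [] h₀ hex hpres
  exact ⟨f, hf, h⟩

theorem vec_comp_mem_seqs (hx : x ∈ φ.seqs) {c : ℕ → VecCode} (hc : Computable c) :
    (fun n => vec x (c n)) ∈ φ.seqs := by
  have h1 : IsRecursiveComplexRational fun p : ℕ × ℕ => coef (c p.1) p.2 :=
    isRecursiveComplexRational_coef.comp (f := fun p : ℕ × ℕ => (c p.1, p.2))
      ((hc.comp Computable.fst).pair Computable.snd)
  have h2 : IsRecursiveComplexRational fun _ : ℕ × ℕ => ((0 : ℚ) : ℂ) := .ratCast (.const 0)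
  convert φ.linear_forms x hx x hx _ _ h1.isComputableComplex h2.isComputableComplex _
    (Computable.list_length.comp hc) using 2 with n
  rw [vec_eq_sum_range x (Nat.le_succ _)]
  simp

end Chain

variable {X : Type*} [NormedAddCommGroup X] [InnerProductSpace ℂ X] [CompleteSpace X]
  {φ : ComputabilityStructure X}

/-- The basis is the limit of a computable chain of finite systems of Gaussian rational combinations
of a computable generating sequence. -/
theorem exists_isComputableOrthonormalBasis (hX : ¬ FiniteDimensional ℂ X)
    (hφ : φ.IsEffectivelySeparable) : ∃ e, IsComputableOrthonormalBasis φ e := by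
  obtain ⟨x, hx, hg⟩ := hφ
  -- every code occurs infinitely often in the enumeration `γ`
  let γ : ℕ → VecCode := fun n => (Encodable.decode n.unpair.1).getD []
  have hγ : Computable γ := Computable.option_getD
    (Computable.decode.comp (Computable.fst.comp Computable.unpair)) (Computable.const [])
  have hγ' : ∀ v, ∃ᶠ n in atTop, γ n = v := fun v => frequently_atTop.2 fun k =>
    ⟨Nat.pair (Encodable.encode v) k, Nat.right_le_pair _ _, by simp [γ]⟩
  obtain ⟨f, hf, h⟩ := exists_computable_chain_stepDefect hX hx hg hγ
  obtain ⟨e, he, hdist, hcl⟩ := exists_orthonormal_limit (w := fun n => vecSeq x (f n)) h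
  refine ⟨e, ?_, he, ?_⟩
  · have h1 : Computable fun p : ℕ × ℕ => (f (p.1 + 1 + p.2))[p.1]?.getD [] :=
      Computable.option_getD (Computable.list_getElem?.comp
        (hf.comp ((Computable.succ.comp Computable.fst).nat_add Computable.snd)) Computable.fst)
        (Computable.const [])
    refine φ.limits (fun n m => vecSeq x (f (n + 1 + m)) n) e (fun p => p.2)
      (vec_comp_mem_seqs hx (h1.comp Computable.unpair)) Computable.snd fun n k => ?_
    refine (hdist (n + 1 + k) n (by omega)).trans ?_
    calc 2 * (4⁻¹ : ℝ) ^ (n + 1 + k) ≤ 2 * (4⁻¹ : ℝ) ^ (1 + k) := by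
          gcongr ?_ * ?_
          exact pow_le_pow_of_le_one (by norm_num) (by norm_num) (by omega)
      _ = 2⁻¹ * 4⁻¹ ^ k := by rw [pow_add]; ring
      _ ≤ 1 * 2⁻¹ ^ k := by gcongr <;> norm_num
      _ = _ := one_mul _
  · refine dense_closure.1 ((denseRange_vec hg).mono ?_)
    rintro _ ⟨v, rfl⟩
    exact hcl _ ((hγ' v).mono fun n hn => by rw [hn])

end OrthonormalBasis

theorem mainTheorem1 {X : Type*} [NormedAddCommGroup X] [InnerProductSpace ℂ X] [CompleteSpace X]
    (hX : ¬ FiniteDimensional ℂ X) (φ : ComputabilityStructure X)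
    (hφ : φ.IsEffectivelySeparable) :
    ∃ M : List Bool → X →L[ℂ] X, IsUniversalSemiPOVM φ M := by
  obtain ⟨e, he⟩ := exists_isComputableOrthonormalBasis hX hφ
  obtain ⟨M, hM, hM', hdom⟩ := exists_dominating_semiPOVM he.2.1 he.2.2
  refine ⟨M, ⟨hM, e, he, hM'⟩, fun R ⟨hR, e', he', hR'⟩ => ?_⟩
  obtain ⟨x, hx, hx1, hxR⟩ := exists_item_sequence he he' hR hR'
  obtain ⟨c, hc, hcM⟩ := hdom x hx hx1
  exact ⟨c / 2, half_pos hc, fun s => hxR s c (M s) hc.le (hM.1 s).isSelfAdjoint fun K => hcM K s⟩
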